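/- **Setting.** There are $K\ge 2$ arms. Arm $i$ has mean reward $\mu_i\in[0,1]$, drawn independently from a prior $\mathcal P_i$ on $[0,1]$ with mean $\mu_i^0$; pulling arm $i$ gives an independent Bernoulli($\mu_i$) reward. A bandit algorithm recommends in each round $t$ an arm $A_t$, at random, depending on the past arms and rewards. It is BIC in round $t$ if, when all recommendations are followed, $\mathbb E[\mu_i-\mu_j\mid A_t=i]\ge 0$ for all arms $i,j$ with $\Pr[A_t=i]>0$. Let $A^*$ be the arm with the largest $\mu_i$ (smallest index in case of ties); Thompson Sampling draws the arm from the posterior distribution of $A^*$ given the past arms and rewards. Write $\mu_q=\sum_i q_i\mu_i$ for a distribution $q$ over arms, $\mathrm{ZEROS}_{j,n}$ for the event that the first $n$ samples of each arm $i<j$ are all $0$, $x_+=\max(x,0)$ and $x_-=\max(-x,0)$. For absolute constants $C_{\rm TS},C_{\rm pad}$ let $$\varepsilon_{\rm TS}=\min_{i\ne j}\mathbb E[(\mu_i-\mu_j)_+],\quad \delta_{\rm TS}=\min_i\Pr[A^*=i],\quad N_{\rm TS}=C_{\rm TS}\,\varepsilon_{\rm TS}^{-2}\log\delta_{\rm TS}^{-1},$$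 $$G_{\rm pad}=\min_{j,\;q\text{ supported on }\{i<j\}}\mathbb E[(\mu_j-\mu_q)_+],\quad N_{\rm pad}=C_{\rm pad}\,G_{\rm pad}^{-2}\log G_{\rm pad}^{-1},$$ $$N_{\rm boot}=\min\{n:\mathbb E[\mu_j-\mu_i\mid \mathrm{ZEROS}_{j,n}]>0\ \ \forall i<j\},\quad p_{\rm boot}=\min_j\Pr[\mathrm{ZEROS}_{j,N_{\rm boot}}],\quad L=\sup_{j,q}\frac{\mathbb E[(\mu_j-\mu_q)_-]}{\mathbb E[(\mu_j-\mu_q)_+]},$$ $$\mathrm{UB}(N)=K\max(N,N_{\rm boot},N_{\rm pad})\,G_{\rm pad}^{-1}\log(G_{\rm pad}^{-1}p_{\rm boot}^{-1}),\qquad \mathrm{LB}=\max(K,N_{\rm boot},L),$$ the quantities $N_{\rm boot}$, $L$, $\mathrm{LB}$ being allowed to be $\infty$ (and $0/0=0$ in $L$). Let $\mathcal C$ be a finite or infinite collection of probability distributions on $[0,1]$; an instance is $\mathcal C$-consistent if all its priors lie in $\mathcal C$. Let $\Phi_{\mathcal C}=\sup_{\mathcal P\in\mathcal C}\mathbb E[\mathcal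 P]$ and $\sup(\mathcal P)=\sup(\mathrm{support}(\mathcal P))$. For $\delta>0$, $\mathcal C$ is *$\delta$-easy* if $\inf_{\mathcal P\in\mathcal C}\mathbb E_{\mu\sim\mathcal P}[(\mu-\Phi_{\mathcal C})_+]>\delta$; *$\delta$-hard* if $\inf_{\mathcal P\in\mathcal C}\Pr_{\mu\sim\mathcal P}[\mu\ge\Phi_{\mathcal C}-\delta]=0$; *$\delta$-non-dominant* if $\mathbb E[(\mu_j^0-\mu_i)_+]\ge\delta$ for all arms $i\ne j$ of every $\mathcal C$-consistent instance. (An infimum over the empty collection is $+\infty$.) **Theorem.** (a) Let $C_{\rm TS},C_{\rm pad}$ be large enough absolute constants. There are $A$ and $a$, depending only on them, such that for all $\delta>0$, every $\delta$-easy and $\delta$-non-dominant $\mathcal C$, and every $\mathcal C$-consistent instance with $K\ge2$ arms, with $B:=A\,\frac{K^3}{\delta^4}\log^a(K/\delta)$: $\mathrm{UB}(N_{\rm TS})\le B$, and there are $T\le B$ and an algorithm that is BIC in rounds $1,\dots,T$, almost surely collects at least $N_{\rm TS}$ samples of each arm in these rounds, and remains BIC in all rounds when it is followed by Thompson Sampling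 from round $T+1$ on. (b) For every $\delta>0$ there is $c>0$, depending only on $\delta$, such that for every $\delta$-hard $\mathcal C$ and every $K\ge2$ there is a $\mathcal C$-consistent instance with $K$ arms, ordered so that $\mu_1^0\ge\dots\ge\mu_K^0$, for which $\mathrm{LB}>e^{cK}$, and every algorithm that is BIC in rounds $1,\dots,T$ and almost surely samples each arm at least once in these rounds has $T>e^{cK}$. (c) If $\mathcal C$ is finite and non-empty and $\min_{\mathcal P\in\mathcal C}\sup(\mathcal P)\ne\Phi_{\mathcal C}$, then for some $\delta>0$ it is either $\delta$-easy or $\delta$-hard, and not both. -/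

import Mathlib

open MeasureTheory
open scoped ENNReal

noncomputable section

namespace IncentivizedExploration

/-- A prior: a probability distribution over `[0,1]`. -/
abbrev Prior : Type := ProbabilityMeasure unitInterval

/-- The expectation `E[𝒫]` of a prior. -/
def mean (Q : Prior) : ℝ := ∫ x, (x : ℝ) ∂(Q : Measure unitInterval)

/-- The supremum of the support of a prior. -/
def supSupport (Q : Prior) : ℝ :=
  sSup ((fun x : unitInterval => (x : ℝ)) '' (Q : Measure unitInterval).support)

/-- `Φ_𝒞`, the supremum of the prior mean rewards over the collection `𝒞`. -/
def Phi (C : Set Prior) : ℝ := sSup (mean '' C)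

/-- `𝒞` is `δ`-easy: `inf_{𝒫 ∈ 𝒞} E_{μ ∼ 𝒫} (μ - Φ_𝒞)₊ > δ`. -/
def IsEasy (δ : ℝ) (C : Set Prior) : Prop :=
  ENNReal.ofReal δ <
    ⨅ Q ∈ C, ∫⁻ x, ENNReal.ofReal ((x : ℝ) - Phi C) ∂((Q : Prior) : Measure unitInterval)

/-- `𝒞` is `δ`-hard: `inf_{𝒫 ∈ 𝒞} Pr_{μ ∼ 𝒫} [μ ≥ Φ_𝒞 - δ] = 0`. -/
def IsHard (δ : ℝ) (C : Set Prior) : Prop :=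
  ⨅ Q ∈ C, ((Q : Prior) : Measure unitInterval) {x | Phi C - δ ≤ (x : ℝ)} = 0

/-- The problem instance with priors `P 0, …, P (K-1)` is `𝒞`-consistent. -/
def IsConsistent (C : Set Prior) {K : ℕ} (P : Fin K → Prior) : Prop := ∀ i, P i ∈ C

/-- `𝒞` is `δ`-non-dominant: `E (μ_j⁰ - μ_i)₊ ≥ δ` for any two arms `i ≠ j` of any
`𝒞`-consistent instance. -/
def IsNonDominant (δ : ℝ) (C : Set Prior) : Prop :=
  ∀ (K : ℕ) (P : Fin K → Prior), IsConsistent C P → ∀ i j : Fin K, i ≠ j →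
    ENNReal.ofReal δ ≤
      ∫⁻ x, ENNReal.ofReal (mean (P j) - (x : ℝ)) ∂((P i : Prior) : Measure unitInterval)

section Instance

variable {K : ℕ}

/-- The joint prior `𝒫_1 × ⋯ × 𝒫_K` of the mean rewards. -/
def jointPrior (P : Fin K → Prior) : Measure (Fin K → unitInterval) :=
  Measure.pi fun i => ((P i : Prior) : Measure unitInterval)

/-! ### Bandit algorithms, incentive compatibility -/

/-- Histories: the list of (arm, reward) pairs of the past rounds, most recent round first. -/
abbrev History (K : ℕ) : Type := List (Fin K × Bool)

/-- A (randomized) bandit algorithm: a distribution of the next arm, given the history. -/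
abbrev Algorithm (K : ℕ) : Type := History K → PMF (Fin K)

/-- The Bernoulli reward of an arm with mean reward `m`. -/
def rewardPMF (m : unitInterval) : PMF Bool :=
  PMF.ofFintype (fun r => cond r (ENNReal.ofReal m) (ENNReal.ofReal (1 - m))) (by
    rw [Fintype.sum_bool]
    simp only [cond_true, cond_false]
    rw [← ENNReal.ofReal_add m.2.1 (by linarith [m.2.2])]
    simp)

/-- The law of the history of the first `t` rounds, given the mean rewards `μ`, if all
recommendations of the algorithm are followed. -/
def historyLaw (alg : Algorithm K) (μ : Fin K → unitInterval) : ℕ → PMF (History K)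
  | 0 => PMF.pure []
  | t + 1 => (historyLaw alg μ t).bind fun h => (alg h).bind fun a =>
      (rewardPMF (μ a)).bind fun r => PMF.pure ((a, r) :: h)

/-- The probability, given the mean rewards `μ`, that arm `i` is recommended after `t` rounds
have been played. -/
def recProb (alg : Algorithm K) (t : ℕ) (i : Fin K) (μ : Fin K → unitInterval) : ℝ :=
  (((historyLaw alg μ t).bind alg) i).toReal

/-- The conditional expectation `E[μ_i - μ_j ∣ A = i]`, where `A` is the arm recommended after
`t` rounds; the mean rewards are drawn from the joint prior. -/
def condGap (P : Fin K → Prior) (alg : Algorithm K) (t : ℕ) (i j : Fin K) : ℝ :=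
  (∫ μ, ((μ i : ℝ) - μ j) * recProb alg t i μ ∂(jointPrior P)) /
    ∫ μ, recProb alg t i μ ∂(jointPrior P)

/-- The recommendation made after `t` rounds (in round `t + 1`) is Bayesian-incentive
compatible. -/
def IsBICAt (P : Fin K → Prior) (alg : Algorithm K) (t : ℕ) : Prop :=
  ∀ i j : Fin K, 0 < ∫ μ, recProb alg t i μ ∂(jointPrior P) → 0 ≤ condGap P alg t i j

/-- The algorithm is Bayesian-incentive compatible (BIC) in its first `T` rounds. -/
def IsBIC (P : Fin K → Prior) (alg : Algorithm K) (T : ℕ) : Prop :=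
  ∀ t < T, IsBICAt P alg t

/-- Almost surely, the algorithm collects at least `N` samples of each arm in its first `T`
rounds. -/
def Collects (P : Fin K → Prior) (alg : Algorithm K) (T : ℕ) (N : ℝ≥0∞) : Prop :=
  ∀ᵐ μ ∂(jointPrior P), ∀ h ∈ (historyLaw alg μ T).support, ∀ i : Fin K,
    N ≤ ((h.map Prod.fst).count i : ℝ≥0∞)

/-! ### Thompson Sampling -/

/-- The event `A* = i`: arm `i` is the best arm, ties being broken in favour of smaller
indices. -/
def bestArm (i : Fin K) : Set (Fin K → unitInterval) :=
  {μ | (∀ j, μ j ≤ μ i) ∧ ∀ j < i, μ j < μ i}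

/-- The likelihood of the rewards of a history, given the mean rewards. -/
def likelihood (h : History K) (μ : Fin K → unitInterval) : ℝ :=
  (h.map fun p => if p.2 then (μ p.1 : ℝ) else 1 - μ p.1).prod

/-- The posterior weight of the event `A* = i` given the history, before normalization. -/
def posteriorWeight (P : Fin K → Prior) (h : History K) (i : Fin K) : ℝ≥0∞ :=
  ∫⁻ μ in bestArm i, ENNReal.ofReal (likelihood h μ) ∂(jointPrior P)

open Classical in
/-- The algorithm that runs `alg` for `T` rounds and Thompson Sampling afterwards: from then on,
the arm is drawn from the posterior distribution of the best arm `A*` given the history. (The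
posterior is undefined for histories of probability zero only; there, `alg` is kept.) -/
def thenThompson (P : Fin K → Prior) (alg : Algorithm K) (T : ℕ) : Algorithm K := fun h =>
  if h.length < T then alg h
  else if hw : (∑' i, posteriorWeight P h i) ≠ 0 ∧ (∑' i, posteriorWeight P h i) ≠ ∞ then
    PMF.normalize (posteriorWeight P h) hw.1 hw.2
  else alg h

/-! ### The parameters of a problem instance -/

/-- The logarithm as a map to `[0,∞]`; it is used for arguments at least `1`. -/
def logE (x : ℝ≥0∞) : ℝ≥0∞ := (ENNReal.log x).toENNReal

/-- `ε_TS = min_{i ≠ j} E (μ_i - μ_j)₊`. -/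
def epsTS (P : Fin K → Prior) : ℝ≥0∞ :=
  ⨅ (i : Fin K) (j : Fin K) (_ : i ≠ j),
    ∫⁻ μ, ENNReal.ofReal ((μ i : ℝ) - μ j) ∂(jointPrior P)

/-- `δ_TS = min_i Pr [A* = i]`. -/
def deltaTS (P : Fin K → Prior) : ℝ≥0∞ := ⨅ i : Fin K, jointPrior P (bestArm i)

/-- `N_TS = c ε_TS⁻² log (1 / δ_TS)`, the number of samples of each arm that warm-starts
Thompson Sampling. -/
def nTS (c : ℝ) (P : Fin K → Prior) : ℝ≥0∞ :=
  ENNReal.ofReal c * (epsTS P)⁻¹ ^ 2 * logE (deltaTS P)⁻¹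

/-- `μ_q = ∑ q_i μ_i`. -/
def mix (q : Fin K → ℝ) (μ : Fin K → unitInterval) : ℝ := ∑ i, q i * (μ i : ℝ)

/-- `G_pad`, the minimum of `E (μ_j - μ_q)₊` over arms `j` and distributions `q` over the arms
`i < j`. -/
def gPad (P : Fin K → Prior) : ℝ≥0∞ :=
  ⨅ (j : Fin K) (q ∈ {q : Fin K → ℝ | q ∈ stdSimplex ℝ (Fin K) ∧ ∀ i, j ≤ i → q i = 0}),
    ∫⁻ μ, ENNReal.ofReal ((μ j : ℝ) - mix q μ) ∂(jointPrior P)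

/-- `N_pad = c G_pad⁻² log (G_pad⁻¹)`. -/
def nPad (c : ℝ) (P : Fin K → Prior) : ℝ≥0∞ :=
  ENNReal.ofReal c * (gPad P)⁻¹ ^ 2 * logE (gPad P)⁻¹

/-- The probability, given the mean rewards `μ`, of the event `ZEROS_{j,n}` that the first `n`
samples of each arm `i < j` return reward `0`. -/
def zerosGiven (j : Fin K) (n : ℕ) (μ : Fin K → unitInterval) : ℝ :=
  ∏ i ∈ Finset.Iio j, (1 - (μ i : ℝ)) ^ n

/-- `Pr [ZEROS_{j,n}]`. -/
def zerosProb (P : Fin K → Prior) (j : Fin K) (n : ℕ) : ℝ :=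
  ∫ μ, zerosGiven j n μ ∂(jointPrior P)

/-- `E[μ_j - μ_i ∣ ZEROS_{j,n}]` (it is `0`, so not positive, if the event has probability
zero). -/
def zerosGap (P : Fin K → Prior) (j i : Fin K) (n : ℕ) : ℝ :=
  (∫ μ, ((μ j : ℝ) - μ i) * zerosGiven j n μ ∂(jointPrior P)) / zerosProb P j n

/-- `N_boot`, the smallest `n` with `E[μ_j - μ_i ∣ ZEROS_{j,n}] > 0` for all arms `i < j`
(`⊤` if there is none). -/
def nBoot (P : Fin K → Prior) : ℕ∞ :=
  ⨅ n ∈ {n : ℕ | ∀ i j : Fin K, i < j → 0 < zerosGap P j i n}, (n : ℕ∞)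

/-- `p_boot = min_j Pr [ZEROS_{j,N_boot}]`; it is used for finite `N_boot`. -/
def pBoot (P : Fin K → Prior) : ℝ≥0∞ :=
  ⨅ j : Fin K, ENNReal.ofReal (zerosProb P j (nBoot P).toNat)

/-- The upper bound
`K N' G_pad⁻¹ log (G_pad⁻¹ p_boot⁻¹)`, `N' = max (N, N_boot, N_pad)`, on the number of rounds
in which exponential exploration collects `N` samples of each arm, up to a constant factor. -/
def roundsUB (cPad : ℝ) (P : Fin K → Prior) (N : ℝ≥0∞) : ℝ≥0∞ :=
  K * max N (max (nBoot P : ℝ≥0∞) (nPad cPad P)) * (gPad P)⁻¹ *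
    logE ((gPad P)⁻¹ * (pBoot P)⁻¹)

/-- `L = max_{j, q} E (μ_j - μ_q)₋ / E (μ_j - μ_q)₊`, the maximum being over all arms `j` and
all distributions `q` over arms (in `[0,∞]`, with `x / 0 = ∞` for `x > 0`, and `0 / 0 = 0`). -/
def mainLB (P : Fin K → Prior) : ℝ≥0∞ :=
  ⨆ (j : Fin K) (q ∈ stdSimplex ℝ (Fin K)),
    (∫⁻ μ, ENNReal.ofReal (mix q μ - (μ j : ℝ)) ∂(jointPrior P)) /
      ∫⁻ μ, ENNReal.ofReal ((μ j : ℝ) - mix q μ) ∂(jointPrior P)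

/-- The lower bound `max (K, N_boot, L)` on the number of rounds that a BIC algorithm needs to
sample each arm once. -/
def roundsLB (P : Fin K → Prior) : ℝ≥0∞ :=
  max (K : ℝ≥0∞) (max (nBoot P : ℝ≥0∞) (mainLB P))

end Instance

end IncentivizedExploration

end

open IncentivizedExploration

namespace IncentivizedExploration

/-! ### Integration tools and subgaussian estimates -/

section Tools

/-! Hard case. Incentives are summed over time. If `r_t(μ)` is the probability that arm `j` is
recommended in round `t`, the BIC property gives `E[(μ_j - μ_q) r_t] ≥ 0` for every mixture `q`, and
`∑ r_t` lies in `[1, T]` when arm `j` is surely sampled. Hence `E(μ_j - μ_q)₋ ≤ T E(μ_j - μ_q)₊`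
(`integral_neg_part_le_mul`). Now take `K - 1` arms with one prior of mean close to `Φ`, and a last
arm that hardly ever reaches `Φ - δ`. The average of the first arms drops to `Φ - δ` with
probability exponentially small in `K`, so for this average the right expectation is exponentially
small, while the left one has order `δ`.

Easy case, parameters. The level `Φ` separates the arms: it is at least every prior mean, each arm
exceeds it by `δ` in expectation of the positive part, and by non-dominance each arm lies below it
with probability at least `δ`. On `{μ_j > Φ}` arm `j` beats every other arm by `δ` on average; this
event does not depend on the competitor, so the bound passes to mixtures and controls `G_pad` and
`ε_TS`. Independence gives `δ_TS ≥ δ^K`, and observing zeros tilts a prior downwards geometrically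
fast, which bounds `N_boot` and `p_boot`.

Easy case, exploration. Time is cut into blocks of `N` rounds with one arm each, and the state is
one recorded block per explored arm. Arms are explored in decreasing order of prior mean. If all
explored arms look no better than the prior mean of the next arm `j`, recommending `j` is free. In
the other states `j` is explored with a small probability; the loss is paid by recommending `j`
whenever it has been explored and its posterior mean exceeds `Φ`. The gain is proportional to the
explored mass, so this mass can grow geometrically, from `(δ/2)^K` to `1` in `O(K log(K/δ)/δ)`
blocks (`IsRegular.sum_phaseRule_nonneg`, `IsRegular.reaches_insert`).

Easy case, Thompson Sampling. Given the history, the recommendation has the posterior law of `A*`,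
so the incentive for `i` over `j` is the expectation of the posterior gap on `{A* = i}`. A
correlation inequality makes the true gap there at least `δ Pr[A* = i]`
(`IsRegular.mul_measureReal_le_setIntegral`). Replacing posterior means by true means costs four
errors, each at most `(δ/4) Pr[A* = i]` by exponential moments (`sum_setIntegral_le_of_exp_le`); the
warm-up samples suffice for this at all later times.

Dichotomy. For a finite collection all infima are attained, so it only matters on which side of `Φ`
the smallest top of a support lies. -/

lemma integrable_of_abs_le {α : Type*} [MeasurableSpace α] {ν : Measure α} [IsFiniteMeasure ν]
    {f : α → ℝ} (hf : Measurable f) (c : ℝ) (h : ∀ x, |f x| ≤ c) : Integrable f ν :=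
  Integrable.of_bound hf.aestronglyMeasurable c (Filter.Eventually.of_forall h)

lemma lintegral_ofReal_eq_integral_max {α : Type*} [MeasurableSpace α] {ν : Measure α}
    {f : α → ℝ} (hf : Integrable f ν) :
    ∫⁻ x, ENNReal.ofReal (f x) ∂ν = ENNReal.ofReal (∫ x, max (f x) 0 ∂ν) := by
  rw [ofReal_integral_eq_lintegral_ofReal hf.pos_part
    (Filter.Eventually.of_forall fun x => le_max_right _ _)]
  simp

/-- Chebyshev's integral inequality. -/
lemma integral_mul_integral_le_of_similarlyOrdered {α : Type*} [MeasurableSpace α]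
    {ν : Measure α} [IsProbabilityMeasure ν] {f g : α → ℝ} (hf : Integrable f ν)
    (hg : Integrable g ν) (hfg : Integrable (fun x => f x * g x) ν)
    (h : ∀ x y, 0 ≤ (f x - f y) * (g x - g y)) :
    (∫ x, f x ∂ν) * ∫ x, g x ∂ν ≤ ∫ x, f x * g x ∂ν := by
  have key : ∀ a b c : ℝ, ∫ x, (f x * g x - a * f x - b * g x + c) ∂ν
      = (∫ x, f x * g x ∂ν) - a * (∫ x, f x ∂ν) - b * (∫ x, g x ∂ν) + c := by
    intro a b c
    have i1 : Integrable (fun x => f x * g x - a * f x) ν := hfg.sub (hf.const_mul a)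
    have i2 : Integrable (fun x => f x * g x - a * f x - b * g x) ν := i1.sub (hg.const_mul b)
    rw [integral_add i2 (integrable_const c), integral_sub i1 (hg.const_mul b),
      integral_sub hfg (hf.const_mul a), integral_const_mul, integral_const_mul]
    simp
  -- Integrating the hypothesis over two independent copies of the variable gives twice the
  -- covariance.
  have h0 : 0 ≤ ∫ y, ∫ x, (f x - f y) * (g x - g y) ∂ν ∂ν :=
    integral_nonneg fun y => integral_nonneg fun x => h x y
  have h1 : ∀ y x, (f x - f y) * (g x - g y) = f x * g x - g y * f x - f y * g x + f y * g y :=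
    fun y x => by ring
  simp_rw [h1, key] at h0
  have h2 : ∀ y, (∫ x, f x * g x ∂ν) - g y * (∫ x, f x ∂ν) - f y * (∫ x, g x ∂ν) + f y * g y
      = f y * g y - (∫ x, g x ∂ν) * f y - (∫ x, f x ∂ν) * g y + ∫ x, f x * g x ∂ν :=
    fun y => by ring
  simp_rw [h2, key] at h0
  linarith [mul_comm (∫ x, f x ∂ν) (∫ x, g x ∂ν)]

/-- For `|x| ≤ 1` this is the second-order Taylor bound together with `1 + x² ≤ exp(x²)`; for `x >
1` one has `x ≤ x²`, and for `x < -1` the left side is below `1`. The linear term disappears for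
centred variables, leaving a subgaussian bound. -/
lemma exp_le_add_exp_sq (x : ℝ) : Real.exp x ≤ x + Real.exp (x ^ 2) := by
  have h2 := Real.add_one_le_exp (x ^ 2)
  rcases le_or_gt |x| 1 with h | h
  · have := (abs_le.1 (Real.abs_exp_sub_one_sub_id_le h)).2
    linarith
  · rcases lt_abs.1 h with h | h
    · have : Real.exp x ≤ Real.exp (x ^ 2) := Real.exp_le_exp.2 (by nlinarith)
      linarith
    · have : Real.exp x ≤ 1 := Real.exp_le_one_iff.2 (by linarith)
      nlinarith

/-- A centred random variable with values in `[-1,1]` is subgaussian. -/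
lemma integral_exp_le_of_centered {α : Type*} [MeasurableSpace α] {ν : Measure α}
    [IsProbabilityMeasure ν] {Y : α → ℝ} (hY : Measurable Y) (hb : ∀ x, |Y x| ≤ 1)
    (h0 : ∫ x, Y x ∂ν = 0) (θ : ℝ) : ∫ x, Real.exp (θ * Y x) ∂ν ≤ Real.exp (θ ^ 2) := by
  have hYi : Integrable Y ν := integrable_of_abs_le hY 1 hb
  calc ∫ x, Real.exp (θ * Y x) ∂ν ≤ ∫ x, (θ * Y x + Real.exp (θ ^ 2)) ∂ν := by
        refine integral_mono ?_ ((hYi.const_mul _).add (integrable_const _)) fun x => ?_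
        · refine integrable_of_abs_le (by fun_prop) (Real.exp |θ|) fun x => ?_
          rw [Real.abs_exp]
          refine Real.exp_le_exp.2 ((le_abs_self _).trans ?_)
          rw [abs_mul]
          exact mul_le_of_le_one_right (abs_nonneg _) (hb x)
        · refine (exp_le_add_exp_sq _).trans (add_le_add le_rfl (Real.exp_le_exp.2 ?_))
          rw [mul_pow]
          have : Y x ^ 2 ≤ 1 := (sq_le_one_iff_abs_le_one _).2 (hb x)
          nlinarith [sq_nonneg θ]
    _ = Real.exp (θ ^ 2) := by
        rw [integral_add (hYi.const_mul _) (integrable_const _), integral_const_mul, h0]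
        simp

end Tools

/-! ### Single priors and the level `Φ` -/

section Priors

lemma integrable_prior (Q : Prior) {f : unitInterval → ℝ} (hf : Measurable f) (c : ℝ)
    (h : ∀ x, |f x| ≤ c) : Integrable f (Q : Measure unitInterval) :=
  integrable_of_abs_le hf c h

lemma integrable_coe (Q : Prior) :
    Integrable (fun x : unitInterval => (x : ℝ)) (Q : Measure unitInterval) :=
  integrable_prior Q (by fun_prop) 1 fun x => abs_le.2 ⟨by linarith [x.2.1], x.2.2⟩

lemma mean_nonneg (Q : Prior) : 0 ≤ mean Q := integral_nonneg fun x => x.2.1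

lemma mean_le_one (Q : Prior) : mean Q ≤ 1 := by
  have := integral_mono (integrable_coe Q) (integrable_const (1 : ℝ)) fun x => x.2.2
  simpa [mean] using this

lemma bddAbove_mean (C : Set Prior) : BddAbove (mean '' C) :=
  ⟨1, by rintro _ ⟨Q, -, rfl⟩; exact mean_le_one Q⟩

lemma mean_le_Phi {C : Set Prior} {Q : Prior} (hQ : Q ∈ C) : mean Q ≤ Phi C :=
  le_csSup (bddAbove_mean C) ⟨Q, hQ, rfl⟩

lemma Phi_nonneg (C : Set Prior) : 0 ≤ Phi C :=
  Real.sSup_nonneg (by rintro _ ⟨Q, -, rfl⟩; exact mean_nonneg Q)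

lemma Phi_le_one (C : Set Prior) : Phi C ≤ 1 :=
  Real.sSup_le (by rintro _ ⟨Q, -, rfl⟩; exact mean_le_one Q) zero_le_one

lemma integrable_coe_sub (Q : Prior) (a : ℝ) :
    Integrable (fun x : unitInterval => (x : ℝ) - a) (Q : Measure unitInterval) :=
  (integrable_coe Q).sub (integrable_const a)

lemma integrable_sub_coe (Q : Prior) (a : ℝ) :
    Integrable (fun x : unitInterval => a - (x : ℝ)) (Q : Measure unitInterval) :=
  (integrable_const a).sub (integrable_coe Q)

lemma IsEasy.lt_integral {δ : ℝ} {C : Set Prior} (h : IsEasy δ C) {Q : Prior} (hQ : Q ∈ C) :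
    δ < ∫ x, max ((x : ℝ) - Phi C) 0 ∂(Q : Measure unitInterval) := by
  have h1 := lt_of_lt_of_le h (iInf₂_le Q hQ)
  rw [lintegral_ofReal_eq_integral_max (integrable_coe_sub Q _)] at h1
  exact (ENNReal.ofReal_lt_ofReal_iff'.1 h1).1

lemma IsNonDominant.le_integral {δ : ℝ} {C : Set Prior} (hδ : 0 < δ) (h : IsNonDominant δ C)
    {Q Q' : Prior} (hQ : Q ∈ C) (hQ' : Q' ∈ C) :
    δ ≤ ∫ x, max (mean Q' - (x : ℝ)) 0 ∂(Q : Measure unitInterval) := by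
  -- The two arms are distinct even if `Q = Q'`, so the bound also compares a prior with its own
  -- mean.
  have h1 := h 2 ![Q, Q'] (by intro i; fin_cases i <;> assumption) 0 1 (by decide)
  simp only [Matrix.cons_val_zero, Matrix.cons_val_one] at h1
  rw [lintegral_ofReal_eq_integral_max (integrable_sub_coe Q _)] at h1
  refine (ENNReal.ofReal_le_ofReal_iff' .. |>.1 h1).resolve_right (not_le.2 hδ)

lemma delta_lt_one_of_easy {δ : ℝ} {C : Set Prior} (h : IsEasy δ C) {Q : Prior} (hQ : Q ∈ C) :
    δ < 1 := by
  refine (h.lt_integral hQ).trans_le ?_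
  have := integral_mono (integrable_coe_sub Q (Phi C)).pos_part (integrable_const (1 : ℝ))
    fun x => by
      have := x.2.2
      have := Phi_nonneg C
      exact max_le (by linarith) zero_le_one
  simpa using this

end Priors

/-! ### The product prior: independence and resampling of one coordinate -/

section Joint

variable {K : ℕ} (P : Fin K → Prior)

instance : IsProbabilityMeasure (jointPrior P) := by unfold jointPrior; infer_instance

lemma integral_eval (i : Fin K) {f : unitInterval → ℝ} (hf : Measurable f) :
    ∫ μ, f (μ i) ∂(jointPrior P) = ∫ x, f x ∂(P i : Measure unitInterval) := by
  rw [← (measurePreserving_eval (fun i => ((P i : Prior) : Measure unitInterval)) i).map_eq,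
    integral_map (measurable_pi_apply i).aemeasurable hf.aestronglyMeasurable]
  rfl

lemma integral_prod_eval (f : Fin K → unitInterval → ℝ) :
    ∫ μ, ∏ i, f i (μ i) ∂(jointPrior P) = ∏ i, ∫ x, f i x ∂(P i : Measure unitInterval) :=
  integral_fintype_prod_eq_prod f

lemma measurable_update_prod (i : Fin K) :
    Measurable fun p : (Fin K → unitInterval) × unitInterval => Function.update p.1 i p.2 := by
  refine measurable_pi_lambda _ fun k => ?_
  rcases eq_or_ne k i with rfl | h
  · simpa using measurable_snd
  · simp only [Function.update_of_ne h]
    fun_prop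

lemma map_update_prod (i : Fin K) :
    ((jointPrior P).prod (P i : Measure unitInterval)).map
      (fun p => Function.update p.1 i p.2) = jointPrior P := by
  symm
  refine Measure.pi_eq fun s hs => ?_
  rw [Measure.map_apply (measurable_update_prod i) (MeasurableSet.univ_pi hs)]
  have : (fun p : (Fin K → unitInterval) × unitInterval => Function.update p.1 i p.2) ⁻¹'
      (Set.univ.pi s) = (Set.univ.pi (Function.update s i Set.univ)) ×ˢ (s i) := by
    ext p
    simp only [Set.mem_preimage, Set.mem_pi, Set.mem_univ, true_imp_iff, Set.mem_prod]
    constructor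
    · refine fun h => ⟨fun k => ?_, by simpa using h i⟩
      rcases eq_or_ne k i with rfl | hk
      · simp
      · simpa [hk] using h k
    · rintro ⟨h1, h2⟩ k
      rcases eq_or_ne k i with rfl | hk
      · simpa using h2
      · simpa [hk] using h1 k
  rw [this, Measure.prod_prod, jointPrior, Measure.pi_pi,
    ← Finset.mul_prod_erase _ _ (Finset.mem_univ i),
    ← Finset.mul_prod_erase _ (fun k => (P k : Measure unitInterval) (s k)) (Finset.mem_univ i)]
  simp only [Function.update_self, measure_univ, one_mul]
  rw [mul_comm]
  congr 1
  refine Finset.prod_congr rfl fun k hk => ?_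
  rw [Function.update_of_ne (Finset.ne_of_mem_erase hk)]

/-- Resampling one coordinate does not change the joint prior. -/
lemma integral_resample (i : Fin K) {F : (Fin K → unitInterval) → ℝ} (hF : Measurable F)
    (c : ℝ) (hc : ∀ μ, |F μ| ≤ c) :
    ∫ μ, F μ ∂(jointPrior P) =
      ∫ μ, ∫ x, F (Function.update μ i x) ∂(P i : Measure unitInterval) ∂(jointPrior P) := by
  conv_lhs => rw [← map_update_prod P i]
  rw [integral_map (measurable_update_prod i).aemeasurable hF.aestronglyMeasurable]
  exact integral_prod _
    (integrable_of_abs_le (hF.comp (measurable_update_prod i)) c fun p => hc _)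

lemma integrable_joint {F : (Fin K → unitInterval) → ℝ} (hF : Measurable F)
    (c : ℝ) (hc : ∀ μ, |F μ| ≤ c) : Integrable F (jointPrior P) :=
  integrable_of_abs_le hF c hc

lemma integral_coe_eval (i : Fin K) : ∫ μ, (μ i : ℝ) ∂(jointPrior P) = mean (P i) :=
  integral_eval P i (f := fun x => (x : ℝ)) (by fun_prop)

lemma integrable_coe_eval (i : Fin K) :
    Integrable (fun μ : Fin K → unitInterval => (μ i : ℝ)) (jointPrior P) :=
  integrable_joint P (by fun_prop) 1 fun μ => abs_le.2 ⟨by linarith [(μ i).2.1], (μ i).2.2⟩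

lemma integral_mul_eval {i j : Fin K} (hij : i ≠ j) {f g : unitInterval → ℝ}
    (hf : Measurable f) (hg : Measurable g) (cf cg : ℝ) (hcf : ∀ x, |f x| ≤ cf)
    (hcg : ∀ x, |g x| ≤ cg) :
    ∫ μ, f (μ i) * g (μ j) ∂(jointPrior P) =
      (∫ x, f x ∂(P i : Measure unitInterval)) * ∫ x, g x ∂(P j : Measure unitInterval) := by
  rw [integral_resample P i (by fun_prop) (cf * cg) fun μ => by
    rw [abs_mul]
    exact mul_le_mul (hcf _) (hcg _) (abs_nonneg _) ((abs_nonneg _).trans (hcf (μ i)))]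
  simp only [Function.update_self, Function.update_of_ne hij.symm]
  simp_rw [integral_mul_const, integral_const_mul]
  rw [integral_eval P j hg]

end Joint

end IncentivizedExploration

namespace IncentivizedExploration

/-! ### Expectations under discrete distributions -/

section Expectation

variable {α β : Type*}

/-- The expectation of a nonnegative function under a discrete distribution. -/
noncomputable def pmfExp (p : PMF α) (f : α → ℝ≥0∞) : ℝ≥0∞ := ∑' a, p a * f a

lemma pmfExp_bind (p : PMF α) (q : α → PMF β) (f : β → ℝ≥0∞) :
    pmfExp (p.bind q) f = pmfExp p fun a => pmfExp (q a) f := by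
  simp only [pmfExp, PMF.bind_apply, ← ENNReal.tsum_mul_left, ← ENNReal.tsum_mul_right]
  rw [ENNReal.tsum_comm]
  simp only [mul_assoc]

lemma pmfExp_pure (a : α) (f : α → ℝ≥0∞) : pmfExp (PMF.pure a) f = f a := by
  rw [pmfExp, tsum_eq_single a]
  · simp
  · intro b hb; simp [hb]

lemma pmfExp_const (p : PMF α) (c : ℝ≥0∞) : pmfExp p (fun _ => c) = c := by
  simp [pmfExp, ENNReal.tsum_mul_right, p.tsum_coe]

lemma pmfExp_add (p : PMF α) (f g : α → ℝ≥0∞) :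
    pmfExp p (fun a => f a + g a) = pmfExp p f + pmfExp p g := by
  simp [pmfExp, mul_add, ENNReal.tsum_add]

lemma pmfExp_mono (p : PMF α) {f g : α → ℝ≥0∞} (h : ∀ a ∈ p.support, f a ≤ g a) :
    pmfExp p f ≤ pmfExp p g := by
  refine ENNReal.tsum_le_tsum fun a => ?_
  by_cases ha : p a = 0
  · simp [ha]
  · exact mul_le_mul_right (h a ha) _

lemma pmfExp_indicator [DecidableEq α] (p : PMF α) (b : α) :
    pmfExp p (fun a => if a = b then 1 else 0) = p b := by
  rw [pmfExp, tsum_eq_single b]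
  · simp
  · intro a ha; simp [ha]

end Expectation

/-! ### The law of histories and the BIC condition -/

section Histories

variable {K : ℕ}

/-- The product of the probabilities with which an algorithm chooses the arms of a history. -/
noncomputable def choiceWeight (alg : Algorithm K) : History K → ℝ≥0∞
  | [] => 1
  | p :: h => choiceWeight alg h * alg h p.1

lemma choiceWeight_le_one (alg : Algorithm K) (h : History K) : choiceWeight alg h ≤ 1 := by
  induction h with
  | nil => exact le_rfl
  | cons p h ih => exact mul_le_one' ih (PMF.coe_le_one _ _)

lemma likelihood_cons (p : Fin K × Bool) (h : History K) (μ : Fin K → unitInterval) :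
    likelihood (p :: h) μ = (if p.2 then (μ p.1 : ℝ) else 1 - μ p.1) * likelihood h μ := by
  simp [likelihood]

lemma likelihood_mem (h : History K) (μ : Fin K → unitInterval) :
    0 ≤ likelihood h μ ∧ likelihood h μ ≤ 1 := by
  induction h with
  | nil => simp [likelihood]
  | cons p h ih =>
    rw [likelihood_cons]
    have h1 := (μ p.1).2.1
    have h2 := (μ p.1).2.2
    have : 0 ≤ (if p.2 then (μ p.1 : ℝ) else 1 - μ p.1) ∧
        (if p.2 then (μ p.1 : ℝ) else 1 - μ p.1) ≤ 1 := by
      split_ifs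
      · exact ⟨h1, h2⟩
      · exact ⟨by linarith, by linarith⟩
    exact ⟨mul_nonneg this.1 ih.1, mul_le_one₀ this.2 ih.1 ih.2⟩

@[fun_prop]
lemma measurable_likelihood (h : History K) : Measurable (likelihood h) := by
  induction h with
  | nil => exact (measurable_const : Measurable fun _ : Fin K → unitInterval => (1 : ℝ))
  | cons p h ih =>
    rw [show likelihood (p :: h) = _ from funext (likelihood_cons p h)]
    split_ifs <;> fun_prop

lemma rewardPMF_apply (m : unitInterval) (r : Bool) :
    rewardPMF m r = ENNReal.ofReal (if r then (m : ℝ) else 1 - m) := by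
  cases r <;> simp [rewardPMF]

/-- The algorithm sees `μ` only through the rewards, so its choices contribute a factor free of `μ`.
Posteriors given a history therefore depend on the likelihood alone, whatever the algorithm. -/
lemma historyLaw_apply (alg : Algorithm K) (μ : Fin K → unitInterval) (t : ℕ) (h : History K) :
    historyLaw alg μ t h =
      if h.length = t then choiceWeight alg h * ENNReal.ofReal (likelihood h μ) else 0 := by
  induction t generalizing h with
  | zero =>
    cases h with
    | nil => simp [historyLaw, choiceWeight, likelihood]
    | cons p h => simp [historyLaw]
  | succ t ih =>
    simp only [historyLaw, PMF.bind_apply]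
    cases h with
    | nil => simp
    | cons p h =>
      rw [tsum_eq_single h, tsum_eq_single p.1, tsum_eq_single p.2]
      · simp only [PMF.pure_apply, Prod.mk.eta, if_true, mul_one, ih, List.length_cons,
          Nat.add_right_cancel_iff, rewardPMF_apply, likelihood_cons, choiceWeight]
        split_ifs with h1 h2 h2
        · rw [ENNReal.ofReal_mul (μ p.1).2.1]; ring
        · rw [ENNReal.ofReal_mul (by linarith [(μ p.1).2.2])]; ring
        · simp
        · simp
      · intro r hr
        rw [PMF.pure_apply, if_neg, mul_zero]
        intro he; exact hr (by rw [List.cons.injEq] at he; rw [he.1])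
      · intro a ha
        rw [ENNReal.tsum_eq_zero.2, mul_zero]
        intro r
        rw [PMF.pure_apply, if_neg, mul_zero]
        intro he; exact ha (by rw [List.cons.injEq] at he; rw [he.1])
      · intro h' hh
        rw [ENNReal.tsum_eq_zero.2, mul_zero]
        intro a
        rw [ENNReal.tsum_eq_zero.2, mul_zero]
        intro r
        rw [PMF.pure_apply, if_neg, mul_zero]
        intro he; exact hh (by rw [List.cons.injEq] at he; rw [he.2])

lemma length_of_mem_support {alg : Algorithm K} {μ : Fin K → unitInterval} {t : ℕ}
    {h : History K} (hh : h ∈ (historyLaw alg μ t).support) : h.length = t := by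
  by_contra hne
  rw [PMF.mem_support_iff, historyLaw_apply, if_neg hne] at hh
  exact hh rfl

/-- The histories of a given length. -/
noncomputable def historiesOfLength (K t : ℕ) : Finset (History K) :=
  (List.finite_length_eq (Fin K × Bool) t).toFinset

lemma mem_historiesOfLength {t : ℕ} {h : History K} :
    h ∈ historiesOfLength K t ↔ h.length = t := by
  simp [historiesOfLength]

lemma pmfExp_historyLaw (alg : Algorithm K) (μ : Fin K → unitInterval) (t : ℕ)
    (f : History K → ℝ≥0∞) :
    pmfExp (historyLaw alg μ t) f = ∑ h ∈ historiesOfLength K t,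
      choiceWeight alg h * ENNReal.ofReal (likelihood h μ) * f h := by
  rw [pmfExp, tsum_eq_sum (s := historiesOfLength K t)]
  · refine Finset.sum_congr rfl fun h hh => ?_
    rw [historyLaw_apply, if_pos (mem_historiesOfLength.1 hh)]
  · intro h hh
    rw [historyLaw_apply, if_neg (fun e => hh (mem_historiesOfLength.2 e)), zero_mul]

lemma toReal_pmfExp_historyLaw (alg : Algorithm K) (μ : Fin K → unitInterval) (t : ℕ)
    (f : History K → ℝ≥0∞) (hf : ∀ h, f h ≠ ∞) :
    (pmfExp (historyLaw alg μ t) f).toReal = ∑ h ∈ historiesOfLength K t,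
      (choiceWeight alg h).toReal * likelihood h μ * (f h).toReal := by
  rw [pmfExp_historyLaw, ENNReal.toReal_sum]
  · refine Finset.sum_congr rfl fun h _ => ?_
    rw [ENNReal.toReal_mul, ENNReal.toReal_mul, ENNReal.toReal_ofReal (likelihood_mem h μ).1]
  · intro h _
    exact ENNReal.mul_ne_top (ENNReal.mul_ne_top
      ((choiceWeight_le_one alg h).trans_lt ENNReal.one_lt_top).ne ENNReal.ofReal_ne_top) (hf h)

lemma recProb_eq_pmfExp (alg : Algorithm K) (t : ℕ) (i : Fin K) (μ : Fin K → unitInterval) :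
    recProb alg t i μ = (pmfExp (historyLaw alg μ t) fun h => alg h i).toReal := rfl

lemma recProb_eq_sum (alg : Algorithm K) (t : ℕ) (i : Fin K) (μ : Fin K → unitInterval) :
    recProb alg t i μ = ∑ h ∈ historiesOfLength K t,
      (choiceWeight alg h).toReal * likelihood h μ * (alg h i).toReal :=
  toReal_pmfExp_historyLaw _ _ _ _ fun _ => PMF.apply_ne_top _ _

@[fun_prop]
lemma measurable_recProb (alg : Algorithm K) (t : ℕ) (i : Fin K) :
    Measurable (recProb alg t i) := by
  rw [funext (recProb_eq_sum alg t i)]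
  fun_prop

lemma recProb_mem (alg : Algorithm K) (t : ℕ) (i : Fin K) (μ : Fin K → unitInterval) :
    0 ≤ recProb alg t i μ ∧ recProb alg t i μ ≤ 1 :=
  ⟨ENNReal.toReal_nonneg, ENNReal.toReal_le_of_le_ofReal zero_le_one (by
    rw [ENNReal.ofReal_one]
    exact PMF.coe_le_one ((historyLaw alg μ t).bind alg) i)⟩

lemma abs_coe_sub_coe_le (x y : unitInterval) : |(x : ℝ) - y| ≤ 1 :=
  abs_le.2 ⟨by linarith [x.2.1, y.2.2], by linarith [x.2.2, y.2.1]⟩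

lemma integrable_sub_mul_recProb (P : Fin K → Prior) (alg : Algorithm K) (t : ℕ)
    (i j k : Fin K) :
    Integrable (fun μ : Fin K → unitInterval => ((μ i : ℝ) - μ j) * recProb alg t k μ)
      (jointPrior P) := by
  refine integrable_joint P (by fun_prop) 1 fun μ => ?_
  rw [abs_mul, abs_of_nonneg (recProb_mem alg t k μ).1]
  exact mul_le_one₀ (abs_coe_sub_coe_le _ _) (recProb_mem alg t k μ).1 (recProb_mem alg t k μ).2

/-- Clearing the denominator makes the condition linear in the recommendation probabilities. An arm
that is never recommended has `recProb` zero almost everywhere, so the integral vanishes and no case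
distinction remains. -/
lemma isBICAt_iff (P : Fin K → Prior) (alg : Algorithm K) (t : ℕ) :
    IsBICAt P alg t ↔ ∀ i j : Fin K,
      0 ≤ ∫ μ, ((μ i : ℝ) - μ j) * recProb alg t i μ ∂(jointPrior P) := by
  have hn : ∀ i, 0 ≤ ∫ μ, recProb alg t i μ ∂(jointPrior P) := fun i =>
    integral_nonneg fun μ => (recProb_mem alg t i μ).1
  refine forall₂_congr fun i j => ?_
  unfold condGap
  rcases (hn i).eq_or_lt with h0 | h0
  · have hz : (recProb alg t i) =ᵐ[jointPrior P] 0 := by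
      refine (integral_eq_zero_iff_of_nonneg (fun μ => (recProb_mem alg t i μ).1)
        (integrable_joint P (by fun_prop) 1 fun μ => ?_)).1 h0.symm
      rw [abs_of_nonneg (recProb_mem alg t i μ).1]
      exact (recProb_mem alg t i μ).2
    have : ∫ μ, ((μ i : ℝ) - μ j) * recProb alg t i μ ∂(jointPrior P) = 0 := by
      rw [integral_congr_ae (g := fun _ => 0)]
      · simp
      · filter_upwards [hz] with μ hμ
        simp [hμ]
    simp [← h0, this]
  · constructor
    · intro h
      have := mul_nonneg (h h0) h0.le
      rwa [div_mul_cancel₀ _ h0.ne'] at this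
    · exact fun h _ => div_nonneg h h0.le

end Histories

/-! ### Lower bounds on the number of rounds of a BIC algorithm -/

section LowerBound

variable {K : ℕ}

lemma pmfExp_count (alg : Algorithm K) (μ : Fin K → unitInterval) (j : Fin K) (T : ℕ) :
    pmfExp (historyLaw alg μ T) (fun h => ((h.map Prod.fst).count j : ℝ≥0∞)) =
      ∑ t ∈ Finset.range T, pmfExp (historyLaw alg μ t) fun h => alg h j := by
  induction T with
  | zero => simp [historyLaw, pmfExp_pure]
  | succ T ih =>
    rw [Finset.sum_range_succ, ← ih, ← pmfExp_add, historyLaw, pmfExp_bind]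
    congr 1
    funext h
    simp only [pmfExp_bind, pmfExp_pure, pmfExp_const, List.map_cons, List.count_cons, beq_iff_eq,
      Nat.cast_add, Nat.cast_ite, Nat.cast_one, Nat.cast_zero, pmfExp_add, pmfExp_indicator]

lemma one_le_sum_recProb {P : Fin K → Prior} {alg : Algorithm K} {T : ℕ}
    (h : Collects P alg T 1) (j : Fin K) :
    ∀ᵐ μ ∂(jointPrior P), 1 ≤ ∑ t ∈ Finset.range T, recProb alg t j μ := by
  filter_upwards [h] with μ hμ
  have h1 : 1 ≤ ∑ t ∈ Finset.range T, pmfExp (historyLaw alg μ t) fun h => alg h j := by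
    rw [← pmfExp_count, ← pmfExp_const (historyLaw alg μ T) 1]
    exact pmfExp_mono _ fun h hh => hμ h hh j
  have h2 : ∀ t ∈ Finset.range T, pmfExp (historyLaw alg μ t) (fun h => alg h j) ≠ ∞ :=
    fun t _ => PMF.apply_ne_top ((historyLaw alg μ t).bind alg) j
  simp_rw [recProb_eq_pmfExp]
  rw [← ENNReal.toReal_sum h2]
  have := ENNReal.toReal_mono (ENNReal.sum_ne_top.2 h2) h1
  simpa using this

lemma mix_mem {q : Fin K → ℝ} (hq : q ∈ stdSimplex ℝ (Fin K)) (μ : Fin K → unitInterval) :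
    0 ≤ mix q μ ∧ mix q μ ≤ 1 := by
  refine ⟨Finset.sum_nonneg fun i _ => mul_nonneg (hq.1 i) (μ i).2.1, ?_⟩
  rw [← hq.2]
  exact Finset.sum_le_sum fun i _ => mul_le_of_le_one_right (hq.1 i) (μ i).2.2

@[fun_prop]
lemma measurable_mix (q : Fin K → ℝ) : Measurable (mix q) := by
  unfold mix
  fun_prop

lemma abs_sub_mix_le {q : Fin K → ℝ} (hq : q ∈ stdSimplex ℝ (Fin K)) (j : Fin K)
    (μ : Fin K → unitInterval) : |(μ j : ℝ) - mix q μ| ≤ 1 :=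
  abs_le.2 ⟨by linarith [(μ j).2.1, (mix_mem hq μ).2], by linarith [(μ j).2.2, (mix_mem hq μ).1]⟩

lemma sub_mix_eq_sum {q : Fin K → ℝ} (hq : q ∈ stdSimplex ℝ (Fin K)) (j : Fin K)
    (μ : Fin K → unitInterval) : (μ j : ℝ) - mix q μ = ∑ i, q i * ((μ j : ℝ) - μ i) := by
  simp only [mul_sub, Finset.sum_sub_distrib, ← Finset.sum_mul, hq.2, one_mul, mix]

/-- A BIC algorithm that samples every arm needs many rounds if some arm is unlikely to beat a
mixture of the other arms. -/
lemma integral_neg_part_le_mul {P : Fin K → Prior} {alg : Algorithm K} {T : ℕ}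
    (hb : IsBIC P alg T) (hc : Collects P alg T 1) (j : Fin K) {q : Fin K → ℝ}
    (hq : q ∈ stdSimplex ℝ (Fin K)) :
    ∫ μ, max (mix q μ - μ j) 0 ∂(jointPrior P) ≤
      T * ∫ μ, max ((μ j : ℝ) - mix q μ) 0 ∂(jointPrior P) := by
  -- The pairwise BIC inequalities for arm `j` are averaged with the weights `q`.
  have h1 : ∀ t < T, 0 ≤ ∫ μ, ((μ j : ℝ) - mix q μ) * recProb alg t j μ ∂(jointPrior P) := by
    intro t ht
    simp_rw [sub_mix_eq_sum hq, Finset.sum_mul, mul_assoc]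
    rw [integral_finsetSum _ fun i _ => (integrable_sub_mul_recProb P alg t j i j).const_mul _]
    refine Finset.sum_nonneg fun i _ => ?_
    rw [integral_const_mul]
    exact mul_nonneg (hq.1 i) ((isBICAt_iff P alg t).1 (hb t ht) j i)
  have hi : ∀ t, Integrable (fun μ => ((μ j : ℝ) - mix q μ) * recProb alg t j μ)
      (jointPrior P) := by
    intro t
    refine integrable_joint P (by fun_prop) 1 fun μ => ?_
    rw [abs_mul, abs_of_nonneg (recProb_mem alg t j μ).1]
    exact mul_le_one₀ (abs_sub_mix_le hq j μ) (recProb_mem alg t j μ).1 (recProb_mem alg t j μ).2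
  have h2 : 0 ≤ ∫ μ, ((μ j : ℝ) - mix q μ) * ∑ t ∈ Finset.range T, recProb alg t j μ
      ∂(jointPrior P) := by
    simp_rw [Finset.mul_sum]
    rw [integral_finsetSum _ fun t _ => hi t]
    exact Finset.sum_nonneg fun t ht => h1 t (Finset.mem_range.1 ht)
  have i1 : Integrable (fun μ => max ((μ j : ℝ) - mix q μ) 0) (jointPrior P) :=
    (integrable_joint P (F := fun μ => (μ j : ℝ) - mix q μ) (by fun_prop) 1
      (abs_sub_mix_le hq j)).pos_part
  have i2 : Integrable (fun μ => max (mix q μ - (μ j : ℝ)) 0) (jointPrior P) :=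
    (integrable_joint P (F := fun μ => mix q μ - (μ j : ℝ)) (by fun_prop) 1
      (fun μ => by rw [abs_sub_comm]; exact abs_sub_mix_le hq j μ)).pos_part
  -- The sum of recommendation probabilities is at most `T`, which is used where the gap is
  -- positive, and at least `1`, which is used where it is negative.
  have h3 : ∫ μ, ((μ j : ℝ) - mix q μ) * ∑ t ∈ Finset.range T, recProb alg t j μ
      ∂(jointPrior P) ≤
      ∫ μ, (T * max ((μ j : ℝ) - mix q μ) 0 - max (mix q μ - (μ j : ℝ)) 0) ∂(jointPrior P) := by
    refine integral_mono_ae ?_ ((i1.const_mul _).sub i2) ?_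
    · simp_rw [Finset.mul_sum]
      exact integrable_finsetSum _ fun t _ => hi t
    · filter_upwards [one_le_sum_recProb hc j] with μ hμ
      have hT : ∑ t ∈ Finset.range T, recProb alg t j μ ≤ T := by
        have := Finset.sum_le_sum fun t (_ : t ∈ Finset.range T) => (recProb_mem alg t j μ).2
        simpa using this
      rcases le_total (mix q μ) (μ j) with h | h
      · rw [max_eq_left (by linarith), max_eq_right (by linarith)]
        nlinarith
      · rw [max_eq_right (by linarith), max_eq_left (by linarith)]
        nlinarith
  rw [integral_sub (i1.const_mul _) i2, integral_const_mul] at h3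
  linarith

lemma card_le_of_collects {P : Fin K → Prior} {alg : Algorithm K} {T : ℕ}
    (hc : Collects P alg T 1) : K ≤ T := by
  obtain ⟨μ, hμ⟩ := hc.exists
  obtain ⟨h, hh⟩ := (historyLaw alg μ T).support_nonempty
  have h1 : ∀ i : Fin K, 1 ≤ (h.map Prod.fst).count i := fun i => by exact_mod_cast hμ h hh i
  have h2 : ∑ i : Fin K, (h.map Prod.fst).count i = T := by
    rw [← length_of_mem_support hh, ← List.length_map (f := Prod.fst) (as := h)]
    simpa only [Multiset.coe_count, Multiset.coe_card] using
      Multiset.sum_count_eq_card (s := Finset.univ) (m := ((h.map Prod.fst : List _) :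
        Multiset (Fin K))) (fun a _ => Finset.mem_univ a)
  calc K = ∑ _i : Fin K, 1 := by simp
    _ ≤ _ := Finset.sum_le_sum fun i _ => h1 i
    _ = T := h2

lemma le_roundsLB_of_mix {P : Fin K → Prior} (j : Fin K) {q : Fin K → ℝ}
    (hq : q ∈ stdSimplex ℝ (Fin K)) {x : ℝ} (hx : 0 ≤ x)
    (hlo : 0 < ∫ μ, max (mix q μ - μ j) 0 ∂(jointPrior P))
    (h : x * ∫ μ, max ((μ j : ℝ) - mix q μ) 0 ∂(jointPrior P) <
      ∫ μ, max (mix q μ - μ j) 0 ∂(jointPrior P)) :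
    ENNReal.ofReal x < roundsLB P := by
  have h1 : ENNReal.ofReal x < (∫⁻ μ, ENNReal.ofReal (mix q μ - (μ j : ℝ)) ∂(jointPrior P)) /
      ∫⁻ μ, ENNReal.ofReal ((μ j : ℝ) - mix q μ) ∂(jointPrior P) := by
    rw [lintegral_ofReal_eq_integral_max (integrable_joint P (by fun_prop) 1
      (fun μ => by rw [abs_sub_comm]; exact abs_sub_mix_le hq j μ)),
      lintegral_ofReal_eq_integral_max (integrable_joint P (by fun_prop) 1
      (abs_sub_mix_le hq j)),
      ENNReal.lt_div_iff_mul_lt (Or.inr ENNReal.ofReal_ne_top) (Or.inl ENNReal.ofReal_ne_top),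
      ← ENNReal.ofReal_mul hx]
    exact (ENNReal.ofReal_lt_ofReal_iff hlo).2 h
  refine h1.trans_le ?_
  refine le_trans ?_ ((le_max_right _ _).trans (le_max_right _ _))
  exact le_iSup_of_le j (le_iSup₂_of_le q hq le_rfl)

end LowerBound

end IncentivizedExploration

namespace IncentivizedExploration

/-! ### The hard case: many good arms and one arm that rarely competes -/

section Hard

lemma IsHard.exists_lt {δ : ℝ} {C : Set Prior} (h : IsHard δ C) {ε : ℝ} (hε : 0 < ε) :
    ∃ Q ∈ C, (Q : Measure unitInterval).real {x | Phi C - δ ≤ (x : ℝ)} < ε := by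
  have h1 : ⨅ Q ∈ C, ((Q : Prior) : Measure unitInterval) {x | Phi C - δ ≤ (x : ℝ)} <
      ENNReal.ofReal ε := by
    rw [show ⨅ Q ∈ C, ((Q : Prior) : Measure unitInterval) {x | Phi C - δ ≤ (x : ℝ)} = 0 from h]
    exact ENNReal.ofReal_pos.2 hε
  simp only [iInf_lt_iff] at h1
  obtain ⟨Q, hQ, h2⟩ := h1
  refine ⟨Q, hQ, ?_⟩
  rw [measureReal_def]
  exact (ENNReal.lt_ofReal_iff_toReal_lt (measure_ne_top _ _)).1 h2

lemma measurableSet_le_coe (b : ℝ) : MeasurableSet {x : unitInterval | b ≤ (x : ℝ)} :=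
  measurableSet_le measurable_const measurable_subtype_coe

lemma mean_le_add_measureReal (Q : Prior) {b : ℝ} (hb : 0 ≤ b) :
    mean Q ≤ b + (Q : Measure unitInterval).real {x | b ≤ (x : ℝ)} := by
  have hm := measurableSet_le_coe b
  have hi : Integrable ({x : unitInterval | b ≤ (x : ℝ)}.indicator (1 : unitInterval → ℝ))
      (Q : Measure unitInterval) :=
    (integrable_indicator_iff hm).2 (integrable_const _).integrableOn
  calc mean Q ≤ ∫ x, (b + ({x : unitInterval | b ≤ (x : ℝ)}.indicator 1 x : ℝ))
        ∂(Q : Measure unitInterval) := by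
        refine integral_mono (integrable_coe Q) ((integrable_const b).add hi)
          fun x => ?_
        by_cases hx : b ≤ (x : ℝ)
        · simp only [Set.indicator, Set.mem_ofPred_eq, hx, if_true, Pi.one_apply]
          linarith [x.2.2]
        · simp only [Set.indicator, Set.mem_ofPred_eq, hx, if_false]
          linarith
    _ = _ := by
        rw [integral_add (integrable_const b) hi, integral_indicator_one hm]
        simp

/-- The instance with `n` arms of prior `Q'`, followed by one arm of prior `Q`. -/
noncomputable def lastArmInstance (n : ℕ) (Q' Q : Prior) : Fin (n + 1) → Prior :=
  fun i => if i = Fin.last n then Q else Q'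

/-- The uniform distribution on all arms but the last. -/
noncomputable def uniformInit (n : ℕ) : Fin (n + 1) → ℝ :=
  fun i => if i = Fin.last n then 0 else 1 / n

lemma uniformInit_mem {n : ℕ} (hn : 0 < n) : uniformInit n ∈ stdSimplex ℝ (Fin (n + 1)) := by
  have hn' : (n : ℝ) ≠ 0 := by positivity
  refine ⟨fun i => ?_, ?_⟩
  · unfold uniformInit; split_ifs <;> positivity
  · rw [Fin.sum_univ_castSucc]
    simp [uniformInit, Fin.castSucc_ne_last, hn']

/-- Chernoff's method with parameter `nδ/4`: each of the `n` centred arms contributes at most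
`exp((δ/4)²)`, and the shift of `b` below the mean contributes `exp(-nδ²/8)`. The last arm has
weight zero in the mixture, hence the factor `1`. -/
lemma exp_mix_lastArmInstance_le {n : ℕ} (hn : 0 < n) (Q' Q : Prior) {δ b : ℝ}
    (hb : b ≤ mean Q' - δ / 2) (hδ : 0 < δ) :
    ∫ μ, Real.exp (n * (δ / 4) * (b - mix (uniformInit n) μ))
      ∂(jointPrior (lastArmInstance n Q' Q)) ≤ Real.exp (-(n * δ ^ 2 / 16)) := by
  set P := lastArmInstance n Q' Q
  have hn' : (0 : ℝ) < n := by positivity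
  set f : Fin (n + 1) → unitInterval → ℝ := fun i x =>
    if i = Fin.last n then 1 else Real.exp (δ / 4 * (mean Q' - x)) with hf
  have hprod : ∀ μ : Fin (n + 1) → unitInterval, ∏ i, f i (μ i) =
      Real.exp (n * (δ / 4) * (mean Q' - mix (uniformInit n) μ)) := by
    intro μ
    have h1 : ∀ i, f i (μ i) = Real.exp (n * (δ / 4) * (uniformInit n i * (mean Q' - μ i))) := by
      intro i
      simp only [hf, uniformInit]
      split_ifs
      · simp
      · congr 1; field_simp
    simp_rw [h1]
    rw [← Real.exp_sum, ← Finset.mul_sum]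
    simp only [mul_sub, Finset.sum_sub_distrib, ← Finset.sum_mul, (uniformInit_mem hn).2, one_mul,
      mix]
  have hint : ∫ μ, Real.exp (n * (δ / 4) * (mean Q' - mix (uniformInit n) μ)) ∂(jointPrior P)
      ≤ Real.exp (n * (δ / 4) ^ 2) := by
    simp_rw [← hprod]
    rw [integral_prod_eval, Fin.prod_univ_castSucc]
    have h2 : ∀ i : Fin n, ∫ x, f i.castSucc x ∂(P i.castSucc : Measure unitInterval) ≤
        Real.exp ((δ / 4) ^ 2) := by
      intro i
      simp only [hf, P, lastArmInstance, Fin.castSucc_ne_last, if_false]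
      refine integral_exp_le_of_centered (Y := fun x : unitInterval => mean Q' - (x : ℝ))
        (by fun_prop) (fun x => ?_) ?_ _
      · exact abs_le.2 ⟨by linarith [x.2.2, mean_nonneg Q'], by linarith [x.2.1, mean_le_one Q']⟩
      · rw [integral_sub (integrable_const _) (integrable_coe Q')]
        simp [mean]
    have h3 : ∫ x, f (Fin.last n) x ∂(P (Fin.last n) : Measure unitInterval) = 1 := by
      simp [hf]
    rw [h3, mul_one]
    calc _ ≤ ∏ i : Fin n, Real.exp ((δ / 4) ^ 2) := Finset.prod_le_prod
          (fun i _ => integral_nonneg fun x => by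
            simp only [hf]; split_ifs <;> positivity) fun i _ => h2 i
      _ = _ := by
          rw [Finset.prod_const, Finset.card_univ, Fintype.card_fin, ← Real.exp_nat_mul]
  have hbd : ∀ c : ℝ, Integrable (fun μ => Real.exp (n * (δ / 4) *
      (c - mix (uniformInit n) μ))) (jointPrior P) := by
    intro c
    refine integrable_joint P (by fun_prop) (Real.exp (n * (δ / 4) * c)) fun μ => ?_
    rw [Real.abs_exp]
    refine Real.exp_le_exp.2 (mul_le_mul_of_nonneg_left ?_ (by positivity))
    linarith [(mix_mem (uniformInit_mem hn) μ).1]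
  calc _ ≤ ∫ μ, Real.exp (-(n * (δ / 4) * (δ / 2))) *
        Real.exp (n * (δ / 4) * (mean Q' - mix (uniformInit n) μ)) ∂(jointPrior P) := by
        refine integral_mono (hbd b) ((hbd _).const_mul _) fun μ => ?_
        rw [← Real.exp_add]
        refine Real.exp_le_exp.2 ?_
        have : (n : ℝ) * (δ / 4) * b ≤ n * (δ / 4) * (mean Q' - δ / 2) :=
          mul_le_mul_of_nonneg_left hb (by positivity)
        linarith
    _ ≤ Real.exp (-(n * (δ / 4) * (δ / 2))) * Real.exp (n * (δ / 4) ^ 2) := by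
        rw [integral_const_mul]
        exact mul_le_mul_of_nonneg_left hint (Real.exp_pos _).le
    _ = _ := by
        rw [← Real.exp_add]
        congr 1; ring

/-- If the last arm reaches `b`, the gap is bounded by `1`. Otherwise it is at most `b - μ_q ≤
exp(θ(b - μ_q))/θ` with `θ = nδ/4`, whose expectation is the Chernoff bound. -/
lemma integral_pos_part_lastArmInstance_le {n : ℕ} (hn : 0 < n) (Q' Q : Prior) {δ b : ℝ}
    (hb : b ≤ mean Q' - δ / 2) (hδ : 0 < δ) :
    ∫ μ, max ((μ (Fin.last n) : ℝ) - mix (uniformInit n) μ) 0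
      ∂(jointPrior (lastArmInstance n Q' Q)) ≤
    (Q : Measure unitInterval).real {x | b ≤ (x : ℝ)} +
      4 / (n * δ) * Real.exp (-(n * δ ^ 2 / 16)) := by
  set P := lastArmInstance n Q' Q
  have hq := uniformInit_mem hn
  have hn' : (0 : ℝ) < n := by positivity
  have hm := measurableSet_le_coe b
  set S : unitInterval → ℝ := {x : unitInterval | b ≤ (x : ℝ)}.indicator 1 with hS
  have hSm : Measurable S := measurable_one.indicator hm
  have hS01 : ∀ x, |S x| ≤ 1 := fun x => by
    simp only [hS, Set.indicator]; split_ifs <;> simp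
  have i1 : Integrable (fun μ => S (μ (Fin.last n))) (jointPrior P) :=
    integrable_joint P (by fun_prop) 1 fun μ => hS01 _
  have i2 : Integrable (fun μ => Real.exp (n * (δ / 4) * (b - mix (uniformInit n) μ)))
      (jointPrior P) := by
    refine integrable_joint P (by fun_prop) (Real.exp (n * (δ / 4) * b)) fun μ => ?_
    rw [Real.abs_exp]
    refine Real.exp_le_exp.2 (mul_le_mul_of_nonneg_left ?_ (by positivity))
    linarith [(mix_mem hq μ).1]
  calc _ ≤ ∫ μ, (S (μ (Fin.last n)) + 4 / (n * δ) *
        Real.exp (n * (δ / 4) * (b - mix (uniformInit n) μ))) ∂(jointPrior P) := by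
        refine integral_mono (integrable_joint P (by fun_prop) 1
          (abs_sub_mix_le hq _)).pos_part (i1.add (i2.const_mul _)) fun μ => ?_
        have hpos : 0 < 4 / (n * δ) * Real.exp (n * (δ / 4) * (b - mix (uniformInit n) μ)) := by
          positivity
        by_cases hx : b ≤ (μ (Fin.last n) : ℝ)
        · simp only [hS, Set.indicator, Set.mem_ofPred_eq, hx, if_true, Pi.one_apply]
          have := (μ (Fin.last n)).2.2
          have := (mix_mem hq μ).1
          exact max_le (by linarith) (by linarith)
        · simp only [hS, Set.indicator, Set.mem_ofPred_eq, hx, if_false, zero_add]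
          refine max_le ?_ hpos.le
          have h1 := Real.add_one_le_exp (n * (δ / 4) * (b - mix (uniformInit n) μ))
          have h2 : 4 / (n * δ) * (n * (δ / 4) * (b - mix (uniformInit n) μ)) =
              b - mix (uniformInit n) μ := by field_simp
          have h3 : 4 / (n * δ) * (n * (δ / 4) * (b - mix (uniformInit n) μ)) ≤
              4 / (n * δ) * Real.exp (n * (δ / 4) * (b - mix (uniformInit n) μ)) :=
            mul_le_mul_of_nonneg_left (by linarith) (by positivity)
          linarith
    _ ≤ _ := by
        rw [integral_add i1 (i2.const_mul _), integral_const_mul, integral_eval P _ hSm,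
          integral_indicator_one hm]
        refine add_le_add (le_of_eq ?_) (mul_le_mul_of_nonneg_left
          (exp_mix_lastArmInstance_le hn Q' Q hb hδ) (by positivity))
        simp [P, lastArmInstance]

lemma sub_le_integral_neg_part_lastArmInstance {n : ℕ} (hn : 0 < n) (Q' Q : Prior) :
    mean Q' - mean Q ≤ ∫ μ, max (mix (uniformInit n) μ - (μ (Fin.last n) : ℝ)) 0
      ∂(jointPrior (lastArmInstance n Q' Q)) := by
  set P := lastArmInstance n Q' Q
  have hq := uniformInit_mem hn
  have hn' : (n : ℝ) ≠ 0 := by positivity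
  have i2 : Integrable (fun μ => mix (uniformInit n) μ - (μ (Fin.last n) : ℝ)) (jointPrior P) :=
    integrable_joint P (by fun_prop) 1
      (fun μ => by rw [abs_sub_comm]; exact abs_sub_mix_le hq _ μ)
  calc mean Q' - mean Q = ∫ μ, (mix (uniformInit n) μ - (μ (Fin.last n) : ℝ)) ∂(jointPrior P) := by
        have i1 : Integrable (mix (uniformInit n)) (jointPrior P) :=
          integrable_joint P (by fun_prop) 1 fun μ =>
            abs_le.2 ⟨by linarith [(mix_mem hq μ).1], (mix_mem hq μ).2⟩
        rw [integral_sub i1 (integrable_coe_eval P _), integral_coe_eval]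
        simp only [mix]
        rw [integral_finsetSum _ fun i _ => (integrable_coe_eval P i).const_mul _]
        simp_rw [integral_const_mul, integral_coe_eval]
        rw [Fin.sum_univ_castSucc]
        simp only [uniformInit, P, lastArmInstance, Fin.castSucc_ne_last, if_false, if_true,
          Finset.sum_const, Finset.card_univ, Fintype.card_fin, nsmul_eq_mul]
        field_simp
        ring
    _ ≤ _ := integral_mono i2 i2.pos_part fun μ => le_max_left _ _

theorem exists_hard_instance {δ : ℝ} (hδ : 0 < δ) : ∃ c : ℝ, 0 < c ∧
      ∀ C : Set Prior, IsHard δ C → ∀ K : ℕ, 2 ≤ K →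
        ∃ P : Fin K → Prior, IsConsistent C P ∧ (Antitone fun i => mean (P i)) ∧
          ENNReal.ofReal (Real.exp (c * K)) < roundsLB P ∧
            ∀ (T : ℕ) (alg : Algorithm K), IsBIC P alg T → Collects P alg T 1 →
              Real.exp (c * K) < T := by
  refine ⟨δ ^ 2 / 128, by positivity, fun C hC K hK => ?_⟩
  obtain ⟨n, rfl⟩ : ∃ n, K = n + 1 := ⟨K - 1, by omega⟩
  have hn : 0 < n := by omega
  have hn1 : (1 : ℝ) ≤ n := by exact_mod_cast hn
  set c := δ ^ 2 / 128 with hc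
  set E := Real.exp (c * ((n + 1 : ℕ) : ℝ)) with hE
  have hE0 : 0 < E := Real.exp_pos _
  have hE1 : 1 ≤ E := Real.one_le_exp (by positivity)
  obtain ⟨Q₀, hQ₀, hlt₀⟩ := hC.exists_lt one_pos
  -- If `Φ ≤ δ`, the event in the definition of hardness would be sure under every prior.
  have hb : 0 < Phi C - δ := by
    by_contra hneg
    rw [show {x : unitInterval | Phi C - δ ≤ (x : ℝ)} = Set.univ from
      Set.eq_univ_of_forall fun x => le_trans (not_lt.1 hneg) x.2.1] at hlt₀
    simp at hlt₀
  have hδ1 : δ < 1 := by linarith [Phi_le_one C]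
  -- The rare arm is chosen after `K`: even multiplied by `E = exp(cK)`, its chance of reaching `Φ -
  -- δ` stays below `δ/8`.
  obtain ⟨Q, hQ, hlt⟩ := hC.exists_lt (ε := δ / (8 * E)) (by positivity)
  obtain ⟨_, ⟨Q', hQ', rfl⟩, hlt'⟩ := exists_lt_of_lt_csSup
    (Set.Nonempty.image mean ⟨Q₀, hQ₀⟩) (show Phi C - δ / 2 < sSup (mean '' C) by
      change _ < Phi C; linarith)
  set p := (Q : Measure unitInterval).real {x | Phi C - δ ≤ (x : ℝ)} with hp
  have hpE : E * p < δ / 8 := by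
    have := mul_lt_mul_of_pos_left hlt hE0
    rwa [show E * (δ / (8 * E)) = δ / 8 by field_simp] at this
  have hp0 : 0 ≤ p := measureReal_nonneg
  have hp8 : p < δ / 8 := by nlinarith
  have hQm : mean Q ≤ Phi C - δ + p := mean_le_add_measureReal Q hb.le
  refine ⟨lastArmInstance n Q' Q, fun i => ?_, fun i k hik => ?_, ?_⟩
  · unfold lastArmInstance; split_ifs <;> assumption
  · simp only [lastArmInstance]
    split_ifs with h1 h2 h2
    · exact le_rfl
    · linarith
    · exact absurd (le_antisymm (Fin.le_last _) (h2 ▸ hik)) h1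
    · exact le_rfl
  -- For `nδ² < 32` the exponential bound is below `2 ≤ K`, so the trivial lower bound `K` suffices.
  -- Otherwise the factor `4/(nδ)` of the Chernoff term is at most `δ/8`.
  rcases lt_or_ge ((n : ℝ) * δ ^ 2) 32 with hsmall | hlarge
  · have hlt2 : E < ((n + 1 : ℕ) : ℝ) := by
      have h1 : c * ((n + 1 : ℕ) : ℝ) ≤ 33 / 128 := by
        rw [hc]; push_cast; nlinarith
      have h2 : E < 2 := by
        calc E ≤ Real.exp (33 / 128) := Real.exp_le_exp.2 h1
          _ < Real.exp (Real.log 2) := Real.exp_lt_exp.2 (by linarith [Real.log_two_gt_d9])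
          _ = 2 := Real.exp_log two_pos
      have : (2 : ℝ) ≤ ((n + 1 : ℕ) : ℝ) := by exact_mod_cast hK
      linarith
    refine ⟨lt_of_lt_of_le ?_ (le_max_left _ _), fun T alg _ hcol => ?_⟩
    · rw [← ENNReal.ofReal_natCast]
      exact (ENNReal.ofReal_lt_ofReal_iff (by positivity)).2 hlt2
    · exact hlt2.trans_le (by exact_mod_cast card_le_of_collects hcol)
  · set G := ∫ μ, max ((μ (Fin.last n) : ℝ) - mix (uniformInit n) μ) 0
      ∂(jointPrior (lastArmInstance n Q' Q)) with hG
    set Lo := ∫ μ, max (mix (uniformInit n) μ - (μ (Fin.last n) : ℝ)) 0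
      ∂(jointPrior (lastArmInstance n Q' Q)) with hLo
    have hq := uniformInit_mem hn
    have hG1 : G ≤ p + 4 / (n * δ) * Real.exp (-(n * δ ^ 2 / 16)) :=
      integral_pos_part_lastArmInstance_le hn Q' Q (by linarith) hδ
    have hG0 : 0 ≤ G := integral_nonneg fun μ => le_max_right _ _
    have hLo1 : mean Q' - mean Q ≤ Lo := sub_le_integral_neg_part_lastArmInstance hn Q' Q
    have hLo2 : 3 * δ / 8 < Lo := by linarith
    have h2 : E * (4 / (n * δ) * Real.exp (-(n * δ ^ 2 / 16))) ≤ δ / 8 := by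
      have h3 : E * Real.exp (-(n * δ ^ 2 / 16)) ≤ 1 := by
        rw [hE, ← Real.exp_add]
        refine Real.exp_le_one_iff.2 ?_
        rw [hc]; push_cast; nlinarith [sq_nonneg δ]
      have h4 : 4 / (n * δ) ≤ δ / 8 := by
        rw [div_le_div_iff₀ (by positivity) (by positivity)]
        nlinarith
      calc _ = 4 / (n * δ) * (E * Real.exp (-(n * δ ^ 2 / 16))) := by ring
        _ ≤ 4 / (n * δ) * 1 := mul_le_mul_of_nonneg_left h3 (by positivity)
        _ ≤ δ / 8 := by linarith
    -- The rare arm and the Chernoff term cost at most `δ/8` each after multiplication by `E`,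
    -- against `Lo > 3δ/8`.
    have h5 : E * G < Lo := by
      have := mul_le_mul_of_nonneg_left hG1 hE0.le
      rw [mul_add] at this
      linarith
    refine ⟨le_roundsLB_of_mix (Fin.last n) hq hE0.le (by linarith) h5, fun T alg hbic hcol => ?_⟩
    have h6 : Lo ≤ T * G := integral_neg_part_le_mul hbic hcol (Fin.last n) hq
    by_contra hcon
    have := mul_le_mul_of_nonneg_right (not_lt.1 hcon) hG0
    linarith

end Hard

/-! ### The dichotomy for finite collections -/

section Dichotomy

lemma supSupport_nonempty (Q : Prior) :
    ((fun x : unitInterval => (x : ℝ)) '' (Q : Measure unitInterval).support).Nonempty :=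
  (Measure.nonempty_support (IsProbabilityMeasure.ne_zero _)).image _

lemma bddAbove_support (Q : Prior) :
    BddAbove ((fun x : unitInterval => (x : ℝ)) '' (Q : Measure unitInterval).support) :=
  ⟨1, by rintro _ ⟨x, -, rfl⟩; exact x.2.2⟩

lemma ae_le_supSupport (Q : Prior) :
    ∀ᵐ x : unitInterval ∂(Q : Measure unitInterval), (x : ℝ) ≤ supSupport Q := by
  filter_upwards [Measure.support_mem_ae (μ := (Q : Measure unitInterval))] with x hx
  exact le_csSup (bddAbove_support Q) ⟨x, hx, rfl⟩

lemma measure_lt_pos {Q : Prior} {b : ℝ} (h : b < supSupport Q) :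
    0 < (Q : Measure unitInterval) {x | b < (x : ℝ)} := by
  obtain ⟨_, ⟨x, hx, rfl⟩, hbx⟩ := exists_lt_of_lt_csSup (supSupport_nonempty Q) h
  refine (Measure.mem_support_iff_forall x).1 hx _ (IsOpen.mem_nhds ?_ hbx)
  exact isOpen_lt continuous_const continuous_subtype_val

theorem exists_isEasy_xor_isHard {C : Set Prior} (hfin : C.Finite) (hne : C.Nonempty)
    (h : sInf (supSupport '' C) ≠ Phi C) : ∃ δ : ℝ, 0 < δ ∧ Xor (IsEasy δ C) (IsHard δ C) := by
  obtain ⟨Q₀, hQ₀, hmin⟩ := hfin.exists_minimalFor supSupport C hne |>.imp fun Q hQ =>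
    (⟨hQ.1, fun R hR => (le_total (supSupport Q) (supSupport R)).elim id fun hle =>
      hQ.2 hR hle⟩ : Q ∈ C ∧ ∀ R ∈ C, supSupport Q ≤ supSupport R)
  have hinf : sInf (supSupport '' C) = supSupport Q₀ :=
    le_antisymm (csInf_le ⟨supSupport Q₀, by rintro _ ⟨R, hR, rfl⟩; exact hmin R hR⟩
      ⟨Q₀, hQ₀, rfl⟩) (le_csInf (hne.image _) (by rintro _ ⟨R, hR, rfl⟩; exact hmin R hR))
  rw [hinf] at h
  have hval : ∀ Q : Prior, ∫⁻ x, ENNReal.ofReal ((x : ℝ) - Phi C) ∂(Q : Measure unitInterval) ≠ ∞ :=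
    fun Q => by
      rw [lintegral_ofReal_eq_integral_max (integrable_coe_sub Q _)]
      exact ENNReal.ofReal_ne_top
  rcases lt_or_gt_of_ne h with hlt | hlt
  -- The prior `Q₀` has no mass above its top, which lies below `Φ - δ`; it witnesses hardness and
  -- refutes easiness.
  · refine ⟨(Phi C - supSupport Q₀) / 2, by linarith, Or.inr ⟨?_, ?_⟩⟩
    · refine le_antisymm ((iInf₂_le Q₀ hQ₀).trans (le_of_eq ?_)) zero_le
      rw [measure_eq_zero_iff_ae_notMem]
      filter_upwards [ae_le_supSupport Q₀] with x hx
      simp only [not_le]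
      linarith
    · intro he
      have h1 := lt_of_lt_of_le he (iInf₂_le Q₀ hQ₀)
      rw [lintegral_congr_ae (g := fun _ => 0)] at h1
      · simp at h1
      · filter_upwards [ae_le_supSupport Q₀] with x hx
        exact ENNReal.ofReal_of_nonpos (by linarith)
  -- Every prior now has mass strictly above `Φ`. By finiteness the smallest excess `v` is positive,
  -- and half of it is the required `δ`; the same mass above `Φ` rules out hardness.
  · have hpos : ∀ Q ∈ C, 0 < ∫⁻ x, ENNReal.ofReal ((x : ℝ) - Phi C) ∂(Q : Measure unitInterval) := by
      intro Q hQ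
      rw [lintegral_pos_iff_support (by fun_prop)]
      refine (measure_lt_pos (hlt.trans_le (hmin Q hQ))).trans_le (measure_mono fun x hx => ?_)
      simp only [Set.mem_ofPred_eq] at hx
      simp only [Function.mem_support, ne_eq, ENNReal.ofReal_eq_zero, not_le]
      linarith
    obtain ⟨Q₁, hQ₁, hmin₁⟩ := hfin.exists_minimalFor
      (fun Q : Prior => ∫⁻ x, ENNReal.ofReal ((x : ℝ) - Phi C) ∂(Q : Measure unitInterval)) C hne
      |>.imp fun Q hQ => (⟨hQ.1, fun R hR => (le_total _ _).elim id fun hle => hQ.2 hR hle⟩ :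
        Q ∈ C ∧ ∀ R ∈ C, ∫⁻ x, ENNReal.ofReal ((x : ℝ) - Phi C) ∂(Q : Measure unitInterval) ≤
          ∫⁻ x, ENNReal.ofReal ((x : ℝ) - Phi C) ∂(R : Measure unitInterval))
    set v := ∫⁻ x, ENNReal.ofReal ((x : ℝ) - Phi C) ∂(Q₁ : Measure unitInterval) with hv
    have hv0 : 0 < v.toReal := ENNReal.toReal_pos (hpos Q₁ hQ₁).ne' (hval Q₁)
    refine ⟨v.toReal / 2, by linarith, Or.inl ⟨?_, ?_⟩⟩
    · refine lt_of_lt_of_le ?_ (le_iInf₂ hmin₁)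
      rw [ENNReal.ofReal_lt_iff_lt_toReal (by linarith) (hval Q₁)]
      linarith
    · intro hhard
      obtain ⟨Q₂, hQ₂, hmin₂⟩ := hfin.exists_minimalFor
        (fun Q : Prior => (Q : Measure unitInterval) {x | Phi C - v.toReal / 2 ≤ (x : ℝ)}) C hne
        |>.imp fun Q hQ => (⟨hQ.1, fun R hR => (le_total _ _).elim id fun hle => hQ.2 hR hle⟩ :
          Q ∈ C ∧ ∀ R ∈ C, (Q : Measure unitInterval) {x | Phi C - v.toReal / 2 ≤ (x : ℝ)} ≤
            (R : Measure unitInterval) {x | Phi C - v.toReal / 2 ≤ (x : ℝ)})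
      have h2 : (Q₂ : Measure unitInterval) {x | Phi C - v.toReal / 2 ≤ (x : ℝ)} ≤ 0 :=
        (le_iInf₂ hmin₂).trans hhard.le
      have h3 := measure_lt_pos (hlt.trans_le (hmin Q₂ hQ₂))
      refine absurd (h3.trans_le ((measure_mono fun x hx => ?_).trans h2)) (lt_irrefl _)
      simp only [Set.mem_ofPred_eq] at hx ⊢
      linarith

end Dichotomy

end IncentivizedExploration

/-! ### Easy collections: bounds on `G_pad`, `ε_TS` and `δ_TS` -/

namespace IncentivizedExploration

variable {K : ℕ}

/-- The quantitative content, for a problem instance, of the assumption that the collection of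
priors is `δ`-easy and `δ`-non-dominant. -/
structure IsRegular (δ Φ : ℝ) (P : Fin K → Prior) : Prop where
  pos : 0 < δ
  lt_one : δ < 1
  le_one : Φ ≤ 1
  mean_le : ∀ i, mean (P i) ≤ Φ
  easy : ∀ i, δ ≤ ∫ x, max ((x : ℝ) - Φ) 0 ∂(P i : Measure unitInterval)
  nonDominant : ∀ i j, δ ≤ ∫ x, max (mean (P j) - (x : ℝ)) 0 ∂(P i : Measure unitInterval)

lemma isRegular_of_isEasy {δ : ℝ} (hδ : 0 < δ) {C : Set Prior} (he : IsEasy δ C)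
    (hd : IsNonDominant δ C) {P : Fin K → Prior} (hP : IsConsistent C P) (hK : 2 ≤ K) :
    IsRegular δ (Phi C) P where
  pos := hδ
  lt_one := delta_lt_one_of_easy he (hP ⟨0, by omega⟩)
  le_one := Phi_le_one C
  mean_le i := mean_le_Phi (hP i)
  easy i := (he.lt_integral (hP i)).le
  nonDominant i j := hd.le_integral hδ (hP i) (hP j)

namespace IsRegular

variable {δ Φ : ℝ} {P : Fin K → Prior}

lemma measurable_ind (Φ : ℝ) : Measurable fun x : unitInterval => if Φ < (x : ℝ) then (1 : ℝ) else 0 :=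
  Measurable.ite (measurableSet_lt measurable_const measurable_subtype_coe) measurable_const
    measurable_const

lemma abs_ind_le (Φ : ℝ) (x : unitInterval) : |(if Φ < (x : ℝ) then (1 : ℝ) else 0)| ≤ 1 := by
  split_ifs <;> simp

/-- Inserting `Φ` between the two arms splits the integral into `E(μ_j - Φ)₊ ≥ δ` and, by
independence, `Pr[μ_j > Φ] (Φ - μ_i⁰) ≥ 0`. -/
lemma le_integral_sub_mul_ind (h : IsRegular δ Φ P) {i j : Fin K} (hij : i ≠ j) :
    δ ≤ ∫ μ, ((μ j : ℝ) - μ i) * (if Φ < (μ j : ℝ) then 1 else 0) ∂(jointPrior P) := by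
  have hm := measurable_ind Φ
  have h1 : ∀ μ : Fin K → unitInterval, ((μ j : ℝ) - μ i) * (if Φ < (μ j : ℝ) then 1 else 0) =
      max ((μ j : ℝ) - Φ) 0 + (if Φ < (μ j : ℝ) then 1 else 0) * (Φ - μ i) := by
    intro μ
    split_ifs with hx
    · rw [max_eq_left (by linarith)]; ring
    · rw [max_eq_right (by linarith)]; ring
  simp_rw [h1]
  have i1 : Integrable (fun μ => max ((μ j : ℝ) - Φ) 0) (jointPrior P) :=
    ((integrable_coe_eval P j).sub (integrable_const Φ)).pos_part
  have hb : ∀ x : unitInterval, |Φ - (x : ℝ)| ≤ |Φ| + 1 := fun x => by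
    refine (abs_sub _ _).trans (add_le_add le_rfl ?_)
    rw [abs_of_nonneg x.2.1]; exact x.2.2
  have i2 : Integrable (fun μ : Fin K → unitInterval =>
      (if Φ < (μ j : ℝ) then (1 : ℝ) else 0) * (Φ - μ i)) (jointPrior P) := by
    refine integrable_joint P ((hm.comp (measurable_pi_apply j)).mul (by fun_prop)) (1 * (|Φ| + 1))
      fun μ => ?_
    rw [abs_mul]
    exact mul_le_mul (abs_ind_le Φ _) (hb _) (abs_nonneg _) zero_le_one
  rw [integral_add i1 i2, integral_eval P j (f := fun x => max ((x : ℝ) - Φ) 0) (by fun_prop),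
    integral_mul_eval P hij.symm (f := fun x => if Φ < (x : ℝ) then 1 else 0)
      (g := fun x => Φ - (x : ℝ)) hm (by fun_prop) 1 (|Φ| + 1) (abs_ind_le Φ) hb,
    integral_sub (integrable_const _) (integrable_coe _)]
  have h2 : 0 ≤ ∫ x : unitInterval, (if Φ < (x : ℝ) then (1 : ℝ) else 0)
      ∂(P j : Measure unitInterval) := integral_nonneg fun x => by
    show (0 : ℝ) ≤ if Φ < (x : ℝ) then (1 : ℝ) else 0
    split_ifs <;> norm_num
  have h3 : 0 ≤ (∫ _x, Φ ∂(P i : Measure unitInterval)) -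
      ∫ x, (x : ℝ) ∂(P i : Measure unitInterval) := by
    have := h.mean_le i
    simp only [integral_const, probReal_univ, smul_eq_mul, one_mul]
    exact sub_nonneg.2 this
  linarith [h.easy j, mul_nonneg h2 h3]

/-- The event `μ_j > Φ` is the same for all competitors, so the pairwise bounds can be averaged with
weights `q`; restricting to any event only lowers the expectation of a positive part. Point masses
`q` give `ε_TS`. -/
lemma le_integral_pos_part_sub_mix (h : IsRegular δ Φ P) (j : Fin K) {q : Fin K → ℝ}
    (hq : q ∈ stdSimplex ℝ (Fin K)) (hqj : q j = 0) :
    δ ≤ ∫ μ, max ((μ j : ℝ) - mix q μ) 0 ∂(jointPrior P) := by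
  have hm := measurable_ind Φ
  have i1 : ∀ i, Integrable (fun μ : Fin K → unitInterval =>
      ((μ j : ℝ) - μ i) * (if Φ < (μ j : ℝ) then 1 else 0)) (jointPrior P) := by
    intro i
    refine integrable_joint P (Measurable.mul (by fun_prop) (hm.comp (measurable_pi_apply j)))
      1 fun μ => ?_
    rw [abs_mul]
    exact mul_le_one₀ (abs_coe_sub_coe_le _ _) (abs_nonneg _) (abs_ind_le Φ _)
  calc δ = ∑ i, q i * δ := by rw [← Finset.sum_mul, hq.2, one_mul]
    _ ≤ ∑ i, q i * ∫ μ, ((μ j : ℝ) - μ i) * (if Φ < (μ j : ℝ) then 1 else 0) ∂(jointPrior P) := by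
        refine Finset.sum_le_sum fun i _ => ?_
        rcases eq_or_ne i j with rfl | hij
        · simp [hqj]
        · exact mul_le_mul_of_nonneg_left (h.le_integral_sub_mul_ind hij) (hq.1 i)
    _ = ∫ μ, ((μ j : ℝ) - mix q μ) * (if Φ < (μ j : ℝ) then 1 else 0) ∂(jointPrior P) := by
        simp_rw [sub_mix_eq_sum hq, Finset.sum_mul, mul_assoc]
        rw [integral_finsetSum _ fun i _ => (i1 i).const_mul _]
        simp_rw [integral_const_mul]
    _ ≤ _ := by
        refine integral_mono ?_ (integrable_joint P (by fun_prop) 1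
          (abs_sub_mix_le hq _)).pos_part fun μ => ?_
        · refine integrable_joint P (Measurable.mul (by fun_prop)
            (hm.comp (measurable_pi_apply j))) 1 fun μ => ?_
          rw [abs_mul]
          exact mul_le_one₀ (abs_sub_mix_le hq j μ) (abs_nonneg _) (abs_ind_le Φ _)
        · show _ ≤ max _ _
          split_ifs
          · rw [mul_one]; exact le_max_left _ _
          · rw [mul_zero]; exact le_max_right _ _

lemma le_gPad (h : IsRegular δ Φ P) : ENNReal.ofReal δ ≤ gPad P := by
  refine le_iInf fun j => le_iInf₂ fun q hq => ?_
  rw [lintegral_ofReal_eq_integral_max (integrable_joint P (by fun_prop) 1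
    (abs_sub_mix_le hq.1 j))]
  exact ENNReal.ofReal_le_ofReal (h.le_integral_pos_part_sub_mix j hq.1 (hq.2 j le_rfl))

lemma le_epsTS (h : IsRegular δ Φ P) : ENNReal.ofReal δ ≤ epsTS P := by
  refine le_iInf fun i => le_iInf fun j => le_iInf fun hij => ?_
  have hq : Pi.single j (1 : ℝ) ∈ stdSimplex ℝ (Fin K) := single_mem_stdSimplex ℝ j
  have h1 := h.le_integral_pos_part_sub_mix i hq (by simp [hij])
  have h2 : ∀ μ : Fin K → unitInterval, mix (Pi.single j (1 : ℝ)) μ = μ j := fun μ => by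
    simp [mix, Pi.single_apply]
  simp_rw [h2] at h1
  rw [lintegral_ofReal_eq_integral_max (f := fun μ : Fin K → unitInterval => (μ i : ℝ) - μ j)
    ((integrable_coe_eval P i).sub (integrable_coe_eval P j))]
  exact ENNReal.ofReal_le_ofReal h1

lemma le_measure_of_le_integral {Q : Prior} {f : unitInterval → ℝ} (hf : Measurable f)
    (hf1 : ∀ x, |f x| ≤ 1) {s : Set unitInterval} (hs : MeasurableSet s) (hfs : ∀ x ∉ s, f x ≤ 0)
    (h : δ ≤ ∫ x, max (f x) 0 ∂(Q : Measure unitInterval)) :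
    ENNReal.ofReal δ ≤ (Q : Measure unitInterval) s := by
  rw [← ofReal_measureReal]
  refine ENNReal.ofReal_le_ofReal (h.trans ?_)
  rw [← integral_indicator_one hs]
  refine integral_mono (integrable_prior Q hf 1 hf1).pos_part
    ((integrable_indicator_iff hs).2 (integrable_const _).integrableOn) fun x => ?_
  by_cases hx : x ∈ s
  · simp only [Set.indicator_of_mem hx, Pi.one_apply]
    exact max_le (abs_le.1 (hf1 x)).2 zero_le_one
  · simp only [Set.indicator_of_notMem hx]
    exact max_le (hfs x hx) le_rfl

/-- Arm `i` is best if it exceeds `Φ` and all others lie below `Φ`. These are independent events,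
each of probability at least `δ`: the first by easiness, the others by non-dominance, since `μ_i⁰ ≤
Φ`. -/
lemma le_measure_bestArm (h : IsRegular δ Φ P) (i : Fin K) :
    ENNReal.ofReal δ ^ K ≤ jointPrior P (bestArm i) := by
  set s : Fin K → Set unitInterval := fun k =>
    if k = i then {x | Φ < (x : ℝ)} else {x | (x : ℝ) < Φ} with hs
  have hΦ0 : 0 ≤ Φ := (mean_nonneg _).trans (h.mean_le i)
  have hb : ∀ a : ℝ, 0 ≤ a → a ≤ 1 → ∀ x : unitInterval, |(x : ℝ) - a| ≤ 1 :=
    fun a h0 h1 x => abs_le.2 ⟨by linarith [x.2.1], by linarith [x.2.2]⟩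
  have hm : ∀ k, ENNReal.ofReal δ ≤ (P k : Measure unitInterval) (s k) := by
    intro k
    rcases eq_or_ne k i with hk | hk
    · simp only [hs, hk, if_true]
      exact le_measure_of_le_integral (f := fun x => (x : ℝ) - Φ) (by fun_prop)
        (hb Φ hΦ0 h.le_one) (measurableSet_lt measurable_const measurable_subtype_coe)
        (fun x hx => by simp only [Set.mem_ofPred_eq, not_lt] at hx; linarith) (h.easy i)
    · simp only [hs, hk, if_false]
      exact le_measure_of_le_integral (f := fun x => mean (P i) - (x : ℝ)) (by fun_prop)
        (fun x => by rw [abs_sub_comm]; exact hb _ (mean_nonneg _) (mean_le_one _) x)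
        (measurableSet_lt measurable_subtype_coe measurable_const)
        (fun x hx => by
          simp only [Set.mem_ofPred_eq, not_lt] at hx
          linarith [h.mean_le i]) (h.nonDominant k i)
  calc ENNReal.ofReal δ ^ K = ∏ _k : Fin K, ENNReal.ofReal δ := by simp
    _ ≤ ∏ k, (P k : Measure unitInterval) (s k) := Finset.prod_le_prod' fun k _ => hm k
    _ = jointPrior P (Set.univ.pi s) := (Measure.pi_pi _ _).symm
    _ ≤ _ := by
        refine measure_mono fun μ hμ => ?_
        have hi : Φ < (μ i : ℝ) := by simpa [hs] using hμ i trivial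
        have hlt : ∀ k, k ≠ i → μ k < μ i := by
          intro k hk
          have : (μ k : ℝ) < Φ := by simpa [hs, hk] using hμ k trivial
          exact Subtype.coe_lt_coe.1 (this.trans hi)
        refine ⟨fun k => ?_, fun k hk => hlt k hk.ne⟩
        rcases eq_or_ne k i with rfl | hk
        · exact le_rfl
        · exact (hlt k hk).le

lemma le_deltaTS (h : IsRegular δ Φ P) : ENNReal.ofReal δ ^ K ≤ deltaTS P :=
  le_iInf fun i => h.le_measure_bestArm i

end IsRegular

/-! ### Bounds on `N_boot` and `p_boot` -/

section Boot

/-- Let `a = 1 - m`. Values `x > m` contribute at least `-a^(n+1)`, whereas values with `m - x ≥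
δ/2` carry weight at least `(a + δ/2)^n`. Since `a ≤ 1` gives `a + δ/2 ≥ a(1 + δ/2)`, the second
effect wins once `(1 + δ/2)^n > 2/δ`. -/
lemma integral_sub_mul_pow_pos {Q : Prior} {δ m : ℝ} (hδ : 0 < δ) (hm0 : 0 ≤ m) (hm : m ≤ 1)
    (h : δ ≤ ∫ x, max (m - (x : ℝ)) 0 ∂(Q : Measure unitInterval)) {n : ℕ}
    (hn : 2 / δ < (1 + δ / 2) ^ n) :
    0 < ∫ x, (m - (x : ℝ)) * (1 - (x : ℝ)) ^ n ∂(Q : Measure unitInterval) := by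
  set a := 1 - m with ha
  have ha0 : 0 ≤ a := by linarith
  have hpow : 0 < (a + δ / 2) ^ n := by positivity
  have i1 : Integrable (fun x : unitInterval => max (m - (x : ℝ)) 0) (Q : Measure unitInterval) :=
    (integrable_sub_coe Q m).pos_part
  have i2 : Integrable (fun x : unitInterval => max (m - (x : ℝ)) 0 - δ / 2)
      (Q : Measure unitInterval) := i1.sub (integrable_const _)
  have hbound : (a + δ / 2) ^ n * (δ / 2) - a ^ (n + 1) ≤
      ∫ x, (m - (x : ℝ)) * (1 - (x : ℝ)) ^ n ∂(Q : Measure unitInterval) := by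
    calc _ ≤ ∫ x, ((a + δ / 2) ^ n * (max (m - (x : ℝ)) 0 - δ / 2) - a ^ (n + 1))
          ∂(Q : Measure unitInterval) := by
          rw [integral_sub (i2.const_mul _) (integrable_const _),
            integral_const_mul, integral_sub i1 (integrable_const _)]
          simp only [integral_const, probReal_univ, smul_eq_mul, one_mul]
          have := mul_le_mul_of_nonneg_left h hpow.le
          linarith
      _ ≤ _ := by
          refine integral_mono ((i2.const_mul _).sub (integrable_const _)) ?_ fun x => ?_
          · refine integrable_prior Q (by fun_prop) (|m| + 1) fun x => ?_
            have h1 : |(1 - (x : ℝ)) ^ n| ≤ 1 := by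
              rw [abs_of_nonneg (pow_nonneg (by linarith [x.2.2]) n)]
              exact pow_le_one₀ (by linarith [x.2.2]) (by linarith [x.2.1])
            have h2 : |m - (x : ℝ)| ≤ |m| + 1 := (abs_sub _ _).trans (add_le_add le_rfl (by
              rw [abs_of_nonneg x.2.1]; exact x.2.2))
            rw [abs_mul]
            nlinarith [abs_nonneg (m - (x : ℝ)), abs_nonneg ((1 - (x : ℝ)) ^ n)]
          · have hx0 := x.2.1
            have hx1 := x.2.2
            have hap : 0 ≤ a ^ (n + 1) := by positivity
            have hy : 0 ≤ (1 - (x : ℝ)) ^ n := pow_nonneg (by linarith) n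
            show _ ≤ (m - (x : ℝ)) * (1 - (x : ℝ)) ^ n
            rcases le_total (m - (x : ℝ)) 0 with h1 | h1
            · rw [max_eq_right h1]
              have h2 : (1 - (x : ℝ)) ^ n ≤ a ^ n := pow_le_pow_left₀ (by linarith) (by linarith) n
              have h3 : (x - m) * (1 - (x : ℝ)) ^ n ≤ a * a ^ n :=
                mul_le_mul (by linarith) h2 hy ha0
              have h4 : a ^ (n + 1) = a * a ^ n := by ring
              nlinarith
            · rw [max_eq_left h1]
              rcases le_total (δ / 2) (m - (x : ℝ)) with h2 | h2
              · have h3 : (a + δ / 2) ^ n ≤ (1 - (x : ℝ)) ^ n :=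
                  pow_le_pow_left₀ (by positivity) (by linarith) n
                have h4 := mul_le_mul h3 (show m - (x : ℝ) - δ / 2 ≤ m - x by linarith)
                  (by linarith) hy
                linarith
              · nlinarith [mul_nonneg h1 hy]
  refine lt_of_lt_of_le ?_ hbound
  rcases ha0.eq_or_lt with h0 | h0
  · rw [← h0, zero_pow (Nat.succ_ne_zero n), sub_zero]
    positivity
  · have h1 : (a * (1 + δ / 2)) ^ n ≤ (a + δ / 2) ^ n :=
      pow_le_pow_left₀ (by positivity) (by
        nlinarith) n
    have h2 : a ^ n * (2 / δ) < (a * (1 + δ / 2)) ^ n := by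
      rw [mul_pow]
      exact mul_lt_mul_of_pos_left hn (by positivity)
    have h3 : a ^ (n + 1) ≤ a ^ n :=
      pow_le_pow_of_le_one ha0 (by linarith) (Nat.le_succ n)
    have h4 : a ^ n < (a + δ / 2) ^ n * (δ / 2) := by
      have h5 := mul_lt_mul_of_pos_right (h2.trans_le h1) (show (0 : ℝ) < δ / 2 by linarith)
      rwa [show a ^ n * (2 / δ) * (δ / 2) = a ^ n by field_simp] at h5
    linarith

/-- Jensen's inequality for the convex function `y ↦ y^n` on the nonnegative reals. -/
lemma le_integral_one_sub_pow {Q : Prior} {δ : ℝ} (hδ : 0 ≤ δ) (h : δ ≤ 1 - mean Q) (n : ℕ) :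
    δ ^ n ≤ ∫ x, (1 - (x : ℝ)) ^ n ∂(Q : Measure unitInterval) := by
  have hj := (convexOn_pow (𝕜 := ℝ) n).map_integral_le (μ := (Q : Measure unitInterval))
    (f := fun x : unitInterval => 1 - (x : ℝ)) (by fun_prop) isClosed_Ici
    (Filter.Eventually.of_forall fun x => by
      show (0 : ℝ) ≤ 1 - x
      linarith [x.2.2]) (integrable_sub_coe Q 1)
    (integrable_prior Q (by fun_prop) 1 fun x => by
      show |(1 - (x : ℝ)) ^ n| ≤ 1
      rw [abs_of_nonneg (pow_nonneg (by linarith [x.2.2]) n)]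
      exact pow_le_one₀ (by linarith [x.2.2]) (by linarith [x.2.1]))
  rw [integral_sub (integrable_const _) (integrable_coe Q)] at hj
  simp only [integral_const, probReal_univ, smul_eq_mul, one_mul] at hj
  exact (pow_le_pow_left₀ hδ h n).trans hj

lemma zerosGiven_eq_prod (j : Fin K) (n : ℕ) (μ : Fin K → unitInterval) :
    zerosGiven j n μ = ∏ i, if i < j then (1 - (μ i : ℝ)) ^ n else 1 := by
  rw [zerosGiven, ← Finset.prod_filter]
  congr 1
  ext i; simp

lemma zerosGiven_mem (j : Fin K) (n : ℕ) (μ : Fin K → unitInterval) :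
    0 ≤ zerosGiven j n μ ∧ zerosGiven j n μ ≤ 1 :=
  ⟨Finset.prod_nonneg fun i _ => pow_nonneg (by linarith [(μ i).2.2]) n,
    Finset.prod_le_one (fun i _ => pow_nonneg (by linarith [(μ i).2.2]) n)
      fun i _ => pow_le_one₀ (by linarith [(μ i).2.2]) (by linarith [(μ i).2.1])⟩

@[fun_prop]
lemma measurable_zerosGiven (j : Fin K) (n : ℕ) : Measurable (zerosGiven j n) := by
  unfold zerosGiven
  fun_prop

namespace IsRegular

variable {δ Φ : ℝ} {P : Fin K → Prior}

lemma le_one_sub_mean (h : IsRegular δ Φ P) (i : Fin K) : δ ≤ 1 - mean (P i) := by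
  refine (h.nonDominant i i).trans ?_
  calc _ ≤ ∫ x, (1 - (x : ℝ)) ∂(P i : Measure unitInterval) :=
        integral_mono (integrable_sub_coe _ _).pos_part (integrable_sub_coe _ _) fun x =>
          max_le (by linarith [mean_le_one (P i)]) (by linarith [x.2.2])
    _ = _ := by
        rw [integral_sub (integrable_const _) (integrable_coe _)]
        simp [mean]

lemma pow_le_zerosProb (h : IsRegular δ Φ P) (j : Fin K) (n : ℕ) :
    δ ^ (n * K) ≤ zerosProb P j n := by
  have hδ := h.pos
  unfold zerosProb
  simp_rw [zerosGiven_eq_prod]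
  rw [integral_prod_eval P fun i x => if i < j then (1 - (x : ℝ)) ^ n else 1]
  calc δ ^ (n * K) = ∏ _i : Fin K, δ ^ n := by simp [pow_mul]
    _ ≤ _ := by
        refine Finset.prod_le_prod (fun i _ => by positivity) fun i _ => ?_
        by_cases hij : i < j
        · simp only [hij, if_true]
          exact le_integral_one_sub_pow hδ.le (h.le_one_sub_mean i) n
        · simp only [hij, if_false, integral_const, probReal_univ, smul_eq_mul, one_mul]
          exact pow_le_one₀ hδ.le h.lt_one.le

lemma zerosGap_pos (h : IsRegular δ Φ P) {n : ℕ} (hn : 2 / δ < (1 + δ / 2) ^ n) {i j : Fin K}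
    (hij : i < j) : 0 < zerosGap P j i n := by
  have hδ := h.pos
  have hz : 0 < zerosProb P j n := (pow_pos hδ _).trans_le (h.pow_le_zerosProb j n)
  refine div_pos ?_ hz
  have hb : ∀ (a : ℝ) (x : unitInterval), 0 ≤ a → a ≤ 1 → |a - (x : ℝ)| ≤ 1 := fun a x h0 h1 =>
    abs_le.2 ⟨by linarith [x.2.2], by linarith [x.2.1]⟩
  have hb' : ∀ (a : ℝ) (μ : Fin K → unitInterval), 0 ≤ a → a ≤ 1 →
      |(a - (μ i : ℝ)) * zerosGiven j n μ| ≤ 1 := fun a μ h0 h1 => by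
    rw [abs_mul, abs_of_nonneg (zerosGiven_mem j n μ).1]
    exact mul_le_one₀ (hb a _ h0 h1) (zerosGiven_mem j n μ).1 (zerosGiven_mem j n μ).2
  -- The event concerns only arms before `j`, so arm `j` averages out to its prior mean.
  rw [integral_resample P j (by fun_prop) 1 fun μ => hb' _ μ (μ j).2.1 (μ j).2.2]
  have h1 : ∀ (μ : Fin K → unitInterval) (x : unitInterval),
      zerosGiven j n (Function.update μ j x) = zerosGiven j n μ := fun μ x =>
    Finset.prod_congr rfl fun l hl => by
      rw [Function.update_of_ne (Finset.mem_Iio.1 hl).ne]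
  simp_rw [h1, Function.update_self, Function.update_of_ne hij.ne, integral_mul_const]
  have h2 : ∀ μ : Fin K → unitInterval, ∫ x, ((x : ℝ) - μ i) ∂(P j : Measure unitInterval) =
      mean (P j) - μ i := fun μ => by
    rw [integral_sub (integrable_coe _) (integrable_const _)]
    simp [mean]
  simp_rw [h2]
  -- Resampling arm `i` separates its factor `(1 - x)^n` from the factor `R` of the remaining arms,
  -- so that the one-dimensional estimate applies.
  rw [integral_resample P i (by fun_prop) 1 fun μ => hb' _ μ (mean_nonneg _) (mean_le_one _)]
  set R : (Fin K → unitInterval) → ℝ := fun μ =>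
    ∏ l ∈ (Finset.Iio j).erase i, (1 - (μ l : ℝ)) ^ n with hR
  have hRm : Measurable R := by rw [hR]; fun_prop
  have h3 : ∀ (μ : Fin K → unitInterval) (x : unitInterval),
      zerosGiven j n (Function.update μ i x) = (1 - (x : ℝ)) ^ n * R μ := fun μ x => by
    rw [zerosGiven, ← Finset.mul_prod_erase _ _ (Finset.mem_Iio.2 hij), Function.update_self]
    congr 1
    refine Finset.prod_congr rfl fun l hl => ?_
    rw [Function.update_of_ne (Finset.ne_of_mem_erase hl)]
  simp_rw [h3, Function.update_self, ← mul_assoc, integral_mul_const]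
  rw [integral_const_mul]
  refine mul_pos (integral_sub_mul_pow_pos hδ (mean_nonneg _) (mean_le_one _) (h.nonDominant i j) hn)
    (hz.trans_le ?_)
  have hR01 : ∀ μ, 0 ≤ R μ ∧ R μ ≤ 1 := fun μ =>
    ⟨Finset.prod_nonneg fun i _ => pow_nonneg (by linarith [(μ i).2.2]) n,
    Finset.prod_le_one (fun i _ => pow_nonneg (by linarith [(μ i).2.2]) n)
      fun i _ => pow_le_one₀ (by linarith [(μ i).2.2]) (by linarith [(μ i).2.1])⟩
  refine integral_mono (integrable_joint P (by fun_prop) 1 fun μ => ?_)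
    (integrable_joint P hRm 1 fun μ => ?_) fun μ => ?_
  · rw [abs_of_nonneg (zerosGiven_mem j n μ).1]; exact (zerosGiven_mem j n μ).2
  · rw [abs_of_nonneg (hR01 μ).1]; exact (hR01 μ).2
  · have := h3 μ (μ i)
    rw [Function.update_eq_self] at this
    show zerosGiven j n μ ≤ R μ
    rw [this]
    exact mul_le_of_le_one_left (hR01 μ).1
      (pow_le_one₀ (by linarith [(μ i).2.2]) (by linarith [(μ i).2.1]))

lemma nBoot_le (h : IsRegular δ Φ P) {n : ℕ} (hn : 2 / δ < (1 + δ / 2) ^ n) : nBoot P ≤ n :=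
  iInf₂_le n fun _ _ hij => h.zerosGap_pos hn hij

/-- An upper bound on `N_boot` is enough, because `δ^(nK)` decreases in `n`. -/
lemma le_pBoot (h : IsRegular δ Φ P) {n : ℕ} (hn : 2 / δ < (1 + δ / 2) ^ n) :
    ENNReal.ofReal δ ^ (n * K) ≤ pBoot P := by
  have h1 : (nBoot P).toNat ≤ n := ENat.toNat_le_of_le_natCast (h.nBoot_le hn)
  refine le_iInf fun j => ?_
  rw [← ENNReal.ofReal_pow h.pos.le]
  refine ENNReal.ofReal_le_ofReal (le_trans ?_ (h.pow_le_zerosProb j _))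
  exact pow_le_pow_of_le_one h.pos.le h.lt_one.le (Nat.mul_le_mul_right K h1)

end IsRegular

end Boot

end IncentivizedExploration

/-! ### Polynomial bounds on `N_TS`, `N_pad` and the upper bound `UB` -/

namespace IncentivizedExploration

variable {K : ℕ}

lemma logE_mono {x y : ℝ≥0∞} (h : x ≤ y) : logE x ≤ logE y :=
  EReal.toENNReal_le_toENNReal (ENNReal.log_monotone h)

lemma logE_ofReal {r : ℝ} (hr : 0 < r) : logE (ENNReal.ofReal r) = ENNReal.ofReal (Real.log r) := by
  rw [logE, ENNReal.log_ofReal_of_pos hr, EReal.real_coe_toENNReal]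

namespace IsRegular

variable {δ Φ : ℝ} {P : Fin K → Prior}

lemma log_inv_le (h : IsRegular δ Φ P) (hK : 2 ≤ K) : Real.log δ⁻¹ ≤ Real.log (K / δ) := by
  have hδ := h.pos
  have : (2 : ℝ) ≤ K := by exact_mod_cast hK
  refine Real.log_le_log (by positivity) ?_
  rw [inv_eq_one_div]
  gcongr
  linarith

lemma log_two_div_le (h : IsRegular δ Φ P) (hK : 2 ≤ K) :
    Real.log (2 / δ) ≤ Real.log (K / δ) := by
  have hδ := h.pos
  have : (2 : ℝ) ≤ K := by exact_mod_cast hK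
  refine Real.log_le_log (by positivity) ?_
  gcongr

/-- A constant lower bound on the logarithm lets additive constants and lower powers of it be
absorbed in later estimates. -/
lemma half_le_log (h : IsRegular δ Φ P) (hK : 2 ≤ K) : 1 / 2 ≤ Real.log (K / δ) := by
  have hδ := h.pos
  have h1 : Real.log 2 ≤ Real.log (2 / δ) := Real.log_le_log two_pos (by
    rw [le_div_iff₀ hδ]; linarith [h.lt_one])
  linarith [h.log_two_div_le hK, Real.log_two_gt_d9]

lemma nTS_le (h : IsRegular δ Φ P) (hK : 2 ≤ K) {c : ℝ} (hc : 0 ≤ c) :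
    nTS c P ≤ ENNReal.ofReal (c * (K * Real.log (K / δ) / δ ^ 2)) := by
  have hδ := h.pos
  have hL := h.half_le_log hK
  have h1 : logE (deltaTS P)⁻¹ ≤ ENNReal.ofReal (K * Real.log (K / δ)) := by
    calc logE (deltaTS P)⁻¹ ≤ logE (ENNReal.ofReal ((δ ^ K)⁻¹)) := logE_mono (by
          rw [ENNReal.ofReal_inv_of_pos (by positivity), ENNReal.ofReal_pow hδ.le]
          exact ENNReal.inv_le_inv.2 h.le_deltaTS)
      _ = ENNReal.ofReal (Real.log ((δ ^ K)⁻¹)) := logE_ofReal (by positivity)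
      _ ≤ _ := ENNReal.ofReal_le_ofReal (by
          rw [← inv_pow, Real.log_pow]
          exact mul_le_mul_of_nonneg_left (h.log_inv_le hK) (Nat.cast_nonneg K))
  have h2 : (epsTS P)⁻¹ ≤ ENNReal.ofReal δ⁻¹ := by
    rw [ENNReal.ofReal_inv_of_pos hδ]
    exact ENNReal.inv_le_inv.2 h.le_epsTS
  calc nTS c P ≤ ENNReal.ofReal c * (ENNReal.ofReal δ⁻¹) ^ 2 *
        ENNReal.ofReal (K * Real.log (K / δ)) := by unfold nTS; gcongr
    _ = _ := by
        rw [← ENNReal.ofReal_pow (by positivity), ← ENNReal.ofReal_mul hc,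
          ← ENNReal.ofReal_mul (by positivity)]
        congr 1; field_simp

lemma inv_gPad_le (h : IsRegular δ Φ P) : (gPad P)⁻¹ ≤ ENNReal.ofReal δ⁻¹ := by
  rw [ENNReal.ofReal_inv_of_pos h.pos]
  exact ENNReal.inv_le_inv.2 h.le_gPad

lemma nPad_le (h : IsRegular δ Φ P) (hK : 2 ≤ K) {c : ℝ} (hc : 0 ≤ c) :
    nPad c P ≤ ENNReal.ofReal (c * (K * Real.log (K / δ) / δ ^ 2)) := by
  have hδ := h.pos
  have hL := h.half_le_log hK
  have hK' : (2 : ℝ) ≤ K := by exact_mod_cast hK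
  have h1 : logE (gPad P)⁻¹ ≤ ENNReal.ofReal (K * Real.log (K / δ)) :=
    calc logE (gPad P)⁻¹ ≤ logE (ENNReal.ofReal δ⁻¹) := logE_mono h.inv_gPad_le
      _ = ENNReal.ofReal (Real.log δ⁻¹) := logE_ofReal (by positivity)
      _ ≤ _ := ENNReal.ofReal_le_ofReal (by nlinarith [h.log_inv_le hK])
  have h2 := h.inv_gPad_le
  calc nPad c P ≤ ENNReal.ofReal c * (ENNReal.ofReal δ⁻¹) ^ 2 *
        ENNReal.ofReal (K * Real.log (K / δ)) := by unfold nPad; gcongr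
    _ = _ := by
        rw [← ENNReal.ofReal_pow (by positivity), ← ENNReal.ofReal_mul hc,
          ← ENNReal.ofReal_mul (by positivity)]
        congr 1; field_simp

/-- Since `log(1 + δ/2) ≥ δ/4`, any exponent above `4 log(K/δ)/δ` works; rounding up is paid for by
doubling. -/
lemma exists_bootLength (h : IsRegular δ Φ P) (hK : 2 ≤ K) :
    ∃ n : ℕ, 2 / δ < (1 + δ / 2) ^ n ∧ (n : ℝ) ≤ 8 * Real.log (K / δ) / δ := by
  have hδ := h.pos
  have hδ1 := h.lt_one
  have hL := h.half_le_log hK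
  set L := Real.log (K / δ) with hLdef
  refine ⟨⌊4 * L / δ⌋₊ + 1, ?_, ?_⟩
  · have h1 : 4 * L / δ < ((⌊4 * L / δ⌋₊ + 1 : ℕ) : ℝ) := by
      push_cast; exact Nat.lt_floor_add_one _
    have h2 : δ / 4 ≤ Real.log (1 + δ / 2) := by
      refine le_trans ?_ (Real.le_log_one_add_of_nonneg (by positivity))
      rw [div_le_div_iff₀ (by positivity) (by positivity)]
      nlinarith
    have h3 : L < ((⌊4 * L / δ⌋₊ + 1 : ℕ) : ℝ) * Real.log (1 + δ / 2) := by
      calc L = 4 * L / δ * (δ / 4) := by field_simp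
        _ < ((⌊4 * L / δ⌋₊ + 1 : ℕ) : ℝ) * (δ / 4) := by
            exact mul_lt_mul_of_pos_right h1 (by positivity)
        _ ≤ _ := mul_le_mul_of_nonneg_left h2 (by positivity)
    rw [← Real.log_lt_log_iff (by positivity) (by positivity), Real.log_pow]
    exact (h.log_two_div_le hK).trans_lt h3
  · have h1 : (⌊4 * L / δ⌋₊ : ℝ) ≤ 4 * L / δ := Nat.floor_le (by positivity)
    have h2 : 1 ≤ 4 * L / δ := by rw [le_div_iff₀ hδ]; linarith
    push_cast
    calc (⌊4 * L / δ⌋₊ : ℝ) + 1 ≤ 4 * L / δ + 4 * L / δ := add_le_add h1 h2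
      _ = _ := by ring

/-- Up to constants the four factors are `K`, `K log/δ²`, `1/δ` and `K log²/δ`. The last comes from
`p_boot ≥ δ^(nK)` with `n` of order `log/δ`. -/
lemma roundsUB_le (h : IsRegular δ Φ P) (hK : 2 ≤ K) {cTS cPad : ℝ} (hTS : 0 ≤ cTS)
    (hPad : 0 ≤ cPad) :
    roundsUB cPad P (nTS cTS P) ≤ ENNReal.ofReal
      (10 * (cTS + cPad + 8) * ((K : ℝ) ^ 3 / δ ^ 4) * Real.log (K / δ) ^ 3) := by
  have hδ := h.pos
  have hδ1 := h.lt_one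
  have hL := h.half_le_log hK
  have hK' : (2 : ℝ) ≤ K := by exact_mod_cast hK
  obtain ⟨n, hn, hnle⟩ := h.exists_bootLength hK
  set L := Real.log (K / δ) with hLdef
  have hM0 : 0 ≤ K * L / δ ^ 2 := by positivity
  have hmax : max (nTS cTS P) (max (nBoot P : ℝ≥0∞) (nPad cPad P)) ≤
      ENNReal.ofReal ((cTS + cPad + 8) * (K * L / δ ^ 2)) := by
    refine max_le ((h.nTS_le hK hTS).trans (ENNReal.ofReal_le_ofReal ?_))
      (max_le ?_ ((h.nPad_le hK hPad).trans (ENNReal.ofReal_le_ofReal ?_)))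
    · exact mul_le_mul_of_nonneg_right (by linarith) hM0
    · have h1 : (nBoot P : ℝ≥0∞) ≤ ((n : ℕ∞) : ℝ≥0∞) := ENat.toENNReal_le.2 (h.nBoot_le hn)
      rw [ENat.toENNReal_coe, ← ENNReal.ofReal_natCast] at h1
      refine h1.trans (ENNReal.ofReal_le_ofReal (hnle.trans ?_))
      calc 8 * L / δ ≤ 8 * (K * L / δ ^ 2) := by
            rw [div_le_iff₀ hδ]
            have : 8 * (K * L / δ ^ 2) * δ = 8 * L * (K / δ) := by field_simp
            rw [this]
            refine le_mul_of_one_le_right (by positivity) ?_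
            rw [le_div_iff₀ hδ]; linarith
        _ ≤ _ := mul_le_mul_of_nonneg_right (by linarith) hM0
    · exact mul_le_mul_of_nonneg_right (by linarith) hM0
  have hlog : logE ((gPad P)⁻¹ * (pBoot P)⁻¹) ≤ ENNReal.ofReal (10 * K * L ^ 2 / δ) := by
    have h1 : (pBoot P)⁻¹ ≤ ENNReal.ofReal ((δ ^ (n * K))⁻¹) := by
      rw [ENNReal.ofReal_inv_of_pos (by positivity), ENNReal.ofReal_pow hδ.le]
      exact ENNReal.inv_le_inv.2 (h.le_pBoot hn)
    calc _ ≤ logE (ENNReal.ofReal δ⁻¹ * ENNReal.ofReal ((δ ^ (n * K))⁻¹)) :=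
          logE_mono (mul_le_mul' h.inv_gPad_le h1)
      _ = ENNReal.ofReal (Real.log ((δ⁻¹) ^ (n * K + 1))) := by
          rw [← ENNReal.ofReal_mul (by positivity), logE_ofReal (by positivity)]
          congr 2
          rw [pow_succ, inv_pow]; ring
      _ ≤ _ := by
          refine ENNReal.ofReal_le_ofReal ?_
          rw [Real.log_pow]
          have h2 : ((n * K + 1 : ℕ) : ℝ) ≤ 10 * K * L / δ := by
            push_cast
            have h3 : (n : ℝ) * K ≤ 8 * L / δ * K := mul_le_mul_of_nonneg_right hnle (by positivity)
            have h4 : 1 ≤ 2 * K * L / δ := by rw [le_div_iff₀ hδ]; nlinarith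
            calc (n : ℝ) * K + 1 ≤ 8 * L / δ * K + 2 * K * L / δ := add_le_add h3 h4
              _ = _ := by ring
          calc _ ≤ 10 * K * L / δ * L :=
                mul_le_mul h2 (h.log_inv_le hK) (Real.log_nonneg (by
                  rw [one_le_inv₀ hδ]; exact hδ1.le)) (by positivity)
            _ = _ := by ring
  calc roundsUB cPad P (nTS cTS P) ≤ ENNReal.ofReal K *
        ENNReal.ofReal ((cTS + cPad + 8) * (K * L / δ ^ 2)) * ENNReal.ofReal δ⁻¹ *
          ENNReal.ofReal (10 * K * L ^ 2 / δ) := by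
        unfold roundsUB
        rw [ENNReal.ofReal_natCast]
        have := h.inv_gPad_le
        gcongr
    _ = _ := by
        rw [← ENNReal.ofReal_mul (by positivity), ← ENNReal.ofReal_mul (by positivity),
          ← ENNReal.ofReal_mul (by positivity)]
        congr 1
        field_simp

end IsRegular

end IncentivizedExploration

namespace IncentivizedExploration

variable {K : ℕ}

/-! ### Algorithms that agree in the first rounds -/

section Congr

lemma pmfExp_congr {α : Type*} (p : PMF α) {f g : α → ℝ≥0∞} (h : ∀ a ∈ p.support, f a = g a) :
    pmfExp p f = pmfExp p g :=
  le_antisymm (pmfExp_mono p fun a ha => (h a ha).le) (pmfExp_mono p fun a ha => (h a ha).ge)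

lemma choiceWeight_congr {alg alg' : Algorithm K} {T : ℕ}
    (hag : ∀ h : History K, h.length < T → alg' h = alg h) :
    ∀ h : History K, h.length ≤ T → choiceWeight alg' h = choiceWeight alg h
  | [], _ => rfl
  | p :: h, hl => by
    have hl' : h.length < T := hl
    simp only [choiceWeight]
    rw [choiceWeight_congr hag h hl'.le, hag h hl']

lemma historyLaw_congr {alg alg' : Algorithm K} {T : ℕ}
    (hag : ∀ h : History K, h.length < T → alg' h = alg h) (μ : Fin K → unitInterval) {t : ℕ}
    (ht : t ≤ T) : historyLaw alg' μ t = historyLaw alg μ t := by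
  ext h
  rw [historyLaw_apply, historyLaw_apply]
  split_ifs with hl
  · rw [choiceWeight_congr hag h (hl.trans_le ht)]
  · rfl

lemma recProb_congr {alg alg' : Algorithm K} {T : ℕ}
    (hag : ∀ h : History K, h.length < T → alg' h = alg h) {t : ℕ} (ht : t < T) (i : Fin K)
    (μ : Fin K → unitInterval) : recProb alg' t i μ = recProb alg t i μ := by
  rw [recProb_eq_pmfExp, recProb_eq_pmfExp, historyLaw_congr hag μ ht.le]
  congr 1
  exact pmfExp_congr _ fun h hh => by rw [hag h ((length_of_mem_support hh).trans_lt ht)]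

lemma isBICAt_congr {P : Fin K → Prior} {alg alg' : Algorithm K} {T : ℕ}
    (hag : ∀ h : History K, h.length < T → alg' h = alg h) {t : ℕ} (ht : t < T)
    (h : IsBICAt P alg t) : IsBICAt P alg' t := by
  rw [isBICAt_iff] at h ⊢
  simpa only [recProb_congr hag ht] using h

end Congr

/-! ### Exploration in blocks and the law of the recorded information -/

section Info

variable {N : ℕ}

/-- The information collected about the arms: for each arm, either nothing or the outcome of one
block of `N` samples. -/
abbrev Info (K N : ℕ) : Type := Fin K → Option (Fin N → Bool)

/-- The probability of the outcome of a block of samples of an arm with mean reward `m`. -/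
noncomputable def blockProb (m : unitInterval) (x : Fin N → Bool) : ℝ :=
  ∏ r, if x r then (m : ℝ) else 1 - m

/-- The likelihood of the information about a single arm. -/
noncomputable def optionProb (m : unitInterval) : Option (Fin N → Bool) → ℝ
  | none => 1
  | some x => blockProb m x

/-- The likelihood of the information about all arms. -/
noncomputable def infoProb (s : Info K N) (μ : Fin K → unitInterval) : ℝ :=
  ∏ i, optionProb (μ i) (s i)

lemma blockProb_nonneg (m : unitInterval) (x : Fin N → Bool) : 0 ≤ blockProb m x :=
  Finset.prod_nonneg fun r _ => by
    split_ifs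
    · exact m.2.1
    · linarith [m.2.2]

lemma sum_blockProb_mul_prod (m : unitInterval) (g : Bool → ℝ) :
    ∑ x : Fin N → Bool, blockProb m x * ∏ r, g (x r) = (m * g true + (1 - m) * g false) ^ N := by
  simp only [blockProb, ← Finset.prod_mul_distrib]
  have h := Finset.sum_prod_piFinset Finset.univ
    (fun (_ : Fin N) (b : Bool) => (if b then (m : ℝ) else 1 - m) * g b)
  rw [Fintype.piFinset_univ] at h
  rw [h]
  simp

lemma sum_blockProb (m : unitInterval) : ∑ x : Fin N → Bool, blockProb m x = 1 := by
  have := sum_blockProb_mul_prod (N := N) m fun _ => 1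
  simpa using this

lemma blockProb_le_one (m : unitInterval) (x : Fin N → Bool) : blockProb m x ≤ 1 := by
  rw [← sum_blockProb (N := N) m]
  exact Finset.single_le_sum (fun y _ => blockProb_nonneg m y) (Finset.mem_univ x)

lemma optionProb_mem (m : unitInterval) (o : Option (Fin N → Bool)) :
    0 ≤ optionProb m o ∧ optionProb m o ≤ 1 := by
  cases o with
  | none => exact ⟨zero_le_one, le_rfl⟩
  | some x => exact ⟨blockProb_nonneg m x, blockProb_le_one m x⟩

lemma infoProb_mem (s : Info K N) (μ : Fin K → unitInterval) :
    0 ≤ infoProb s μ ∧ infoProb s μ ≤ 1 :=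
  ⟨Finset.prod_nonneg fun _ _ => (optionProb_mem _ _).1,
    Finset.prod_le_one (fun _ _ => (optionProb_mem _ _).1) fun _ _ => (optionProb_mem _ _).2⟩

@[fun_prop]
lemma measurable_blockProb (x : Fin N → Bool) : Measurable fun m => blockProb m x := by
  unfold blockProb
  refine Finset.measurable_prod _ fun r _ => ?_
  split_ifs <;> fun_prop

@[fun_prop]
lemma measurable_optionProb (o : Option (Fin N → Bool)) : Measurable fun m => optionProb m o := by
  cases o with
  | none => exact measurable_const
  | some x => exact measurable_blockProb x

@[fun_prop]
lemma measurable_infoProb (s : Info K N) : Measurable (infoProb s) := by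
  unfold infoProb
  exact Finset.measurable_prod _ fun i _ =>
    (measurable_optionProb (s i)).comp (measurable_pi_apply i)

/-- The (unnormalized) posterior expectation of `μ_i - μ_k`, given the information `s`. -/
noncomputable def infoGap (P : Fin K → Prior) (i k : Fin K) (s : Info K N) : ℝ :=
  ∫ μ, ((μ i : ℝ) - μ k) * infoProb s μ ∂(jointPrior P)

/-- Recording the outcome `x` of a block of samples of arm `a`, where only the first block of
arm `j` is of interest. -/
noncomputable def record (j : Fin K) (s : Info K N) (a : Fin K) (x : Fin N → Bool) : Info K N :=
  if a = j ∧ s j = none then Function.update s j (some x) else s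

/-- The law of the information after one more block, if the law was `W` before, arms are chosen
by the rule `f`, and only the first block of arm `j` is recorded. -/
noncomputable def nextWeight (j : Fin K) (f : Info K N → PMF (Fin K)) (W : Info K N → ℝ)
    (s : Info K N) : ℝ :=
  if s j = none then W s * (1 - (f s j).toReal)
  else W s + W (Function.update s j none) * (f (Function.update s j none) j).toReal

/-- Some algorithm that is BIC for `T` rounds collects information whose law is `W` times the
likelihood. -/
def Reaches (P : Fin K → Prior) (N T : ℕ) (W : Info K N → ℝ) : Prop :=
  ∃ (alg : Algorithm K) (φ : History K → Info K N), IsBIC P alg T ∧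
    (∀ μ s, (pmfExp (historyLaw alg μ T) fun h => if φ h = s then 1 else 0).toReal =
      W s * infoProb s μ) ∧
    ∀ μ, ∀ h ∈ (historyLaw alg μ T).support, ∀ i, φ h i ≠ none → N ≤ (h.map Prod.fst).count i

/-- The hypothesis on single states determines the law of `φ h`, so any function of the state can be
averaged without reference to histories. -/
lemma toReal_pmfExp_comp {alg : Algorithm K} {φ : History K → Info K N} {T : ℕ}
    {W : Info K N → ℝ} {μ : Fin K → unitInterval}
    (hW : ∀ s, (pmfExp (historyLaw alg μ T) fun h => if φ h = s then 1 else 0).toReal =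
      W s * infoProb s μ) (g : Info K N → ℝ≥0∞) (hg : ∀ s, g s ≠ ∞) :
    (pmfExp (historyLaw alg μ T) fun h => g (φ h)).toReal =
      ∑ s, W s * infoProb s μ * (g s).toReal := by
  have h1 : ∀ s, (W s * infoProb s μ) = ∑ h ∈ historiesOfLength K T,
      (choiceWeight alg h).toReal * likelihood h μ * (if φ h = s then 1 else 0) := fun s => by
    rw [← hW s, toReal_pmfExp_historyLaw _ _ _ _ (fun h => by split_ifs <;> simp)]
    refine Finset.sum_congr rfl fun h _ => ?_
    split_ifs <;> simp
  rw [toReal_pmfExp_historyLaw _ _ _ _ (fun h => hg _)]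
  simp_rw [h1, Finset.sum_mul]
  rw [Finset.sum_comm]
  refine Finset.sum_congr rfl fun h _ => ?_
  simp [mul_assoc]

/-- The algorithm that follows `alg` for `T` rounds, then chooses an arm by `g` and keeps playing
it. -/
noncomputable def thenBlock (alg : Algorithm K) (T : ℕ) (g : Algorithm K) : Algorithm K
  | [] => if 0 < T then alg [] else g []
  | p :: h => if h.length + 1 < T then alg (p :: h) else
      if h.length + 1 = T then g (p :: h) else PMF.pure p.1

lemma thenBlock_of_lt {alg g : Algorithm K} {T : ℕ} (h : History K) (hl : h.length < T) :
    thenBlock alg T g h = alg h := by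
  cases h with
  | nil => simp only [List.length_nil] at hl; simp [thenBlock, hl]
  | cons p h => simp only [List.length_cons] at hl; simp [thenBlock, hl]

lemma thenBlock_of_eq {alg g : Algorithm K} {T : ℕ} (h : History K) (hl : h.length = T) :
    thenBlock alg T g h = g h := by
  cases h with
  | nil => simp only [List.length_nil] at hl; simp [thenBlock, ← hl]
  | cons p h => simp only [List.length_cons] at hl; simp [thenBlock, hl]

lemma thenBlock_cons_of_lt {alg g : Algorithm K} {T : ℕ} (p : Fin K × Bool) (h : History K)
    (hl : T ≤ h.length) : thenBlock alg T g (p :: h) = PMF.pure p.1 := by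
  simp only [thenBlock]
  rw [if_neg (by omega), if_neg (by omega)]

lemma sum_fin_succ_bool {n : ℕ} (F : (Fin (n + 1) → Bool) → ℝ≥0∞) :
    ∑ x, F x = ∑ x : Fin n → Bool, ∑ r : Bool, F (Fin.cons r x) := by
  rw [Finset.sum_comm, ← Fintype.sum_prod_type', ← (Fin.consEquiv fun _ => Bool).sum_comp]
  rfl

lemma pmfExp_rewardPMF (m : unitInterval) (F : Bool → ℝ≥0∞) :
    pmfExp (rewardPMF m) F = ∑ r, ENNReal.ofReal (if r then (m : ℝ) else 1 - m) * F r := by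
  rw [pmfExp, tsum_fintype]
  simp_rw [rewardPMF_apply]

lemma pmfExp_historyLaw_succ (alg : Algorithm K) (μ : Fin K → unitInterval) (t : ℕ)
    (F : History K → ℝ≥0∞) :
    pmfExp (historyLaw alg μ (t + 1)) F = pmfExp (historyLaw alg μ t) fun h =>
      pmfExp (alg h) fun a => pmfExp (rewardPMF (μ a)) fun r => F ((a, r) :: h) := by
  simp only [historyLaw, pmfExp_bind, pmfExp_pure]

/-- The arm is drawn once and then repeated, so a partial block of length `n` amounts to one draw
from `g` followed by `n` independent rewards of that arm. -/
lemma pmfExp_thenBlock (alg g : Algorithm K) (T n : ℕ) (μ : Fin K → unitInterval)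
    (F : History K → ℝ≥0∞) :
    pmfExp (historyLaw (thenBlock alg T g) μ (T + n)) F =
      pmfExp (historyLaw alg μ T) fun h => pmfExp (g h) fun a =>
        ∑ x : Fin n → Bool, ENNReal.ofReal (blockProb (μ a) x) *
          F (List.ofFn (fun r => (a, x r)) ++ h) := by
  induction n generalizing F with
  | zero =>
    rw [Nat.add_zero, historyLaw_congr (alg := alg) (fun h hl => thenBlock_of_lt h hl) μ le_rfl]
    simp [blockProb, pmfExp_const]
  | succ n ih =>
    rw [← Nat.add_assoc, pmfExp_historyLaw_succ, ih]
    refine pmfExp_congr _ fun h hh => ?_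
    have hl := length_of_mem_support hh
    simp only [pmfExp_rewardPMF]
    have hsplit : ∀ a : Fin K, ∑ x : Fin (n + 1) → Bool, ENNReal.ofReal (blockProb (μ a) x) *
        F (List.ofFn (fun r => (a, x r)) ++ h) = ∑ x : Fin n → Bool,
        ENNReal.ofReal (blockProb (μ a) x) * ∑ r : Bool,
          ENNReal.ofReal (if r then (μ a : ℝ) else 1 - μ a) *
          F ((a, r) :: (List.ofFn (fun r => (a, x r)) ++ h)) := by
      intro a
      rw [sum_fin_succ_bool]
      refine Finset.sum_congr rfl fun x _ => ?_
      rw [Finset.mul_sum]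
      refine Finset.sum_congr rfl fun r _ => ?_
      have h1 : blockProb (μ a) (Fin.cons r x : Fin (n + 1) → Bool) =
          blockProb (μ a) x * if r then (μ a : ℝ) else 1 - μ a := by
        simp only [blockProb, Fin.prod_univ_succ, Fin.cons_zero, Fin.cons_succ]
        ring
      rw [h1, ENNReal.ofReal_mul (blockProb_nonneg _ _), List.ofFn_succ]
      simp only [Fin.cons_zero, Fin.cons_succ, List.cons_append, mul_assoc]
    simp_rw [hsplit]
    -- The first round of the block draws the arm from `g`; later rounds copy the arm of the most
    -- recent entry.
    cases n with
    | zero => simp [blockProb, pmfExp_const, thenBlock_of_eq h hl]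
    | succ n =>
      refine pmfExp_congr _ fun a _ => Finset.sum_congr rfl fun x _ => ?_
      rw [List.ofFn_succ, List.cons_append, thenBlock_cons_of_lt _ _ (by simp [hl]), pmfExp_pure]

/-- All rounds of a block have the same recommendation probabilities, so the BIC property needs
checking only once per block. -/
lemma recProb_thenBlock {alg : Algorithm K} {φ : History K → Info K N} {T : ℕ}
    {W : Info K N → ℝ} {μ : Fin K → unitInterval}
    (hW : ∀ s, (pmfExp (historyLaw alg μ T) fun h => if φ h = s then 1 else 0).toReal =
      W s * infoProb s μ) (f : Info K N → PMF (Fin K)) (n : ℕ) (i : Fin K) :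
    recProb (thenBlock alg T fun h => f (φ h)) (T + n) i μ =
      ∑ s, W s * infoProb s μ * (f s i).toReal := by
  rw [← toReal_pmfExp_comp hW (fun s => f s i) fun s => PMF.apply_ne_top _ _, recProb_eq_pmfExp,
    pmfExp_thenBlock]
  congr 1
  refine pmfExp_congr _ fun h hh => ?_
  have hl := length_of_mem_support hh
  cases n with
  | zero => simp [blockProb, pmfExp_const, thenBlock_of_eq h hl]
  | succ n =>
    rw [← pmfExp_indicator (f (φ h)) i]
    refine pmfExp_congr _ fun a _ => ?_
    have h1 : ∀ x : Fin (n + 1) → Bool, thenBlock alg T (fun h => f (φ h))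
        (List.ofFn (fun r => (a, x r)) ++ h) i = if a = i then 1 else 0 := fun x => by
      rw [List.ofFn_succ, List.cons_append, thenBlock_cons_of_lt _ _ (by simp [hl])]
      simp [PMF.pure_apply, eq_comm]
    simp_rw [h1]
    rw [← Finset.sum_mul, ← ENNReal.ofReal_sum_of_nonneg fun x _ => blockProb_nonneg _ _,
      sum_blockProb, ENNReal.ofReal_one, one_mul]

lemma optionProb_update_mul (s : Info K N) (j : Fin K) (x : Fin N → Bool)
    (μ : Fin K → unitInterval) (hs : s j = none) :
    infoProb (Function.update s j (some x)) μ = infoProb s μ * blockProb (μ j) x := by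
  unfold infoProb
  rw [← Finset.mul_prod_erase _ _ (Finset.mem_univ j),
    ← Finset.mul_prod_erase _ (fun i => optionProb (μ i) (s i)) (Finset.mem_univ j),
    Function.update_self, hs]
  simp only [optionProb, one_mul]
  rw [mul_comm]
  congr 1
  refine Finset.prod_congr rfl fun i hi => ?_
  rw [Function.update_of_ne (Finset.ne_of_mem_erase hi)]

lemma sum_toReal_pmf (p : PMF (Fin K)) : ∑ a, (p a).toReal = 1 := by
  rw [← ENNReal.toReal_sum fun a _ => PMF.apply_ne_top _ _,
    (tsum_fintype _).symm.trans p.tsum_coe, ENNReal.toReal_one]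

/-- Outcomes that are not recorded sum to probability one, and a recorded block of arm `j` supplies
exactly the missing likelihood factor. Hence the law of the state remains a weight free of `μ` times
the likelihood. -/
lemma sum_nextWeight (j : Fin K) (f : Info K N → PMF (Fin K)) (W : Info K N → ℝ)
    (μ : Fin K → unitInterval) (s' : Info K N) :
    ∑ s, W s * infoProb s μ * ∑ a, (f s a).toReal * ∑ x, blockProb (μ a) x *
      (if record j s a x = s' then 1 else 0) = nextWeight j f W s' * infoProb s' μ := by
  have h1 : ∀ s : Info K N, ∑ a, (f s a).toReal * ∑ x, blockProb (μ a) x *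
      (if record j s a x = s' then (1 : ℝ) else 0) =
      (if s = s' then (if s j = none then 1 - (f s j).toReal else 1) else 0) +
        if s j = none then (f s j).toReal * ∑ x, blockProb (μ j) x *
          (if Function.update s j (some x) = s' then 1 else 0) else 0 := by
    intro s
    by_cases hs : s j = none
    · rw [← Finset.add_sum_erase _ _ (Finset.mem_univ j)]
      have h2 : ∀ a ∈ Finset.univ.erase j, (f s a).toReal * ∑ x, blockProb (μ a) x *
          (if record j s a x = s' then (1 : ℝ) else 0) =
          (f s a).toReal * (if s = s' then 1 else 0) := fun a ha => by
        simp only [record, Finset.ne_of_mem_erase ha, false_and, if_false]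
        rw [← Finset.sum_mul, sum_blockProb, one_mul]
      rw [Finset.sum_congr rfl h2, ← Finset.sum_mul]
      have h3 := Finset.add_sum_erase Finset.univ (fun a => (f s a).toReal) (Finset.mem_univ j)
      rw [sum_toReal_pmf] at h3
      rw [show ∑ a ∈ Finset.univ.erase j, (f s a).toReal = 1 - (f s j).toReal by linarith]
      simp only [record, hs, and_self, if_true]
      rw [add_comm]
      congr 1
      split_ifs <;> simp
    · simp only [record, hs, and_false, if_false, add_zero]
      simp_rw [← Finset.sum_mul, sum_blockProb, one_mul]
      rw [← Finset.sum_mul, sum_toReal_pmf, one_mul]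
  simp_rw [h1, mul_add, Finset.sum_add_distrib]
  simp only [mul_ite, mul_zero, Finset.sum_ite_eq', Finset.mem_univ, if_true]
  unfold nextWeight
  rcases hs' : s' j with _ | x₀
  · simp only [if_true]
    rw [Finset.sum_eq_zero, add_zero]
    · ring
    · intro s _
      split_ifs with hs
      · rw [Finset.sum_eq_zero, mul_zero, mul_zero]
        intro x _
        rw [if_neg]
        rintro rfl
        simp at hs'
      · rfl
  · simp only [reduceCtorEq, if_false, mul_one]
    rw [add_mul]
    congr 1
    rw [Finset.sum_eq_single (Function.update s' j none)]
    · simp only [Function.update_self, if_true, Function.update_idem]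
      rw [Finset.sum_eq_single x₀]
      · rw [← hs', Function.update_eq_self, if_pos rfl]
        have := optionProb_update_mul (Function.update s' j none) j x₀ μ (by simp)
        rw [Function.update_idem, ← hs', Function.update_eq_self] at this
        rw [this]
        ring
      · intro x _ hx
        rw [if_neg]
        intro he
        apply hx
        have := congrFun he j
        rw [Function.update_self, hs'] at this
        exact Option.some.inj this
      · simp
    · intro s _ hs
      split_ifs with hn
      · rw [Finset.sum_eq_zero, mul_zero, mul_zero]
        intro x _
        rw [if_neg]
        rintro rfl
        apply hs
        rw [Function.update_idem, ← hn, Function.update_eq_self]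
      · rfl
    · simp

/-- One more block of rounds can be played if the rule `f` is BIC. -/
lemma Reaches.next {P : Fin K → Prior} {T : ℕ} (hN : 0 < N) {W : Info K N → ℝ}
    (hW : Reaches P N T W) (j : Fin K) (f : Info K N → PMF (Fin K))
    (hf : ∀ i k, 0 ≤ ∑ s, W s * (f s i).toReal * infoGap P i k s) :
    Reaches P N (T + N) (nextWeight j f W) := by
  obtain ⟨alg, φ, hbic, hlaw, hcount⟩ := hW
  set alg' := thenBlock alg T fun h => f (φ h) with halg'
  -- The newest block occupies the first `N` entries and its arm is at the head. The defaults `j`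
  -- and `false` are never used on a history ending in a full block, since `0 < N`.
  set φ' : History K → Info K N := fun h =>
    record j (φ (h.drop N)) ((h.head?.map Prod.fst).getD j)
      (fun r => (h.map Prod.snd).getD r false) with hφ'
  have hφ'' : ∀ (h : History K) (a : Fin K) (x : Fin N → Bool),
      φ' (List.ofFn (fun r => (a, x r)) ++ h) = record j (φ h) a x := by
    intro h a x
    simp only [hφ']
    have e1 : (List.ofFn (fun r => (a, x r)) ++ h).drop N = h := List.drop_left' (by simp)
    have e2 : ((List.ofFn (fun r => (a, x r)) ++ h).head?.map Prod.fst).getD j = a := by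
      obtain ⟨n, rfl⟩ : ∃ n, N = n + 1 := ⟨N - 1, by omega⟩
      rw [List.ofFn_succ]
      simp
    have e3 : (fun r : Fin N => ((List.ofFn (fun r => (a, x r)) ++ h).map Prod.snd).getD r false)
        = x := by
      funext r
      rw [List.map_append, List.getD_append _ _ _ _ (by simp), List.getD_eq_getElem _ _ (by simp)]
      simp
    rw [e1, e2, e3]
  refine ⟨alg', φ', ?_, ?_, ?_⟩
  · intro t ht
    rcases lt_or_ge t T with htT | htT
    · exact isBICAt_congr (fun h hl => thenBlock_of_lt h hl) htT (hbic t htT)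
    · obtain ⟨n, rfl⟩ := Nat.exists_eq_add_of_le htT
      rw [isBICAt_iff]
      intro i k
      have h1 : ∀ μ : Fin K → unitInterval, ((μ i : ℝ) - μ k) * recProb alg' (T + n) i μ =
          ∑ s, W s * (f s i).toReal * (((μ i : ℝ) - μ k) * infoProb s μ) := by
        intro μ
        rw [halg', recProb_thenBlock (hlaw μ) f n i, Finset.mul_sum]
        exact Finset.sum_congr rfl fun s _ => by ring
      simp_rw [h1]
      rw [integral_finsetSum]
      · simp_rw [integral_const_mul]
        exact hf i k
      · intro s _
        refine Integrable.const_mul (integrable_joint P (by fun_prop) 1 fun μ => ?_) _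
        rw [abs_mul, abs_of_nonneg (infoProb_mem s μ).1]
        exact mul_le_one₀ (abs_coe_sub_coe_le _ _) (infoProb_mem s μ).1 (infoProb_mem s μ).2
  · intro μ s'
    rw [halg', pmfExp_thenBlock]
    simp_rw [hφ'']
    rw [toReal_pmfExp_comp (hlaw μ) (fun s => pmfExp (f s) fun a => ∑ x : Fin N → Bool,
      ENNReal.ofReal (blockProb (μ a) x) * (if record j s a x = s' then 1 else 0)),
      ← sum_nextWeight]
    · refine Finset.sum_congr rfl fun s _ => ?_
      congr 1
      rw [pmfExp, tsum_fintype, ENNReal.toReal_sum]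
      · refine Finset.sum_congr rfl fun a _ => ?_
        rw [ENNReal.toReal_mul, ENNReal.toReal_sum]
        · congr 1
          refine Finset.sum_congr rfl fun x _ => ?_
          rw [ENNReal.toReal_mul, ENNReal.toReal_ofReal (blockProb_nonneg _ _)]
          split_ifs <;> simp
        · intro x _
          split_ifs <;> simp
      · intro a _
        refine ENNReal.mul_ne_top (PMF.apply_ne_top _ _) (ENNReal.sum_ne_top.2 fun x _ => ?_)
        split_ifs <;> simp
    · intro s
      rw [pmfExp, tsum_fintype]
      refine ENNReal.sum_ne_top.2 fun a _ => ENNReal.mul_ne_top (PMF.apply_ne_top _ _)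
        (ENNReal.sum_ne_top.2 fun x _ => ?_)
      split_ifs <;> simp
  · intro μ h hh i hi
    by_contra hlt
    -- The histories violating the count are shown to have total probability zero, which excludes
    -- them from the support.
    have hz : pmfExp (historyLaw alg' μ (T + N)) (fun h =>
        if φ' h i ≠ none ∧ ¬ N ≤ (h.map Prod.fst).count i then 1 else 0) = 0 := by
      rw [halg', pmfExp_thenBlock]
      refine (pmfExp_congr _ fun h₀ hh₀ => ?_).trans (pmfExp_const (historyLaw alg μ T) 0)
      refine (pmfExp_congr _ fun a _ => Finset.sum_eq_zero fun x _ => ?_).trans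
        (pmfExp_const (f (φ h₀)) 0)
      rw [if_neg, mul_zero]
      rintro ⟨h1, h2⟩
      apply h2
      rw [hφ''] at h1
      have hmap : (List.ofFn (fun r => (a, x r)) ++ h₀).map Prod.fst =
          List.replicate N a ++ h₀.map Prod.fst := by
        rw [List.map_append, List.map_ofFn]
        congr 1
        exact List.ofFn_const N a
      rw [hmap, List.count_append]
      by_cases hn : φ h₀ i = none
      · have : a = i := by
          unfold record at h1
          split_ifs at h1 with hc
          · by_contra hne
            rw [Function.update_of_ne (by rw [← hc.1]; exact fun e => hne e.symm)] at h1
            exact h1 hn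
          · exact absurd hn h1
        rw [this, List.count_replicate_self]
        exact Nat.le_add_right _ _
      · exact (hcount μ h₀ hh₀ i hn).trans (Nat.le_add_left _ _)
    rw [pmfExp, ENNReal.tsum_eq_zero] at hz
    have := hz h
    rw [if_pos ⟨hi, hlt⟩, mul_one] at this
    exact (PMF.mem_support_iff _ _).1 hh this

end Info

end IncentivizedExploration

namespace IncentivizedExploration

variable {K N : ℕ}

/-! ### Posterior means given recorded blocks -/

section Posterior

/-- The marginal probability of the information about an arm with prior `Q`. -/
noncomputable def evidence (Q : Prior) (o : Option (Fin N → Bool)) : ℝ :=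
  ∫ x, optionProb x o ∂(Q : Measure unitInterval)

/-- The posterior mean reward of an arm with prior `Q`. -/
noncomputable def postMean (Q : Prior) (o : Option (Fin N → Bool)) : ℝ :=
  (∫ x, (x : ℝ) * optionProb x o ∂(Q : Measure unitInterval)) / evidence Q o

/-- The marginal probability of the information about all arms. -/
noncomputable def infoEvidence (P : Fin K → Prior) (s : Info K N) : ℝ := ∏ i, evidence (P i) (s i)

lemma integrable_optionProb (Q : Prior) (o : Option (Fin N → Bool)) :
    Integrable (fun x => optionProb x o) (Q : Measure unitInterval) :=
  integrable_prior Q (by fun_prop) 1 fun x => by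
    rw [abs_of_nonneg (optionProb_mem x o).1]; exact (optionProb_mem x o).2

lemma integrable_coe_mul_optionProb (Q : Prior) (o : Option (Fin N → Bool)) :
    Integrable (fun x : unitInterval => (x : ℝ) * optionProb x o) (Q : Measure unitInterval) :=
  integrable_prior Q (by fun_prop) 1 fun x => by
    rw [abs_of_nonneg (mul_nonneg x.2.1 (optionProb_mem x o).1)]
    exact mul_le_one₀ x.2.2 (optionProb_mem x o).1 (optionProb_mem x o).2

lemma evidence_nonneg (Q : Prior) (o : Option (Fin N → Bool)) : 0 ≤ evidence Q o :=
  integral_nonneg fun x => (optionProb_mem x o).1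

lemma integral_coe_mul_optionProb_mem (Q : Prior) (o : Option (Fin N → Bool)) :
    0 ≤ ∫ x, (x : ℝ) * optionProb x o ∂(Q : Measure unitInterval) ∧
      ∫ x, (x : ℝ) * optionProb x o ∂(Q : Measure unitInterval) ≤ evidence Q o :=
  ⟨integral_nonneg fun x => mul_nonneg x.2.1 (optionProb_mem x o).1,
    integral_mono (integrable_coe_mul_optionProb Q o) (integrable_optionProb Q o) fun x =>
      mul_le_of_le_one_left (optionProb_mem x o).1 x.2.2⟩

/-- This also holds for outcomes of probability zero: the numerator lies between `0` and the
evidence, so both sides vanish and no conditioning hypothesis is needed. -/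
lemma evidence_mul_postMean (Q : Prior) (o : Option (Fin N → Bool)) :
    evidence Q o * postMean Q o = ∫ x, (x : ℝ) * optionProb x o ∂(Q : Measure unitInterval) := by
  have h := integral_coe_mul_optionProb_mem Q o
  unfold postMean
  rcases (evidence_nonneg Q o).eq_or_lt with h0 | h0
  · rw [← h0] at h ⊢
    rw [zero_mul]; exact le_antisymm h.1 h.2
  · rw [mul_div_cancel₀ _ h0.ne']

lemma postMean_mem (Q : Prior) (o : Option (Fin N → Bool)) :
    0 ≤ postMean Q o ∧ postMean Q o ≤ 1 :=
  ⟨div_nonneg (integral_coe_mul_optionProb_mem Q o).1 (evidence_nonneg Q o),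
    div_le_one_of_le₀ (integral_coe_mul_optionProb_mem Q o).2 (evidence_nonneg Q o)⟩

lemma evidence_none (Q : Prior) : evidence Q (none : Option (Fin N → Bool)) = 1 := by
  simp [evidence, optionProb]

lemma postMean_none (Q : Prior) : postMean Q (none : Option (Fin N → Bool)) = mean Q := by
  simp [postMean, evidence_none, optionProb, mean]

lemma sum_evidence (Q : Prior) : ∑ x : Fin N → Bool, evidence Q (some x) = 1 := by
  unfold evidence
  rw [← integral_finsetSum _ fun x _ => integrable_optionProb Q (some x)]
  simp [optionProb, sum_blockProb]

lemma sum_evidence_mul_postMean (Q : Prior) :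
    ∑ x : Fin N → Bool, evidence Q (some x) * postMean Q (some x) = mean Q := by
  simp_rw [evidence_mul_postMean]
  rw [← integral_finsetSum _ fun x _ => integrable_coe_mul_optionProb Q (some x)]
  simp [optionProb, ← Finset.mul_sum, sum_blockProb, mean]

lemma infoEvidence_nonneg (P : Fin K → Prior) (s : Info K N) : 0 ≤ infoEvidence P s :=
  Finset.prod_nonneg fun _ _ => evidence_nonneg _ _

lemma integral_coe_mul_infoProb (P : Fin K → Prior) (i : Fin K) (s : Info K N) :
    ∫ μ, (μ i : ℝ) * infoProb s μ ∂(jointPrior P) = infoEvidence P s * postMean (P i) (s i) := by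
  have h1 : ∀ μ : Fin K → unitInterval, (μ i : ℝ) * infoProb s μ =
      ∏ l, (if l = i then (μ l : ℝ) else 1) * optionProb (μ l) (s l) := fun μ => by
    rw [Finset.prod_mul_distrib, infoProb]
    simp
  simp_rw [h1]
  rw [integral_prod_eval P fun l x => (if l = i then (x : ℝ) else 1) * optionProb x (s l)]
  have h2 : ∀ l, ∫ x, (if l = i then (x : ℝ) else 1) * optionProb x (s l)
      ∂(P l : Measure unitInterval) =
      evidence (P l) (s l) * if l = i then postMean (P l) (s l) else 1 := fun l => by
    split_ifs
    · rw [evidence_mul_postMean]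
    · simp [evidence]
  simp_rw [h2, Finset.prod_mul_distrib, infoEvidence]
  simp

/-- The prior and the likelihood are both products over arms, so the posterior is too, and each
posterior mean depends only on the block of its own arm. -/
lemma infoGap_eq (P : Fin K → Prior) (i k : Fin K) (s : Info K N) :
    infoGap P i k s = infoEvidence P s * (postMean (P i) (s i) - postMean (P k) (s k)) := by
  have hi : ∀ l : Fin K, Integrable (fun μ : Fin K → unitInterval => (μ l : ℝ) * infoProb s μ)
      (jointPrior P) := fun l => by
    refine integrable_joint P (by fun_prop) 1 fun μ => ?_
    rw [abs_of_nonneg (mul_nonneg (μ l).2.1 (infoProb_mem s μ).1)]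
    exact mul_le_one₀ (μ l).2.2 (infoProb_mem s μ).1 (infoProb_mem s μ).2
  unfold infoGap
  simp_rw [sub_mul]
  rw [integral_sub (hi i) (hi k), integral_coe_mul_infoProb, integral_coe_mul_infoProb, mul_sub]

end Posterior

/-! ### A block of `144/δ²` samples loses at most half of `δ` -/

section Estimate

/-- The average reward in a block. -/
noncomputable def blockMean (x : Fin N → Bool) : ℝ := (∑ r, if x r then (1 : ℝ) else 0) / N

lemma sum_blockProb_mul_exp_le (hN : 0 < N) (m : unitInterval) (θ : ℝ) :
    ∑ x : Fin N → Bool, blockProb m x * Real.exp (θ * ((m : ℝ) - blockMean x)) ≤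
      Real.exp (θ ^ 2 / N) := by
  have hN' : (N : ℝ) ≠ 0 := by positivity
  have h1 : ∀ x : Fin N → Bool, Real.exp (θ * ((m : ℝ) - blockMean x)) =
      ∏ r, Real.exp (θ / N * ((m : ℝ) - if x r then 1 else 0)) := fun x => by
    rw [← Real.exp_sum, ← Finset.mul_sum, Finset.sum_sub_distrib]
    congr 1
    simp only [blockMean, Finset.sum_const, Finset.card_univ, Fintype.card_fin, nsmul_eq_mul]
    field_simp
  simp_rw [h1]
  rw [sum_blockProb_mul_prod m fun b => Real.exp (θ / N * ((m : ℝ) - if b then 1 else 0))]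
  have h2 : (m : ℝ) * Real.exp (θ / N * ((m : ℝ) - if true then 1 else 0)) +
      (1 - m) * Real.exp (θ / N * ((m : ℝ) - if false then 1 else 0)) ≤
      Real.exp ((θ / N) ^ 2) := by
    simp only [if_true, Bool.false_eq_true, if_false, sub_zero]
    have hm0 := m.2.1
    have hm1 := m.2.2
    have key : ∀ y : ℝ, |y| ≤ 1 → Real.exp (θ / N * y) ≤ θ / N * y + Real.exp ((θ / N) ^ 2) := by
      intro y hy
      refine (exp_le_add_exp_sq _).trans (add_le_add le_rfl (Real.exp_le_exp.2 ?_))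
      rw [mul_pow]
      exact mul_le_of_le_one_right (sq_nonneg _) ((sq_le_one_iff_abs_le_one _).2 hy)
    have k1 := mul_le_mul_of_nonneg_left
      (key ((m : ℝ) - 1) (abs_le.2 ⟨by linarith, by linarith⟩)) hm0
    have k2 := mul_le_mul_of_nonneg_left
      (key (m : ℝ) (abs_le.2 ⟨by linarith, by linarith⟩)) (by linarith : 0 ≤ 1 - (m : ℝ))
    linarith
  calc _ ≤ Real.exp ((θ / N) ^ 2) ^ N := pow_le_pow_left₀ (by
        have := m.2.1
        have : 0 ≤ 1 - (m : ℝ) := by linarith [m.2.2]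
        positivity) h2 N
    _ = _ := by
        rw [← Real.exp_nat_mul]
        congr 1; field_simp

/-- With `θ = 12/δ` the exponential moments at `±θ` are at most `e`, and `|y| ≤ (exp(θy) +
exp(-θy))/θ` gives the bound `2e/θ = eδ/6`, where `e < 3`. -/
lemma sum_blockProb_mul_abs_le {δ : ℝ} (hδ : 0 < δ) (hN : 144 / δ ^ 2 ≤ N) (m : unitInterval) :
    ∑ x : Fin N → Bool, blockProb m x * |(m : ℝ) - blockMean x| ≤ δ / 2 := by
  have hN0 : (0 : ℝ) < N := lt_of_lt_of_le (by positivity) hN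
  have hN' : 0 < N := by exact_mod_cast hN0
  set θ := 12 / δ with hθ
  have hθ0 : 0 < θ := by positivity
  have hsq : θ ^ 2 / N ≤ 1 := by
    rw [div_le_one hN0, hθ, div_pow]; norm_num; exact hN
  have habs : ∀ y : ℝ, |y| ≤ (Real.exp (θ * y) + Real.exp (-θ * y)) / θ := fun y => by
    rw [le_div_iff₀ hθ0]
    rcases abs_cases y with ⟨h, -⟩ | ⟨h, -⟩ <;> rw [h]
    · linarith [Real.add_one_le_exp (θ * y), Real.exp_pos (-θ * y)]
    · linarith [Real.add_one_le_exp (-θ * y), Real.exp_pos (θ * y)]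
  calc _ ≤ ∑ x : Fin N → Bool, blockProb m x * ((Real.exp (θ * ((m : ℝ) - blockMean x)) +
        Real.exp (-θ * ((m : ℝ) - blockMean x))) / θ) :=
        Finset.sum_le_sum fun x _ => mul_le_mul_of_nonneg_left (habs _) (blockProb_nonneg m x)
    _ = ((∑ x : Fin N → Bool, blockProb m x * Real.exp (θ * ((m : ℝ) - blockMean x))) +
        ∑ x : Fin N → Bool, blockProb m x * Real.exp (-θ * ((m : ℝ) - blockMean x))) / θ := by
        rw [← Finset.sum_add_distrib, Finset.sum_div]
        exact Finset.sum_congr rfl fun x _ => by ring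
    _ ≤ (Real.exp 1 + Real.exp 1) / θ := by
        refine div_le_div_of_nonneg_right (add_le_add ?_ ?_) hθ0.le
        · exact (sum_blockProb_mul_exp_le hN' m θ).trans (Real.exp_le_exp.2 hsq)
        · exact (sum_blockProb_mul_exp_le hN' m (-θ)).trans (Real.exp_le_exp.2 (by
            rw [neg_sq]; exact hsq))
    _ ≤ δ / 2 := by
        rw [div_le_iff₀ hθ0, hθ, show δ / 2 * (12 / δ) = 6 by field_simp; norm_num]
        linarith [Real.exp_one_lt_d9]

/-- Replacing the mean reward by its posterior mean does not decrease the expectation of the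
positive part of its distance to `b` by much. -/
lemma half_le_sum_evidence_mul {δ : ℝ} (hδ : 0 < δ) (hN : 144 / δ ^ 2 ≤ N) (Q : Prior) (b σ : ℝ)
    (hσ : |σ| = 1)
    (h : δ ≤ ∫ x, max (σ * ((x : ℝ) - b)) 0 ∂(Q : Measure unitInterval)) :
    δ / 2 ≤ ∑ x : Fin N → Bool, evidence Q (some x) * max (σ * (postMean Q (some x) - b)) 0 := by
  classical
  -- Deciding the sign by the empirical mean `e` instead of the true value `y` costs at most `|y -
  -- e|`. Once the decision depends on the block alone, conditioning replaces `y` by the posterior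
  -- mean. The sign `σ` treats both tails together.
  have hpt : ∀ y e : ℝ, max (σ * (y - b)) 0 ≤
      (if 0 < σ * (e - b) then σ * (y - b) else 0) + |y - e| := by
    intro y e
    have h1 : |σ * (y - b) - σ * (e - b)| = |y - e| := by
      rw [← mul_sub, abs_mul, hσ, one_mul]; congr 1; ring
    have h2 := abs_le.1 h1.le
    split_ifs with hc
    · exact max_le (by linarith [abs_nonneg (y - e)]) (by linarith)
    · exact max_le (by linarith) (by linarith [abs_nonneg (y - e)])
  have hint : ∀ x : Fin N → Bool, Integrable (fun m : unitInterval =>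
      σ * ((m : ℝ) - b) * blockProb m x) (Q : Measure unitInterval) := fun x => by
    have h1 := (((integrable_coe_mul_optionProb Q (some x)).sub
      ((integrable_optionProb Q (some x)).const_mul b)).const_mul σ)
    refine h1.congr (Filter.Eventually.of_forall fun m => ?_)
    simp only [Pi.sub_apply, optionProb]; ring
  have hval : ∀ x : Fin N → Bool, ∫ m, σ * ((m : ℝ) - b) * blockProb m x
      ∂(Q : Measure unitInterval) =
      evidence Q (some x) * (σ * (postMean Q (some x) - b)) := fun x => by
    have h1 : ∀ m : unitInterval, σ * ((m : ℝ) - b) * blockProb m x =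
        σ * ((m : ℝ) * optionProb m (some x) - b * optionProb m (some x)) := fun m => by
      simp only [optionProb]; ring
    simp_rw [h1]
    rw [integral_const_mul, integral_sub (integrable_coe_mul_optionProb Q (some x))
      ((integrable_optionProb Q (some x)).const_mul b), integral_const_mul,
      ← evidence_mul_postMean]
    change σ * (_ - b * evidence Q (some x)) = _
    ring
  have hite : ∀ x : Fin N → Bool, Integrable (fun m : unitInterval =>
      if 0 < σ * (blockMean x - b) then σ * ((m : ℝ) - b) * blockProb m x else 0)
      (Q : Measure unitInterval) := fun x => by
    split_ifs
    · exact hint x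
    · exact integrable_zero _ _ _
  have hmain : ∫ x, max (σ * ((x : ℝ) - b)) 0 ∂(Q : Measure unitInterval) ≤
      ∫ m, ((∑ x : Fin N → Bool, if 0 < σ * (blockMean x - b) then
        σ * ((m : ℝ) - b) * blockProb m x else 0) + δ / 2) ∂(Q : Measure unitInterval) := by
    refine integral_mono ((integrable_coe_sub Q b).const_mul σ).pos_part
      ((integrable_finsetSum _ fun x _ => hite x).add (integrable_const _)) fun m => ?_
    calc max (σ * ((m : ℝ) - b)) 0 =
          ∑ x : Fin N → Bool, blockProb m x * max (σ * ((m : ℝ) - b)) 0 := by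
          rw [← Finset.sum_mul, sum_blockProb, one_mul]
      _ ≤ ∑ x : Fin N → Bool, blockProb m x * ((if 0 < σ * (blockMean x - b) then
          σ * ((m : ℝ) - b) else 0) + |(m : ℝ) - blockMean x|) :=
          Finset.sum_le_sum fun x _ => mul_le_mul_of_nonneg_left (hpt _ _) (blockProb_nonneg m x)
      _ ≤ _ := by
          simp_rw [mul_add, Finset.sum_add_distrib]
          refine add_le_add (le_of_eq (Finset.sum_congr rfl fun x _ => ?_))
            (sum_blockProb_mul_abs_le hδ hN m)
          split_ifs <;> ring
  rw [integral_add (integrable_finsetSum _ fun x _ => hite x) (integrable_const _),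
    integral_finsetSum _ fun x _ => hite x] at hmain
  have hle : ∀ x : Fin N → Bool, (∫ m, (if 0 < σ * (blockMean x - b) then
      σ * ((m : ℝ) - b) * blockProb m x else 0) ∂(Q : Measure unitInterval)) ≤
      evidence Q (some x) * max (σ * (postMean Q (some x) - b)) 0 := fun x => by
    split_ifs
    · rw [hval]
      exact mul_le_mul_of_nonneg_left (le_max_left _ _) (evidence_nonneg _ _)
    · rw [integral_zero]
      exact mul_nonneg (evidence_nonneg _ _) (le_max_right _ _)
  have hsum := Finset.sum_le_sum fun x (_ : x ∈ (Finset.univ : Finset (Fin N → Bool))) => hle x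
  simp only [integral_const, probReal_univ, smul_eq_mul, one_mul] at hmain
  linarith

namespace IsRegular

variable {δ Φ : ℝ} {P : Fin K → Prior}

lemma half_le_sum_postMean_sub (h : IsRegular δ Φ P) (hN : 144 / δ ^ 2 ≤ N) (j : Fin K) :
    δ / 2 ≤ ∑ x : Fin N → Bool, evidence (P j) (some x) * max (postMean (P j) (some x) - Φ) 0 := by
  simpa using half_le_sum_evidence_mul h.pos hN (P j) Φ 1 (by simp) (by simpa using h.easy j)

open Classical in
lemma half_le_sum_evidence_le (h : IsRegular δ Φ P) (hN : 144 / δ ^ 2 ≤ N) (i j : Fin K) :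
    δ / 2 ≤ ∑ x : Fin N → Bool, evidence (P i) (some x) *
      if postMean (P i) (some x) ≤ mean (P j) then 1 else 0 := by
  refine (half_le_sum_evidence_mul h.pos hN (P i) (mean (P j)) (-1) (by simp)
    (by simpa using h.nonDominant i j)).trans (Finset.sum_le_sum fun x _ =>
      mul_le_mul_of_nonneg_left ?_ (evidence_nonneg _ _))
  have h1 := postMean_mem (P i) (some x)
  have h2 := mean_le_one (P j)
  split_ifs with hc
  · exact max_le (by linarith) zero_le_one
  · exact max_le (by linarith) le_rfl

end IsRegular

end Estimate

end IncentivizedExploration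

namespace IncentivizedExploration

variable {K N : ℕ}

/-! ### Sums over the states with a given set of explored arms -/

section Domain

/-- The information `s` is about the arms in `J`. -/
def HasDomain (J : Finset (Fin K)) (s : Info K N) : Prop := ∀ i, s i ≠ none ↔ i ∈ J

lemma hasDomain_insert_iff {J : Finset (Fin K)} {j : Fin K} (hj : j ∉ J) (s : Info K N) :
    HasDomain (insert j J) s ↔ s j ≠ none ∧ HasDomain J (Function.update s j none) := by
  constructor
  · intro h
    refine ⟨(h j).2 (Finset.mem_insert_self j J), fun i => ?_⟩
    rcases eq_or_ne i j with rfl | hij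
    · simp [hj]
    · rw [Function.update_of_ne hij, h i, Finset.mem_insert, or_iff_right hij]
  · rintro ⟨h1, h2⟩ i
    rcases eq_or_ne i j with rfl | hij
    · simp [h1]
    · have := h2 i
      rw [Function.update_of_ne hij] at this
      rw [this, Finset.mem_insert, or_iff_right hij]

lemma HasDomain.eq_none {J : Finset (Fin K)} {s : Info K N} (h : HasDomain J s) {j : Fin K}
    (hj : j ∉ J) : s j = none := by
  by_contra hne
  exact hj ((h j).1 hne)

open Classical in
-- Having domain `J` is a condition on each coordinate separately, so the sum of products factors
-- over the arms.
lemma sum_hasDomain_prod (J : Finset (Fin K)) (u : Fin K → Option (Fin N → Bool) → ℝ) :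
    ∑ s : Info K N, (if HasDomain J s then ∏ i, u i (s i) else 0) =
      ∏ i, if i ∈ J then ∑ x, u i (some x) else u i none := by
  have h1 : ∀ s : Info K N, (if HasDomain J s then ∏ i, u i (s i) else 0) =
      ∏ i, if (s i ≠ none ↔ i ∈ J) then u i (s i) else 0 := by
    intro s
    split_ifs with h
    · exact Finset.prod_congr rfl fun i _ => by rw [if_pos (h i)]
    · obtain ⟨i, hi⟩ := not_forall.1 h
      exact (Finset.prod_eq_zero (Finset.mem_univ i) (if_neg hi)).symm
  simp_rw [h1]
  have h2 := Finset.prod_univ_sum (fun _ : Fin K => (Finset.univ : Finset (Option (Fin N → Bool))))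
    fun i o => if (o ≠ none ↔ i ∈ J) then u i o else 0
  rw [Fintype.piFinset_univ] at h2
  rw [← h2]
  refine Finset.prod_congr rfl fun i _ => ?_
  rw [Fintype.sum_option]
  by_cases hi : i ∈ J <;> simp [hi]

open Classical in
lemma sum_hasDomain_insert {J : Finset (Fin K)} {j : Fin K} (hj : j ∉ J) (F : Info K N → ℝ) :
    ∑ s : Info K N, (if HasDomain (insert j J) s then F s else 0) =
      ∑ s : Info K N, if HasDomain J s then ∑ x, F (Function.update s j (some x)) else 0 := by
  have h1 : ∀ s : Info K N, (if HasDomain J s then ∑ x, F (Function.update s j (some x)) else 0) =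
      ∑ x, if HasDomain J s then F (Function.update s j (some x)) else 0 := fun s => by
    split_ifs <;> simp
  simp_rw [h1]
  rw [← Fintype.sum_prod_type']
  simp_rw [← Finset.sum_filter]
  refine Finset.sum_bij' (fun s _ => (Function.update s j none, (s j).getD fun _ => false))
    (fun p _ => Function.update p.1 j (some p.2)) ?_ ?_ ?_ ?_ ?_
  · intro s hs
    have hs' := (hasDomain_insert_iff hj s).1 (Finset.mem_filter.1 hs).2
    exact Finset.mem_filter.2 ⟨Finset.mem_univ _, hs'.2⟩
  · intro p hp
    have hp' := (Finset.mem_filter.1 hp).2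
    refine Finset.mem_filter.2 ⟨Finset.mem_univ _, (hasDomain_insert_iff hj _).2 ⟨by simp, ?_⟩⟩
    rw [Function.update_idem, ← hp'.eq_none hj, Function.update_eq_self]
    exact hp'
  · intro s hs
    have hs' := (hasDomain_insert_iff hj s).1 (Finset.mem_filter.1 hs).2
    obtain ⟨x, hx⟩ := Option.ne_none_iff_exists'.1 hs'.1
    simp only [Function.update_idem, hx, Option.getD_some]
    rw [← hx, Function.update_eq_self]
  · intro p hp
    have hp' := (Finset.mem_filter.1 hp).2
    simp only [Function.update_idem, Function.update_self, Option.getD_some]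
    rw [← hp'.eq_none hj, Function.update_eq_self]
  · intro s hs
    have hs' := (hasDomain_insert_iff hj s).1 (Finset.mem_filter.1 hs).2
    obtain ⟨x, hx⟩ := Option.ne_none_iff_exists'.1 hs'.1
    simp only [Function.update_idem, hx, Option.getD_some]
    rw [← hx, Function.update_eq_self]

lemma infoEvidence_update (P : Fin K → Prior) {s : Info K N} {j : Fin K} (hs : s j = none)
    (x : Fin N → Bool) : infoEvidence P (Function.update s j (some x)) =
      infoEvidence P s * evidence (P j) (some x) := by
  unfold infoEvidence
  rw [← Finset.mul_prod_erase _ _ (Finset.mem_univ j),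
    ← Finset.mul_prod_erase _ (fun i => evidence (P i) (s i)) (Finset.mem_univ j),
    Function.update_self, hs, evidence_none, one_mul, mul_comm]
  congr 1
  refine Finset.prod_congr rfl fun i hi => ?_
  rw [Function.update_of_ne (Finset.ne_of_mem_erase hi)]

open Classical in
lemma sum_infoEvidence (P : Fin K → Prior) (J : Finset (Fin K)) :
    ∑ s : Info K N, (if HasDomain J s then infoEvidence P s else 0) = 1 := by
  unfold infoEvidence
  rw [sum_hasDomain_prod J fun i o => evidence (P i) o]
  refine Finset.prod_eq_one fun i _ => ?_
  split_ifs
  · exact sum_evidence _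
  · exact evidence_none _

open Classical in
-- The tower property: posterior means average to the prior mean, whether or not arm `k` has been
-- explored.
lemma sum_infoEvidence_mul_postMean (P : Fin K → Prior) (J : Finset (Fin K)) (k : Fin K) :
    ∑ s : Info K N, (if HasDomain J s then infoEvidence P s * postMean (P k) (s k) else 0) =
      mean (P k) := by
  have h1 : ∀ s : Info K N, infoEvidence P s * postMean (P k) (s k) =
      ∏ i, evidence (P i) (s i) * if i = k then postMean (P i) (s i) else 1 := fun s => by
    rw [Finset.prod_mul_distrib, infoEvidence]
    simp
  simp_rw [h1]
  rw [sum_hasDomain_prod J fun i o => evidence (P i) o * if i = k then postMean (P i) o else 1,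
    Finset.prod_eq_single k]
  · simp only [if_true, sum_evidence_mul_postMean, evidence_none, postMean_none, one_mul, ite_self]
  · intro i _ hi
    simp only [hi, if_false, mul_one, sum_evidence, evidence_none, ite_self]
  · simp

end Domain

/-! ### Exploring one arm: free exploration, exploitation and growth -/

section Phase

open Classical

/-- All arms of `J` have a posterior mean reward of at most the prior mean reward of arm `j`. -/
def AllWorse (P : Fin K → Prior) (J : Finset (Fin K)) (j : Fin K) (s : Info K N) : Prop :=
  ∀ i ∈ J, postMean (P i) (s i) ≤ mean (P j)

/-- The law of the information during the exploration of arm `j`, when the arms of `J` have been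
explored before. Arm `j` has been explored with probability `α` where all arms of `J` look worse,
and with probability `β` elsewhere. -/
noncomputable def phaseWeight (P : Fin K → Prior) (J : Finset (Fin K)) (j : Fin K) (α β : ℝ)
    (s : Info K N) : ℝ :=
  if HasDomain J s then (if AllWorse P J j s then 1 - α else 1 - β)
  else if HasDomain (insert j J) s then (if AllWorse P J j s then α else β) else 0

/-- The rule that explores arm `j` with probability `ρ`, and exploits otherwise. -/
noncomputable def phaseRule (P : Fin K → Prior) (Φ : ℝ) (J : Finset (Fin K)) (j : Fin K) (ρ : ℝ)
    (best : Info K N → Fin K) (s : Info K N) (a : Fin K) : ℝ :=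
  if HasDomain J s then
    if AllWorse P J j s then (if a = j then 1 else 0)
    else ρ * (if a = j then 1 else 0) + (1 - ρ) * (if a = best s then 1 else 0)
  else if Φ < postMean (P j) (s j) then (if a = j then 1 else 0)
  else (if a = best s then 1 else 0)

lemma phaseRule_nonneg (P : Fin K → Prior) (Φ : ℝ) (J : Finset (Fin K)) (j : Fin K) {ρ : ℝ}
    (h0 : 0 ≤ ρ) (h1 : ρ ≤ 1) (best : Info K N → Fin K) (s : Info K N) (a : Fin K) :
    0 ≤ phaseRule P Φ J j ρ best s a := by
  have : 0 ≤ 1 - ρ := by linarith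
  unfold phaseRule
  split_ifs <;> simp [h0, this]

lemma sum_phaseRule (P : Fin K → Prior) (Φ : ℝ) (J : Finset (Fin K)) (j : Fin K) (ρ : ℝ)
    (best : Info K N → Fin K) (s : Info K N) : ∑ a, phaseRule P Φ J j ρ best s a = 1 := by
  unfold phaseRule
  split_ifs
  · simp
  · rw [Finset.sum_add_distrib, ← Finset.mul_sum, ← Finset.mul_sum]; simp
  · simp
  · simp

lemma exists_pmf_of_sum_eq_one {g : Fin K → ℝ} (h0 : ∀ a, 0 ≤ g a) (h1 : ∑ a, g a = 1) :
    ∃ p : PMF (Fin K), ∀ a, (p a).toReal = g a :=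
  ⟨PMF.ofFintype (fun a => ENNReal.ofReal (g a)) (by
    rw [← ENNReal.ofReal_sum_of_nonneg fun a _ => h0 a, h1, ENNReal.ofReal_one]),
    fun a => by rw [PMF.ofFintype_apply, ENNReal.toReal_ofReal (h0 a)]⟩

lemma allWorse_update (P : Fin K → Prior) {J : Finset (Fin K)} {j : Fin K} (hj : j ∉ J)
    (s : Info K N) (o : Option (Fin N → Bool)) :
    AllWorse P J j (Function.update s j o) ↔ AllWorse P J j s :=
  forall₂_congr fun i hi => by
    have hij : i ≠ j := fun e => hj (e ▸ hi)
    rw [Function.update_of_ne hij]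

variable {P : Fin K → Prior} {J : Finset (Fin K)} {j : Fin K}

/-- An unexplored arm `j` keeps its prior mean, and some explored arm has a larger posterior mean.
Thus exploitation never explores `j` by accident, and the explored mass is known exactly. -/
lemma best_ne (hj : j ∉ J) {best : Info K N → Fin K}
    (hbest : ∀ s k, postMean (P k) (s k) ≤ postMean (P (best s)) (s (best s))) {s : Info K N}
    (hs : HasDomain J s) (hw : ¬ AllWorse P J j s) : best s ≠ j := by
  intro he
  apply hw
  intro i _
  have := hbest s i
  rwa [he, hs.eq_none hj, postMean_none] at this

/-- One block fully explores `j` where all explored arms look worse, so `α` becomes `1`; elsewhere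
the unexplored mass is multiplied by `1 - ρ`, which turns `β` into `β'`. -/
lemma nextWeight_phaseWeight (hj : j ∉ J) {α β β' ρ Φ : ℝ} (hρ : (1 - β) * ρ = β' - β)
    {best : Info K N → Fin K}
    (hbest : ∀ s k, postMean (P k) (s k) ≤ postMean (P (best s)) (s (best s)))
    {f : Info K N → PMF (Fin K)} (hf : ∀ s a, (f s a).toReal = phaseRule P Φ J j ρ best s a) :
    nextWeight j f (phaseWeight P J j α β) = phaseWeight P J j 1 β' := by
  have hrule : ∀ s : Info K N, HasDomain J s →
      (f s j).toReal = if AllWorse P J j s then 1 else ρ := fun s hs => by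
    rw [hf, phaseRule, if_pos hs]
    by_cases hw : AllWorse P J j s
    · simp [hw]
    · simp [hw, (best_ne hj hbest hs hw).symm]
  have hJ : ∀ s : Info K N, HasDomain J s → s j = none := fun s hs => hs.eq_none hj
  funext s
  unfold nextWeight
  split_ifs with hs
  · by_cases hd : HasDomain J s
    · rw [hrule s hd]
      simp only [phaseWeight, hd, if_true]
      split_ifs
      · ring
      · linarith
    · have hd' : ¬ HasDomain (insert j J) s := fun h => ((hasDomain_insert_iff hj s).1 h).1 hs
      simp only [phaseWeight, hd, hd', if_false, zero_mul]
  · have hd : ¬ HasDomain J s := fun h => hs (hJ s h)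
    by_cases hd' : HasDomain J (Function.update s j none)
    · have hi : HasDomain (insert j J) s := (hasDomain_insert_iff hj s).2 ⟨hs, hd'⟩
      rw [hrule _ hd']
      simp only [phaseWeight, hd, hd', hi, if_true, if_false, allWorse_update P hj]
      split_ifs
      · ring
      · linarith
    · have hi : ¬ HasDomain (insert j J) s := fun h => hd' ((hasDomain_insert_iff hj s).1 h).2
      have hi' : ¬ HasDomain (insert j J) (Function.update s j none) := fun h =>
        ((hasDomain_insert_iff hj _).1 h).1 (by simp)
      simp only [phaseWeight, hd, hd', hi, hi', if_false, zero_mul, add_zero]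

namespace IsRegular

variable {δ Φ : ℝ}

/-- The requirements on the arms of `J` are independent, each of probability at least `δ/2`; arms
outside `J` contribute the factor `1`. -/
lemma le_sum_allWorse (h : IsRegular δ Φ P) (hN : 144 / δ ^ 2 ≤ N) (J : Finset (Fin K))
    (j : Fin K) : (δ / 2) ^ K ≤ ∑ s : Info K N,
      if HasDomain J s then (if AllWorse P J j s then infoEvidence P s else 0) else 0 := by
  have hδ := h.pos
  have h1 : ∀ s : Info K N, (if AllWorse P J j s then infoEvidence P s else 0) =
      ∏ i, evidence (P i) (s i) * if i ∈ J → postMean (P i) (s i) ≤ mean (P j) then 1 else 0 := by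
    intro s
    rw [Finset.prod_mul_distrib]
    split_ifs with hw
    · rw [Finset.prod_eq_one (f := fun i => if i ∈ J → postMean (P i) (s i) ≤ mean (P j)
        then (1 : ℝ) else 0) (fun i _ => if_pos (hw i)), mul_one, infoEvidence]
    · obtain ⟨i, hi⟩ := not_forall.1 hw
      rw [Finset.prod_eq_zero (f := fun i => if i ∈ J → postMean (P i) (s i) ≤ mean (P j)
        then (1 : ℝ) else 0) (Finset.mem_univ i) (if_neg hi), mul_zero]
  simp_rw [h1]
  rw [sum_hasDomain_prod J fun i o => evidence (P i) o *
    if i ∈ J → postMean (P i) o ≤ mean (P j) then 1 else 0]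
  calc (δ / 2) ^ K = ∏ _i : Fin K, δ / 2 := by
        rw [Finset.prod_const, Finset.card_univ, Fintype.card_fin]
    _ ≤ _ := by
        refine Finset.prod_le_prod (fun i _ => by positivity) fun i _ => ?_
        by_cases hi : i ∈ J
        · simpa [hi] using h.half_le_sum_evidence_le hN i j
        · rw [if_neg hi, if_pos fun hi' => absurd hi' hi, evidence_none, mul_one]
          linarith [h.lt_one]

/-- The gain of exploiting arm `j` once it has been explored. -/
lemma le_sum_exploit (h : IsRegular δ Φ P) (hN : 144 / δ ^ 2 ≤ N) (hj : j ∉ J)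
    {α β : ℝ} (hβ : 0 ≤ β) (hαβ : β ≤ α) {k : Fin K}
    (hk : k ≠ j) :
    δ / 2 * ((α - β) * (δ / 2) ^ K + β) ≤
      ∑ s : Info K N, if HasDomain (insert j J) s then
        (if Φ < postMean (P j) (s j) then (if AllWorse P J j s then α else β) *
          (infoEvidence P s * (postMean (P j) (s j) - postMean (P k) (s k))) else 0) else 0 := by
  have hδ := h.pos
  rw [sum_hasDomain_insert hj]
  set E := ∑ x : Fin N → Bool, evidence (P j) (some x) * max (postMean (P j) (some x) - Φ) 0 with hE
  set p := ∑ x : Fin N → Bool, evidence (P j) (some x) *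
    (if Φ < postMean (P j) (some x) then 1 else 0) with hp
  have hE1 : δ / 2 ≤ E := h.half_le_sum_postMean_sub hN j
  have hp0 : 0 ≤ p := Finset.sum_nonneg fun x _ => mul_nonneg (evidence_nonneg _ _) (by
    split_ifs <;> norm_num)
  have hinner : ∀ s : Info K N, s j = none → ∑ x, (if Φ < postMean (P j)
      (Function.update s j (some x) j) then
      (if AllWorse P J j (Function.update s j (some x)) then α else β) *
        (infoEvidence P (Function.update s j (some x)) *
          (postMean (P j) (Function.update s j (some x) j) -
            postMean (P k) (Function.update s j (some x) k))) else 0) =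
      (if AllWorse P J j s then α else β) * infoEvidence P s *
        (E + p * (Φ - postMean (P k) (s k))) := by
    intro s hs
    rw [hE, hp, Finset.sum_mul, ← Finset.sum_add_distrib, Finset.mul_sum]
    refine Finset.sum_congr rfl fun x _ => ?_
    simp only [Function.update_self, Function.update_of_ne hk, allWorse_update P hj,
      infoEvidence_update P hs]
    by_cases hx : Φ < postMean (P j) (some x)
    · rw [if_pos hx, if_pos hx, max_eq_left (by linarith)]; ring
    · rw [if_neg hx, if_neg hx, max_eq_right (by linarith)]; ring
  -- The explored mass is written as `(α - β)` on the states where all look worse, plus `β` on all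
  -- states. On the former `Φ` dominates pointwise; on the latter it does so after averaging, by the
  -- tower property.
  have hsum : ∀ s : Info K N, (if HasDomain J s then ∑ x, (if Φ < postMean (P j)
      (Function.update s j (some x) j) then
      (if AllWorse P J j (Function.update s j (some x)) then α else β) *
        (infoEvidence P (Function.update s j (some x)) *
          (postMean (P j) (Function.update s j (some x) j) -
            postMean (P k) (Function.update s j (some x) k))) else 0) else 0) =
      E * ((α - β) * (if HasDomain J s then (if AllWorse P J j s then infoEvidence P s else 0)
          else 0) + β * (if HasDomain J s then infoEvidence P s else 0)) +
      p * ((α - β) * (if HasDomain J s then (if AllWorse P J j s then infoEvidence P s *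
          (Φ - postMean (P k) (s k)) else 0) else 0) +
        β * (Φ * (if HasDomain J s then infoEvidence P s else 0) -
          (if HasDomain J s then infoEvidence P s * postMean (P k) (s k) else 0))) := by
    intro s
    by_cases hd : HasDomain J s
    · simp only [hd, if_true]
      rw [hinner s (hd.eq_none hj)]
      split_ifs <;> ring
    · simp [hd]
  rw [Finset.sum_congr rfl fun s _ => hsum s]
  simp only [Finset.sum_add_distrib, Finset.sum_sub_distrib, ← Finset.mul_sum, sum_infoEvidence,
    sum_infoEvidence_mul_postMean]
  have hz := h.le_sum_allWorse hN J j
  set z := ∑ s : Info K N, if HasDomain J s then (if AllWorse P J j s then infoEvidence P s else 0)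
    else 0
  have hz' : 0 ≤ ∑ s : Info K N, if HasDomain J s then (if AllWorse P J j s then
      infoEvidence P s * (Φ - postMean (P k) (s k)) else 0) else 0 := by
    refine Finset.sum_nonneg fun s _ => ?_
    split_ifs with hd hw
    · refine mul_nonneg (infoEvidence_nonneg P s) (sub_nonneg.2 ?_)
      by_cases hkJ : k ∈ J
      · exact (hw k hkJ).trans (h.mean_le j)
      · rw [hd.eq_none hkJ, postMean_none]; exact h.mean_le k
    · exact le_rfl
    · exact le_rfl
  have hm := h.mean_le k
  have h1 : δ / 2 * ((α - β) * (δ / 2) ^ K + β) ≤ E * ((α - β) * z + β * 1) := by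
    rw [mul_one]
    refine mul_le_mul hE1 (add_le_add (mul_le_mul_of_nonneg_left hz (by linarith)) le_rfl) ?_
      (by linarith)
    have : 0 ≤ α - β := by linarith
    positivity
  have h2 : 0 ≤ p * ((α - β) * (∑ s : Info K N, if HasDomain J s then (if AllWorse P J j s then
      infoEvidence P s * (Φ - postMean (P k) (s k)) else 0) else 0) +
        β * (Φ * 1 - mean (P k))) :=
    mul_nonneg hp0 (add_nonneg (mul_nonneg (by linarith) hz') (mul_nonneg hβ (by linarith)))
  linarith

/-- For arm `j`, free exploration and recommendation as the best arm cost nothing. Randomized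
exploration has total mass at most `β' - β` and gap at least `-1`; `hstep` says that this is covered
by the gain of `le_sum_exploit`. -/
lemma sum_phaseRule_nonneg (h : IsRegular δ Φ P) (hN : 144 / δ ^ 2 ≤ N) (hj : j ∉ J)
    (hmax : ∀ k ∉ J, mean (P k) ≤ mean (P j)) {α β β' ρ : ℝ} (hβ : 0 ≤ β) (hαβ : β ≤ α)
    (hα : α ≤ 1) (hββ' : β ≤ β') (hρ0 : 0 ≤ ρ) (hρ1 : ρ ≤ 1) (hρ : (1 - β) * ρ = β' - β)
    (hstep : β' - β ≤ δ / 2 * ((α - β) * (δ / 2) ^ K + β))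
    {best : Info K N → Fin K}
    (hbest : ∀ s k, postMean (P k) (s k) ≤ postMean (P (best s)) (s (best s))) (i k : Fin K) :
    0 ≤ ∑ s, phaseWeight P J j α β s * phaseRule P Φ J j ρ best s i * infoGap P i k s := by
  have hw0 : ∀ s : Info K N, 0 ≤ phaseWeight P J j α β s := fun s => by
    unfold phaseWeight
    split_ifs <;> linarith
  have hr0 := phaseRule_nonneg P Φ J j hρ0 hρ1 best
  by_cases hij : i = j
  · subst hij
    by_cases hki : k = i
    · subst hki
      simp [infoGap_eq]
    have hle : ∀ s : Info K N, (if HasDomain (insert i J) s then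
        (if Φ < postMean (P i) (s i) then (if AllWorse P J i s then α else β) *
          (infoEvidence P s * (postMean (P i) (s i) - postMean (P k) (s k))) else 0) else 0) -
        (β' - β) * (if HasDomain J s then infoEvidence P s else 0) ≤
        phaseWeight P J i α β s * phaseRule P Φ J i ρ best s i * infoGap P i k s := by
      intro s
      have hΛ := infoEvidence_nonneg P s
      rw [infoGap_eq]
      by_cases hd : HasDomain J s
      · have hd' : ¬ HasDomain (insert i J) s := fun h' =>
          ((hasDomain_insert_iff hj s).1 h').1 (hd.eq_none hj)
        simp only [phaseWeight, phaseRule, hd, hd', if_true, if_false, zero_sub]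
        rw [hd.eq_none hj, postMean_none]
        have hloss : -((β' - β) * infoEvidence P s) ≤ 0 := by
          have : 0 ≤ β' - β := by linarith
          have := mul_nonneg this hΛ
          linarith
        split_ifs with hw hb
        · refine hloss.trans (mul_nonneg (by linarith) (mul_nonneg hΛ (sub_nonneg.2 ?_)))
          by_cases hkJ : k ∈ J
          · exact hw k hkJ
          · rw [hd.eq_none hkJ, postMean_none]; exact hmax k hkJ
        · exact absurd hb.symm (best_ne hj hbest hd hw)
        · rw [mul_one, mul_zero, add_zero, hρ]
          have h1 := mean_nonneg (P i)
          have h2 := (postMean_mem (P k) (s k)).2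
          have h3 : 0 ≤ (β' - β) * infoEvidence P s := mul_nonneg (by linarith) hΛ
          nlinarith
      · by_cases hd' : HasDomain (insert i J) s
        · simp only [phaseWeight, phaseRule, hd, hd', if_true, if_false, mul_zero, sub_zero]
          by_cases hx : Φ < postMean (P i) (s i)
          · rw [if_pos hx, if_pos hx, mul_one]
          · rw [if_neg hx, if_neg hx]
            by_cases hb : i = best s
            · rw [if_pos hb, mul_one]
              refine mul_nonneg (by split_ifs <;> linarith) (mul_nonneg hΛ (sub_nonneg.2 ?_))
              have := hbest s k
              rwa [← hb] at this
            · rw [if_neg hb, mul_zero, zero_mul]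
        · simp [phaseWeight, hd, hd']
    refine le_trans ?_ (Finset.sum_le_sum fun s _ => hle s)
    rw [Finset.sum_sub_distrib, ← Finset.mul_sum, sum_infoEvidence]
    have := h.le_sum_exploit hN hj hβ hαβ hki
    linarith
  -- An arm other than `j` is recommended only when it has the largest posterior mean, so every term
  -- is nonnegative.
  · refine Finset.sum_nonneg fun s _ => ?_
    rw [infoGap_eq]
    by_cases hb : i = best s
    · refine mul_nonneg (mul_nonneg (hw0 s) (hr0 s i)) (mul_nonneg (infoEvidence_nonneg P s)
        (sub_nonneg.2 ?_))
      have := hbest s k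
      rwa [← hb] at this
    · have : phaseRule P Φ J j ρ best s i = 0 := by
        simp [phaseRule, hij, hb]
      rw [this, mul_zero, zero_mul]

/-- One step of the exploration of arm `j`. -/
lemma reaches_phaseWeight_step (h : IsRegular δ Φ P) (hN : 144 / δ ^ 2 ≤ N) (hj : j ∉ J)
    (hmax : ∀ k ∉ J, mean (P k) ≤ mean (P j)) {α β β' : ℝ} (hβ : 0 ≤ β) (hαβ : β ≤ α)
    (hα : α ≤ 1) (hββ' : β ≤ β') (hβ' : β' ≤ 1)
    (hstep : β' - β ≤ δ / 2 * ((α - β) * (δ / 2) ^ K + β)) {T : ℕ}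
    (hT : Reaches P N T (phaseWeight P J j α β)) :
    Reaches P N (T + N) (phaseWeight P J j 1 β') := by
  have hN0 : 0 < N := by
    have hδ := h.pos
    have : (0 : ℝ) < N := lt_of_lt_of_le (by positivity) hN
    exact_mod_cast this
  -- The exploration probability is conditional on `j` being still unexplored, hence the division by
  -- `1 - β`; if nothing is left, `ρ = 0`.
  obtain ⟨ρ, hρ0, hρ1, hρ⟩ : ∃ ρ : ℝ, 0 ≤ ρ ∧ ρ ≤ 1 ∧ (1 - β) * ρ = β' - β := by
    rcases (hββ'.trans hβ').eq_or_lt with h1 | h1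
    · exact ⟨0, le_rfl, zero_le_one, by rw [mul_zero]; linarith⟩
    · refine ⟨(β' - β) / (1 - β), div_nonneg (by linarith) (by linarith),
        (div_le_one (by linarith)).2 (by linarith), mul_div_cancel₀ _ (by linarith)⟩
  have : Nonempty (Fin K) := ⟨j⟩
  choose best hbest using fun s : Info K N => Finite.exists_max fun k => postMean (P k) (s k)
  choose f hf using fun s : Info K N => exists_pmf_of_sum_eq_one
    (phaseRule_nonneg P Φ J j hρ0 hρ1 best s) (sum_phaseRule P Φ J j ρ best s)
  rw [← nextWeight_phaseWeight (α := α) hj hρ hbest hf]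
  refine hT.next hN0 j f fun i k => ?_
  simp_rw [hf]
  exact h.sum_phaseRule_nonneg hN hj hmax hβ hαβ hα hββ' hρ0 hρ1 hρ hstep hbest i k

/-- All of the exploration of arm `j`. -/
lemma reaches_insert (h : IsRegular δ Φ P) (hN : 144 / δ ^ 2 ≤ N) (hj : j ∉ J)
    (hmax : ∀ k ∉ J, mean (P k) ≤ mean (P j)) {L T : ℕ}
    (hL : 1 ≤ (δ / 2) ^ K * ((1 + δ / 4) ^ L - 1))
    (hT : Reaches P N T fun s => if HasDomain J s then 1 else 0) :
    Reaches P N (T + (L + 1) * N) fun s => if HasDomain (insert j J) s then 1 else 0 := by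
  have hδ := h.pos
  have hδ1 := h.lt_one
  set z := (δ / 2) ^ K with hz
  have hz0 : 0 < z := by positivity
  have hz1 : z ≤ 1 := pow_le_one₀ (by positivity) (by linarith)
  have hdis : ∀ s : Info K N, HasDomain J s → ¬ HasDomain (insert j J) s := fun s hs h' =>
    ((hasDomain_insert_iff hj s).1 h').1 (hs.eq_none hj)
  -- Without truncation this solves `b(l+1) - b(l) = (δ/4)(z + b(l))` with `b(0) = 0`.
  set b : ℕ → ℝ := fun l => min 1 (z * ((1 + δ / 4) ^ l - 1)) with hb
  have hpow : ∀ l : ℕ, 1 ≤ (1 + δ / 4) ^ l := fun l => one_le_pow₀ (by linarith)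
  have hb0 : ∀ l, 0 ≤ b l := fun l =>
    le_min zero_le_one (mul_nonneg hz0.le (by linarith [hpow l]))
  have hb1 : ∀ l, b l ≤ 1 := fun l => min_le_left _ _
  have hmono : ∀ l, b l ≤ b (l + 1) := fun l =>
    min_le_min le_rfl (mul_le_mul_of_nonneg_left (by
      rw [pow_succ]
      nlinarith [hpow l]) hz0.le)
  have hbstep : ∀ l, b (l + 1) - b l ≤ δ / 2 * ((1 - b l) * z + b l) := by
    intro l
    have h1 : b (l + 1) - b l ≤ δ / 4 * (z + b l) := by
      rcases le_total 1 (z * ((1 + δ / 4) ^ l - 1)) with hc | hc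
      · have : b l = 1 := min_eq_left hc
        rw [this]
        nlinarith [hb1 (l + 1)]
      · have h2 : b l = z * ((1 + δ / 4) ^ l - 1) := min_eq_right hc
        have h3 : b (l + 1) ≤ z * ((1 + δ / 4) ^ (l + 1) - 1) := min_le_right _ _
        rw [h2]
        calc _ ≤ z * ((1 + δ / 4) ^ (l + 1) - 1) - z * ((1 + δ / 4) ^ l - 1) := by linarith
          _ = _ := by ring
    refine h1.trans ?_
    -- The loss of a factor two, valid because `z` and `b l` are at most `1`, explains the rate
    -- `δ/4` in place of `δ/2`.
    have h2 : z + b l ≤ 2 * ((1 - b l) * z + b l) := by nlinarith [hb0 l, hb1 l]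
    nlinarith
  have hind : ∀ l : ℕ, Reaches P N (T + (l + 1) * N) (phaseWeight P J j 1 (b l)) := by
    intro l
    induction l with
    | zero =>
      -- The first block only explores where this is free, raising `α` from `0` to `1`; this is the
      -- extra block in `L + 1`.
      have h0 : b 0 = 0 := by simp [hb]
      rw [h0, zero_add, one_mul]
      refine h.reaches_phaseWeight_step hN hj hmax (α := 0) (β := 0) le_rfl le_rfl zero_le_one
        le_rfl zero_le_one (by simp) ?_
      convert hT using 2 with s
      simp [phaseWeight]
    | succ l ih =>
      have := h.reaches_phaseWeight_step hN hj hmax (hb0 l) (hb1 l) le_rfl (hmono l)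
        (hb1 (l + 1)) (hbstep l) ih
      rwa [show T + (l + 1) * N + N = T + (l + 1 + 1) * N by ring] at this
  have hfin := hind L
  rw [show b L = 1 from min_eq_left hL] at hfin
  convert hfin using 2 with s
  by_cases hd : HasDomain J s
  · simp [phaseWeight, hd, hdis s hd]
  · simp [phaseWeight, hd]

/-- The next arm always has the largest prior mean among the unexplored ones, as free exploration
requires. With no rounds played the algorithm is irrelevant. -/
lemma reaches_of_card (h : IsRegular δ Φ P) (hN : 144 / δ ^ 2 ≤ N) (hK : 0 < K) {L : ℕ}
    (hL : 1 ≤ (δ / 2) ^ K * ((1 + δ / 4) ^ L - 1)) (n : ℕ) (hn : n ≤ K) :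
    ∃ J : Finset (Fin K), J.card = n ∧
      Reaches P N (n * ((L + 1) * N)) fun s => if HasDomain J s then 1 else 0 := by
  induction n with
  | zero =>
    refine ⟨∅, rfl, fun _ => PMF.pure ⟨0, hK⟩, fun _ _ => none, ?_, ?_, ?_⟩
    · intro t ht; simp at ht
    · intro μ s
      rw [zero_mul, historyLaw, pmfExp_pure]
      have hiff : (fun _ : Fin K => (none : Option (Fin N → Bool))) = s ↔ HasDomain ∅ s := by
        constructor
        · rintro rfl i; simp
        · intro hs; funext i; exact (hs.eq_none (by simp)).symm
      beta_reduce
      by_cases hs : HasDomain ∅ s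
      · rw [if_pos (hiff.2 hs), if_pos hs, ← hiff.2 hs]
        simp [infoProb, optionProb]
      · rw [if_neg (fun e => hs (hiff.1 e)), if_neg hs]
        simp
    · intro μ h' _ i hi; exact absurd rfl hi
  | succ n ih =>
    obtain ⟨J, hJ, hR⟩ := ih (by omega)
    have hne : (Jᶜ).Nonempty := by
      rw [← Finset.card_pos, Finset.card_compl, Fintype.card_fin]; omega
    obtain ⟨j, hj, hmax⟩ := Finset.exists_max_image Jᶜ (fun k => mean (P k)) hne
    have hj' : j ∉ J := Finset.mem_compl.1 hj
    refine ⟨insert j J, by rw [Finset.card_insert_of_notMem hj', hJ], ?_⟩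
    rw [Nat.succ_mul]
    exact h.reaches_insert hN hj' (fun k hk => hmax k (Finset.mem_compl.2 hk)) hL hR

/-- Exploration of all arms. -/
lemma reaches_univ (h : IsRegular δ Φ P) (hN : 144 / δ ^ 2 ≤ N) (hK : 0 < K) {L : ℕ}
    (hL : 1 ≤ (δ / 2) ^ K * ((1 + δ / 4) ^ L - 1)) :
    Reaches P N (K * ((L + 1) * N)) fun s => if HasDomain Finset.univ s then 1 else 0 := by
  obtain ⟨J, hJ, hR⟩ := h.reaches_of_card hN hK hL K le_rfl
  rwa [(Finset.card_eq_iff_eq_univ J).1 (by rw [hJ, Fintype.card_fin])] at hR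

end IsRegular

end Phase

end IncentivizedExploration

namespace IncentivizedExploration

variable {K N : ℕ}

/-! ### The gap on the event that an arm is best -/

section BestArm

lemma measurableSet_bestArm (i : Fin K) : MeasurableSet (bestArm i) := by
  have : bestArm i = (⋂ j, {μ : Fin K → unitInterval | μ j ≤ μ i}) ∩
      ⋂ j, ⋂ (_ : j < i), {μ : Fin K → unitInterval | μ j < μ i} := by
    ext μ
    simp [bestArm]
  rw [this]
  refine (MeasurableSet.iInter fun j => measurableSet_le (measurable_pi_apply j)
    (measurable_pi_apply i)).inter (MeasurableSet.iInter fun j => MeasurableSet.iInter fun _ =>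
      measurableSet_lt (measurable_pi_apply j) (measurable_pi_apply i))

lemma exists_mem_bestArm (hK : 0 < K) (μ : Fin K → unitInterval) : ∃ i, μ ∈ bestArm i := by
  have : Nonempty (Fin K) := ⟨⟨0, hK⟩⟩
  obtain ⟨m, hm⟩ := Finite.exists_max μ
  set S := Finset.univ.filter fun k => μ k = μ m with hS
  have hne : S.Nonempty := ⟨m, by simp [hS]⟩
  have hmin := S.min'_mem hne
  set i := S.min' hne with hi
  have hμi : μ i = μ m := (Finset.mem_filter.1 hmin).2
  refine ⟨i, fun j => by rw [hμi]; exact hm j, fun j hj => ?_⟩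
  rw [hμi]
  refine lt_of_le_of_ne (hm j) fun he => ?_
  have : j ∈ S := by simp [hS, he]
  exact absurd (S.min'_le j this) (not_le.2 hj)

lemma bestArm_disjoint : Pairwise (Function.onFun Disjoint (bestArm (K := K))) := by
  intro i j hij
  refine Set.disjoint_left.2 fun μ hi hj => ?_
  rcases lt_or_gt_of_ne hij with h | h
  · exact absurd (hj.2 i h) (not_lt.2 (hi.1 j))
  · exact absurd (hi.2 j h) (not_lt.2 (hj.1 i))

lemma bestArm_update_self {i : Fin K} {μ : Fin K → unitInterval} {x y : unitInterval} (hxy : x ≤ y)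
    (h : Function.update μ i x ∈ bestArm i) : Function.update μ i y ∈ bestArm i := by
  constructor
  · intro j
    rcases eq_or_ne j i with rfl | hj
    · exact le_rfl
    · have := h.1 j
      rw [Function.update_of_ne hj, Function.update_self] at this ⊢
      exact this.trans hxy
  · intro j hj
    have := h.2 j hj
    rw [Function.update_of_ne hj.ne, Function.update_self] at this ⊢
    exact this.trans_le hxy

lemma bestArm_update_of_ne {i j : Fin K} (hij : i ≠ j) {μ : Fin K → unitInterval}
    {x y : unitInterval} (hxy : x ≤ y)
    (h : Function.update μ j y ∈ bestArm i) : Function.update μ j x ∈ bestArm i := by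
  constructor
  · intro k
    have := h.1 k
    rcases eq_or_ne k j with rfl | hk
    · rw [Function.update_self, Function.update_of_ne hij] at this ⊢
      exact hxy.trans this
    · rwa [Function.update_of_ne hk, Function.update_of_ne hij] at this ⊢
  · intro k hk'
    have := h.2 k hk'
    rcases eq_or_ne k j with rfl | hk
    · rw [Function.update_self, Function.update_of_ne hij] at this ⊢
      exact hxy.trans_lt this
    · rwa [Function.update_of_ne hk, Function.update_of_ne hij] at this ⊢

lemma integral_mul_integral_le_of_monotone {Q : Prior} {f g : unitInterval → ℝ}
    (hf : Measurable f) (hg : Measurable g) (hf1 : ∀ x, |f x| ≤ 1) (hg1 : ∀ x, |g x| ≤ 1)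
    (h : (Monotone f ∧ Monotone g) ∨ (Antitone f ∧ Antitone g)) :
    (∫ x, f x ∂(Q : Measure unitInterval)) * ∫ x, g x ∂(Q : Measure unitInterval) ≤
      ∫ x, f x * g x ∂(Q : Measure unitInterval) := by
  refine integral_mul_integral_le_of_similarlyOrdered (integrable_prior Q hf 1 hf1)
    (integrable_prior Q hg 1 hg1) (integrable_prior Q (hf.mul hg) 1 fun x => ?_) fun x y => ?_
  · rw [abs_mul]
    exact mul_le_one₀ (hf1 x) (abs_nonneg _) (hg1 x)
  · rcases h with ⟨h1, h2⟩ | ⟨h1, h2⟩ <;> rcases le_total x y with hxy | hxy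
    · exact mul_nonneg_of_nonpos_of_nonpos (sub_nonpos.2 (h1 hxy)) (sub_nonpos.2 (h2 hxy))
    · exact mul_nonneg (sub_nonneg.2 (h1 hxy)) (sub_nonneg.2 (h2 hxy))
    · exact mul_nonneg (sub_nonneg.2 (h1 hxy)) (sub_nonneg.2 (h2 hxy))
    · exact mul_nonneg_of_nonpos_of_nonpos (sub_nonpos.2 (h1 hxy)) (sub_nonpos.2 (h2 hxy))

lemma integrable_resample (P : Fin K → Prior) (i : Fin K) {F : (Fin K → unitInterval) → ℝ}
    (hF : Measurable F) (c : ℝ) (hc : ∀ μ, |F μ| ≤ c) :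
    Integrable (fun μ => ∫ x, F (Function.update μ i x) ∂(P i : Measure unitInterval))
      (jointPrior P) :=
  Integrable.integral_prod_left (f := fun p : (Fin K → unitInterval) × unitInterval =>
    F (Function.update p.1 i p.2))
    (integrable_of_abs_le (hF.comp (measurable_update_prod i)) c fun _ => hc _)

namespace IsRegular

variable {δ Φ : ℝ} {P : Fin K → Prior}

/-- The event `A* = i` is increasing in `μ_i` and decreasing in `μ_j`. Chebyshev's inequality in
these two coordinates, one after the other, shows that conditioning on it does not lower the
expected gap below `δ`. -/
lemma mul_measureReal_le_setIntegral (h : IsRegular δ Φ P) {i j : Fin K} (hij : i ≠ j) :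
    δ * (jointPrior P).real (bestArm i) ≤
      ∫ μ in bestArm i, ((μ i : ℝ) - μ j) ∂(jointPrior P) := by
  have hA := measurableSet_bestArm i
  have hΦ0 : 0 ≤ Φ := (mean_nonneg _).trans (h.mean_le i)
  have hΦ1 := h.le_one
  set H : (Fin K → unitInterval) → ℝ := (bestArm i).indicator 1 with hH
  have hHm : Measurable H := measurable_one.indicator hA
  have hH0 : ∀ μ, 0 ≤ H μ := fun μ => Set.indicator_nonneg (fun _ _ => zero_le_one) μ
  have hH1 : ∀ μ, H μ ≤ 1 := fun μ => Set.indicator_le_self' (fun _ _ => zero_le_one) μ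
  have hHabs : ∀ μ, |H μ| ≤ 1 := fun μ => by rw [abs_of_nonneg (hH0 μ)]; exact hH1 μ
  have hupd : ∀ (k : Fin K) (μ : Fin K → unitInterval),
      Measurable fun x => H (Function.update μ k x) := fun k μ =>
    hHm.comp (measurable_update μ)
  have hbd : ∀ x : unitInterval, 0 ≤ max ((x : ℝ) - Φ) 0 ∧ max ((x : ℝ) - Φ) 0 ≤ 1 := fun x =>
    ⟨le_max_right _ _, max_le (by linarith [x.2.2]) zero_le_one⟩
  have hbd' : ∀ x : unitInterval, |max ((x : ℝ) - Φ) 0| ≤ 1 := fun x => by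
    rw [abs_of_nonneg (hbd x).1]; exact (hbd x).2
  have hF1 : ∀ μ : Fin K → unitInterval, |max ((μ i : ℝ) - Φ) 0 * H μ| ≤ 1 := fun μ => by
    rw [abs_mul]
    exact mul_le_one₀ (hbd' _) (abs_nonneg _) (hHabs μ)
  have hF2 : ∀ μ : Fin K → unitInterval, |((μ i : ℝ) - μ j) * H μ| ≤ 1 := fun μ => by
    rw [abs_mul]
    exact mul_le_one₀ (abs_coe_sub_coe_le _ _) (abs_nonneg _) (hHabs μ)
  have hmono : ∀ {p q : Fin K → unitInterval}, (p ∈ bestArm i → q ∈ bestArm i) → H p ≤ H q := by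
    intro p q hpq
    by_cases hp : p ∈ bestArm i
    · simp [hH, hp, hpq hp]
    · simp only [hH, Set.indicator_of_notMem hp]; exact hH0 q
  -- Over `μ_j`: on the event the gap equals its positive part, which decreases in `μ_j` like the
  -- event. Its average is at least `(μ_i - μ_j⁰)₊ ≥ (μ_i - Φ)₊`.
  have step1 : ∫ μ, max ((μ i : ℝ) - Φ) 0 * H μ ∂(jointPrior P) ≤
      ∫ μ, ((μ i : ℝ) - μ j) * H μ ∂(jointPrior P) := by
    rw [integral_resample P j (by fun_prop) 1 hF1, integral_resample P j (by fun_prop) 1 hF2]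
    refine integral_mono (integrable_resample P j (by fun_prop) 1 hF1)
      (integrable_resample P j (by fun_prop) 1 hF2) fun μ => ?_
    · simp only [Function.update_of_ne hij, Function.update_self]
      have he : ∀ y : unitInterval, ((μ i : ℝ) - y) * H (Function.update μ j y) =
          max ((μ i : ℝ) - y) 0 * H (Function.update μ j y) := fun y => by
        by_cases hp : Function.update μ j y ∈ bestArm i
        · have := hp.1 j
          rw [Function.update_self, Function.update_of_ne hij] at this
          have h2 : (y : ℝ) ≤ μ i := this
          rw [max_eq_left (by linarith)]
        · simp [hH, hp]
      simp_rw [he]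
      rw [integral_const_mul]
      refine le_trans (mul_le_mul_of_nonneg_right ?_ (integral_nonneg fun y => hH0 _))
        (integral_mul_integral_le_of_monotone (f := fun y : unitInterval =>
          max ((μ i : ℝ) - y) 0) (by fun_prop) (hupd j μ)
          (fun y => by
            rw [abs_of_nonneg (le_max_right _ _)]
            exact max_le (by linarith [(μ i).2.2, y.2.1]) zero_le_one) (fun y => hHabs _)
          (Or.inr ⟨fun x y hxy => max_le_max (by
            have : (x : ℝ) ≤ y := hxy
            linarith) le_rfl, fun x y hxy => hmono (bestArm_update_of_ne hij hxy)⟩))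
      refine max_le ?_ (integral_nonneg fun y => le_max_right _ _)
      calc (μ i : ℝ) - Φ ≤ μ i - mean (P j) := by linarith [h.mean_le j]
        _ = ∫ y, ((μ i : ℝ) - y) ∂(P j : Measure unitInterval) := by
            rw [integral_sub (integrable_const _) (integrable_coe _)]
            simp [mean]
        _ ≤ _ := integral_mono (integrable_sub_coe _ _) (integrable_sub_coe _ _).pos_part
            fun y => le_max_left _ _
  -- Over `μ_i`: now `(μ_i - Φ)₊` and the event both increase, and easiness bounds the mean of the
  -- former.
  have step2 : δ * ∫ μ, H μ ∂(jointPrior P) ≤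
      ∫ μ, max ((μ i : ℝ) - Φ) 0 * H μ ∂(jointPrior P) := by
    rw [integral_resample P i (by fun_prop) 1 hF1, integral_resample P i hHm 1 hHabs,
      ← integral_const_mul]
    refine integral_mono ((integrable_resample P i hHm 1 hHabs).const_mul _)
      (integrable_resample P i (by fun_prop) 1 hF1) fun μ => ?_
    · simp only [Function.update_self]
      refine le_trans (mul_le_mul_of_nonneg_right (h.easy i) (integral_nonneg fun y => hH0 _))
        (integral_mul_integral_le_of_monotone (f := fun x : unitInterval =>
          max ((x : ℝ) - Φ) 0) (by fun_prop) (hupd i μ) hbd' (fun y => hHabs _)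
          (Or.inl ⟨fun x y hxy => max_le_max (by
            have : (x : ℝ) ≤ y := hxy
            linarith) le_rfl, fun x y hxy => hmono (bestArm_update_self hxy)⟩))
  have e1 : ∫ μ, H μ ∂(jointPrior P) = (jointPrior P).real (bestArm i) :=
    integral_indicator_one hA
  have e2 : ∫ μ, ((μ i : ℝ) - μ j) * H μ ∂(jointPrior P) =
      ∫ μ in bestArm i, ((μ i : ℝ) - μ j) ∂(jointPrior P) := by
    rw [← integral_indicator hA]
    congr 1
    funext μ
    by_cases hp : μ ∈ bestArm i <;> simp [hH, hp]
  rw [← e1, ← e2]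
  exact step2.trans step1

lemma pow_le_measureReal_bestArm (h : IsRegular δ Φ P) (i : Fin K) :
    δ ^ K ≤ (jointPrior P).real (bestArm i) := by
  have := h.le_measure_bestArm i
  rw [← ENNReal.ofReal_pow h.pos.le] at this
  rw [measureReal_def]
  exact (ENNReal.ofReal_le_iff_le_toReal (measure_ne_top _ _)).1 this

end IsRegular

end BestArm

/-! ### From exponential moments to errors on a small event -/

section Young

/-- Exponential moment bounds control expectations on an event in terms of its probability. -/
lemma sum_setIntegral_le_of_exp_le {ι α : Type*} [MeasurableSpace α] {ν : Measure α}
    [IsProbabilityMeasure ν] {S : Finset ι} {w : ι → ℝ} (hw : ∀ h, 0 ≤ w h) {l : ι → α → ℝ}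
    (hl : ∀ h, Measurable (l h)) (hl01 : ∀ h x, 0 ≤ l h x ∧ l h x ≤ 1)
    (hsum : ∀ x, ∑ h ∈ S, w h * l h x = 1) {A : Set α} (hp : 0 < ν.real A) {Y : ι → α → ℝ} (hY : ∀ h, Measurable (Y h))
    {c : ι → ℝ} (hYc : ∀ h x, |Y h x| ≤ c h) {t B : ℝ} (ht : 0 < t)
    (hexp : ∑ h ∈ S, w h * ∫ x, l h x * Real.exp (t * Y h x) ∂ν ≤ Real.exp B) :
    ∑ h ∈ S, w h * ∫ x in A, l h x * Y h x ∂ν ≤ ν.real A * ((B + Real.log (ν.real A)⁻¹) / t) := by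
  set p := ν.real A with hpdef
  -- The inequality `tY ≤ exp(tY - s) + s - 1` is used on `A`. This `s` satisfies `exp(-s) exp(B) =
  -- p`, so the two terms sum to `ps`.
  set s := B + Real.log p⁻¹ with hs
  have i1 : ∀ h, Integrable (fun x => l h x * Real.exp (t * Y h x)) ν := fun h => by
    refine integrable_of_abs_le ((hl h).mul (by fun_prop)) (Real.exp (t * c h)) fun x => ?_
    rw [abs_mul, Real.abs_exp, abs_of_nonneg (hl01 h x).1]
    refine (mul_le_of_le_one_left (Real.exp_pos _).le (hl01 h x).2).trans (Real.exp_le_exp.2 ?_)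
    exact mul_le_mul_of_nonneg_left ((le_abs_self _).trans (hYc h x)) ht.le
  have i2 : ∀ h, Integrable (l h) ν := fun h => integrable_of_abs_le (hl h) 1 fun x => by
    rw [abs_of_nonneg (hl01 h x).1]; exact (hl01 h x).2
  have i3 : ∀ h, Integrable (fun x => l h x * Y h x) ν := fun h => by
    refine integrable_of_abs_le ((hl h).mul (hY h)) (c h) fun x => ?_
    rw [abs_mul, abs_of_nonneg (hl01 h x).1]
    exact (mul_le_of_le_one_left (abs_nonneg _) (hl01 h x).2).trans (hYc h x)
  have hone : ∀ h, t * ∫ x in A, l h x * Y h x ∂ν ≤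
      Real.exp (-s) * (∫ x, l h x * Real.exp (t * Y h x) ∂ν) + (s - 1) * ∫ x in A, l h x ∂ν := by
    intro h
    calc t * ∫ x in A, l h x * Y h x ∂ν ≤ ∫ x in A, (Real.exp (-s) *
          (l h x * Real.exp (t * Y h x)) + (s - 1) * l h x) ∂ν := by
          rw [← integral_const_mul]
          refine integral_mono ((i3 h).const_mul t).integrableOn
            (((i1 h).const_mul _).add ((i2 h).const_mul _)).integrableOn fun x => ?_
          have h1 := Real.add_one_le_exp (t * Y h x - s)
          rw [show t * Y h x - s = -s + t * Y h x by ring, Real.exp_add] at h1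
          have h2 := mul_le_mul_of_nonneg_left h1 (hl01 h x).1
          show t * (l h x * Y h x) ≤ _
          linarith
      _ = Real.exp (-s) * (∫ x in A, l h x * Real.exp (t * Y h x) ∂ν) +
          (s - 1) * ∫ x in A, l h x ∂ν := by
          rw [integral_add ((i1 h).const_mul _).integrableOn ((i2 h).const_mul _).integrableOn,
            integral_const_mul, integral_const_mul]
      _ ≤ _ := by
          refine add_le_add (mul_le_mul_of_nonneg_left ?_ (Real.exp_pos _).le) le_rfl
          exact setIntegral_le_integral (i1 h) (Filter.Eventually.of_forall fun x =>
            mul_nonneg (hl01 h x).1 (Real.exp_pos _).le)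
  have hmass : ∑ h ∈ S, w h * ∫ x in A, l h x ∂ν = p := by
    simp_rw [← integral_const_mul]
    rw [← integral_finsetSum _ fun h _ => ((i2 h).const_mul _).integrableOn]
    simp_rw [hsum]
    simp [hpdef]
  have hes : Real.exp (-s) * Real.exp B = p := by
    rw [← Real.exp_add, hs, Real.log_inv, show -(B + -Real.log p) + B = Real.log p by ring,
      Real.exp_log hp]
  have htot : t * ∑ h ∈ S, w h * ∫ x in A, l h x * Y h x ∂ν ≤ p * s := by
    calc _ = ∑ h ∈ S, w h * (t * ∫ x in A, l h x * Y h x ∂ν) := by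
          rw [Finset.mul_sum]; exact Finset.sum_congr rfl fun h _ => by ring
      _ ≤ ∑ h ∈ S, w h * (Real.exp (-s) * (∫ x, l h x * Real.exp (t * Y h x) ∂ν) +
          (s - 1) * ∫ x in A, l h x ∂ν) :=
          Finset.sum_le_sum fun h _ => mul_le_mul_of_nonneg_left (hone h) (hw h)
      _ = Real.exp (-s) * (∑ h ∈ S, w h * ∫ x, l h x * Real.exp (t * Y h x) ∂ν) +
          (s - 1) * ∑ h ∈ S, w h * ∫ x in A, l h x ∂ν := by
          rw [Finset.mul_sum, Finset.mul_sum, ← Finset.sum_add_distrib]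
          exact Finset.sum_congr rfl fun h _ => by ring
      _ ≤ Real.exp (-s) * Real.exp B + (s - 1) * p := by
          rw [hmass]
          exact add_le_add (mul_le_mul_of_nonneg_left hexp (Real.exp_pos _).le) le_rfl
      _ = p * s := by rw [hes]; ring
  rw [← mul_div_assoc, le_div_iff₀ ht]
  linarith

/-- Jensen's inequality for the exponential of a conditional expectation. -/
lemma integral_mul_exp_le {α : Type*} [MeasurableSpace α] {ν : Measure α}
    {l y : α → ℝ} (hl0 : ∀ x, 0 ≤ l x) (i0 : Integrable l ν)
    (i1 : Integrable (fun x => l x * y x) ν) (i2 : Integrable (fun x => l x * Real.exp (y x)) ν)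
    {r : ℝ} (hr : ∫ x, l x * y x ∂ν = r * ∫ x, l x ∂ν) :
    ∫ x, l x * Real.exp r ∂ν ≤ ∫ x, l x * Real.exp (y x) ∂ν := by
  have h1 : ∫ x, (Real.exp r * (1 - r) * l x + Real.exp r * (l x * y x)) ∂ν ≤
      ∫ x, l x * Real.exp (y x) ∂ν := by
    refine integral_mono ((i0.const_mul _).add (i1.const_mul _)) i2 fun x => ?_
    -- The tangent line of the exponential at `r`; its linear part integrates to zero by `hr`.
    have h2 := Real.add_one_le_exp (y x - r)
    have h3 : Real.exp (y x) = Real.exp r * Real.exp (y x - r) := by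
      rw [← Real.exp_add]; congr 1; ring
    have h4 := mul_le_mul_of_nonneg_left h2 (mul_nonneg (hl0 x) (Real.exp_pos r).le)
    show _ ≤ l x * Real.exp (y x)
    rw [h3]
    linarith
  rw [integral_add (i0.const_mul _) (i1.const_mul _), integral_const_mul, integral_const_mul,
    hr] at h1
  rw [integral_mul_const]
  linarith

end Young

end IncentivizedExploration

namespace IncentivizedExploration

variable {K N : ℕ}

/-! ### Thompson Sampling after the warm-up is BIC -/

section Thompson

lemma thenThompson_of_lt (P : Fin K → Prior) (alg : Algorithm K) {T : ℕ} (h : History K)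
    (hl : h.length < T) : thenThompson P alg T h = alg h := by
  simp [thenThompson, hl]

lemma integrable_likelihood (P : Fin K → Prior) (h : History K) :
    Integrable (likelihood h) (jointPrior P) :=
  integrable_joint P (by fun_prop) 1 fun μ => by
    rw [abs_of_nonneg (likelihood_mem h μ).1]; exact (likelihood_mem h μ).2

lemma posteriorWeight_eq (P : Fin K → Prior) (h : History K) (i : Fin K) :
    posteriorWeight P h i =
      ENNReal.ofReal (∫ μ in bestArm i, likelihood h μ ∂(jointPrior P)) :=
  (ofReal_integral_eq_lintegral_ofReal (integrable_likelihood P h).integrableOn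
    (Filter.Eventually.of_forall fun μ => (likelihood_mem h μ).1)).symm

/-- The events `A* = i` partition the space, so the normalizing constant is the evidence of the
history; the fallback of `thenThompson` applies only where this vanishes. -/
lemma tsum_posteriorWeight (P : Fin K → Prior) (hK : 0 < K) (h : History K) :
    ∑' i, posteriorWeight P h i = ENNReal.ofReal (∫ μ, likelihood h μ ∂(jointPrior P)) := by
  unfold posteriorWeight
  rw [← lintegral_iUnion (fun i => measurableSet_bestArm i) bestArm_disjoint,
    show ⋃ i : Fin K, bestArm i = Set.univ from
      Set.eq_univ_of_forall fun μ => Set.mem_iUnion.2 (exists_mem_bestArm hK μ),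
    Measure.restrict_univ, ofReal_integral_eq_lintegral_ofReal (integrable_likelihood P h)
    (Filter.Eventually.of_forall fun μ => (likelihood_mem h μ).1)]

lemma integral_likelihood_nonneg (P : Fin K → Prior) (h : History K) :
    0 ≤ ∫ μ, likelihood h μ ∂(jointPrior P) := integral_nonneg fun μ => (likelihood_mem h μ).1

lemma thenThompson_mul (P : Fin K → Prior) (hK : 0 < K) (alg : Algorithm K) {T : ℕ}
    (h : History K) (hl : T ≤ h.length) (i : Fin K)
    (hD : 0 < ∫ μ, likelihood h μ ∂(jointPrior P)) :
    (thenThompson P alg T h i).toReal * ∫ μ, likelihood h μ ∂(jointPrior P) =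
      ∫ μ in bestArm i, likelihood h μ ∂(jointPrior P) := by
  have hsum := tsum_posteriorWeight P hK h
  have hw : (∑' i, posteriorWeight P h i) ≠ 0 ∧ (∑' i, posteriorWeight P h i) ≠ ∞ := by
    rw [hsum]
    exact ⟨(ENNReal.ofReal_pos.2 hD).ne', ENNReal.ofReal_ne_top⟩
  rw [thenThompson, if_neg (not_lt.2 hl), dif_pos hw, PMF.normalize_apply, hsum,
    posteriorWeight_eq, ENNReal.toReal_mul, ENNReal.toReal_inv, ENNReal.toReal_ofReal hD.le,
    ENNReal.toReal_ofReal (integral_nonneg fun μ => (likelihood_mem h μ).1),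
    mul_assoc, inv_mul_cancel₀ hD.ne', mul_one]

/-- Forgetting the newest `n` rounds recovers the law after the warm-up, so estimates based on the
warm-up samples hold unchanged at all later times. -/
lemma pmfExp_historyLaw_drop {alg alg' : Algorithm K} {T : ℕ}
    (hag : ∀ h : History K, h.length < T → alg' h = alg h) (μ : Fin K → unitInterval) (n : ℕ)
    (F : History K → ℝ≥0∞) :
    pmfExp (historyLaw alg' μ (T + n)) (fun h => F (h.drop n)) =
      pmfExp (historyLaw alg μ T) F := by
  induction n with
  | zero => simp [historyLaw_congr hag μ le_rfl]
  | succ n ih =>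
    rw [← Nat.add_assoc, pmfExp_historyLaw_succ, ← ih]
    simp only [List.drop_succ_cons, pmfExp_const]

open Classical in
lemma sum_infoProb_mul_exp_le (hN : 0 < N) (μ : Fin K → unitInterval) (i : Fin K) (θ : ℝ) :
    ∑ s : Info K N, (if HasDomain Finset.univ s then 1 else 0) * infoProb s μ *
      Real.exp (θ * ((μ i : ℝ) - blockMean ((s i).getD fun _ => false))) ≤
      Real.exp (θ ^ 2 / N) := by
  have h1 : ∀ s : Info K N, (if HasDomain Finset.univ s then 1 else 0) * infoProb s μ *
      Real.exp (θ * ((μ i : ℝ) - blockMean ((s i).getD fun _ => false))) =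
      if HasDomain Finset.univ s then ∏ l, optionProb (μ l) (s l) * (if l = i then
        Real.exp (θ * ((μ l : ℝ) - blockMean ((s l).getD fun _ => false))) else 1) else 0 := by
    intro s
    split_ifs
    · rw [Finset.prod_mul_distrib, one_mul, infoProb]; simp
    · simp
  simp_rw [h1]
  rw [sum_hasDomain_prod Finset.univ fun l o => optionProb (μ l) o * (if l = i then
    Real.exp (θ * ((μ l : ℝ) - blockMean (o.getD fun _ => false))) else 1),
    Finset.prod_eq_single i]
  · simpa [optionProb] using sum_blockProb_mul_exp_le hN (μ i) θ
  · intro l _ hl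
    simp [hl, optionProb, sum_blockProb]
  · simp

lemma blockMean_mem (x : Fin N → Bool) : 0 ≤ blockMean x ∧ blockMean x ≤ 1 := by
  have h0 : 0 ≤ ∑ r, (if x r then (1 : ℝ) else 0) :=
    Finset.sum_nonneg fun r _ => by split_ifs <;> norm_num
  have h1 : ∑ r, (if x r then (1 : ℝ) else 0) ≤ N := by
    calc _ ≤ ∑ _r : Fin N, (1 : ℝ) := Finset.sum_le_sum fun r _ => by split_ifs <;> norm_num
      _ = N := by simp
  exact ⟨div_nonneg h0 (Nat.cast_nonneg N), div_le_one_of_le₀ h1 (Nat.cast_nonneg N)⟩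

lemma sum_choiceWeight_mul_likelihood (alg : Algorithm K) (μ : Fin K → unitInterval) (t : ℕ) :
    ∑ h ∈ historiesOfLength K t, (choiceWeight alg h).toReal * likelihood h μ = 1 := by
  have := toReal_pmfExp_historyLaw alg μ t (fun _ => 1) fun _ => ENNReal.one_ne_top
  rw [pmfExp_const] at this
  simpa using this.symm

/-- The posterior mean reward of arm `k` given a history. -/
noncomputable def historyMean (P : Fin K → Prior) (k : Fin K) (h : History K) : ℝ :=
  (∫ μ, likelihood h μ * (μ k : ℝ) ∂(jointPrior P)) / ∫ μ, likelihood h μ ∂(jointPrior P)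

lemma integrable_likelihood_mul (P : Fin K → Prior) (h : History K)
    {F : (Fin K → unitInterval) → ℝ} (hF : Measurable F) {c : ℝ} (hc : ∀ μ, |F μ| ≤ c) :
    Integrable (fun μ => likelihood h μ * F μ) (jointPrior P) :=
  integrable_joint P (by fun_prop) c fun μ => by
    rw [abs_mul, abs_of_nonneg (likelihood_mem h μ).1]
    exact (mul_le_of_le_one_left (abs_nonneg _) (likelihood_mem h μ).2).trans (hc μ)

lemma abs_coe_le (x : unitInterval) : |(x : ℝ)| ≤ 1 := by
  rw [abs_of_nonneg x.2.1]; exact x.2.2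

lemma integral_likelihood_mul_coe_mem (P : Fin K → Prior) (k : Fin K) (h : History K) :
    0 ≤ ∫ μ, likelihood h μ * (μ k : ℝ) ∂(jointPrior P) ∧
      ∫ μ, likelihood h μ * (μ k : ℝ) ∂(jointPrior P) ≤ ∫ μ, likelihood h μ ∂(jointPrior P) :=
  ⟨integral_nonneg fun μ => mul_nonneg (likelihood_mem h μ).1 (μ k).2.1,
    integral_mono (integrable_likelihood_mul P h (by fun_prop) fun μ => abs_coe_le (μ k))
      (integrable_likelihood P h) fun μ =>
        mul_le_of_le_one_right (likelihood_mem h μ).1 (μ k).2.2⟩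

lemma historyMean_mul (P : Fin K → Prior) (k : Fin K) (h : History K) :
    historyMean P k h * ∫ μ, likelihood h μ ∂(jointPrior P) =
      ∫ μ, likelihood h μ * (μ k : ℝ) ∂(jointPrior P) := by
  have hm := integral_likelihood_mul_coe_mem P k h
  unfold historyMean
  rcases (integral_likelihood_nonneg P h).eq_or_lt with h0 | h0
  · rw [← h0] at hm ⊢
    rw [mul_zero]; exact le_antisymm hm.1 hm.2
  · rw [div_mul_cancel₀ _ h0.ne']

lemma historyMean_mem (P : Fin K → Prior) (k : Fin K) (h : History K) :
    0 ≤ historyMean P k h ∧ historyMean P k h ≤ 1 :=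
  ⟨div_nonneg (integral_likelihood_mul_coe_mem P k h).1 (integral_likelihood_nonneg P h),
    div_le_one_of_le₀ (integral_likelihood_mul_coe_mem P k h).2 (integral_likelihood_nonneg P h)⟩

/-- Given the history, the recommendation and `A*` have the same law. After the gap is replaced by
its posterior mean, `{A_t = i}` may therefore be exchanged for `{A* = i}`. -/
lemma integral_gap_mul_recProb_thompson (P : Fin K → Prior) (hK : 0 < K) (alg : Algorithm K)
    (T n : ℕ) (i j : Fin K) :
    ∫ μ, ((μ i : ℝ) - μ j) * recProb (thenThompson P alg T) (T + n) i μ ∂(jointPrior P) =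
      ∑ h ∈ historiesOfLength K (T + n), (choiceWeight (thenThompson P alg T) h).toReal *
        ∫ μ in bestArm i, likelihood h μ * (historyMean P i h - historyMean P j h)
          ∂(jointPrior P) := by
  have h1 : ∀ μ : Fin K → unitInterval,
      ((μ i : ℝ) - μ j) * recProb (thenThompson P alg T) (T + n) i μ =
      ∑ h ∈ historiesOfLength K (T + n), (choiceWeight (thenThompson P alg T) h).toReal *
        (thenThompson P alg T h i).toReal * (likelihood h μ * ((μ i : ℝ) - μ j)) := fun μ => by
    rw [recProb_eq_sum, Finset.mul_sum]
    exact Finset.sum_congr rfl fun h _ => by ring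
  simp_rw [h1]
  rw [integral_finsetSum _ fun h _ => (integrable_likelihood_mul P h (by fun_prop)
    fun μ => abs_coe_sub_coe_le (μ i) (μ j)).const_mul _]
  refine Finset.sum_congr rfl fun h hh => ?_
  rw [integral_const_mul, mul_assoc, integral_mul_const]
  congr 1
  have h2 : ∫ μ, likelihood h μ * ((μ i : ℝ) - μ j) ∂(jointPrior P) =
      (historyMean P i h - historyMean P j h) * ∫ μ, likelihood h μ ∂(jointPrior P) := by
    simp_rw [mul_sub]
    rw [integral_sub (integrable_likelihood_mul P h (by fun_prop) fun μ => abs_coe_le (μ i))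
      (integrable_likelihood_mul P h (by fun_prop) fun μ => abs_coe_le (μ j)),
      ← historyMean_mul, ← historyMean_mul, sub_mul]
  rw [h2]
  rcases (integral_likelihood_nonneg P h).eq_or_lt with h0 | h0
  · have h3 : ∫ μ in bestArm i, likelihood h μ ∂(jointPrior P) = 0 := by
      refine le_antisymm ?_ (integral_nonneg fun μ => (likelihood_mem h μ).1)
      rw [h0]
      exact setIntegral_le_integral (integrable_likelihood P h)
        (Filter.Eventually.of_forall fun μ => (likelihood_mem h μ).1)
    rw [← h0, h3]; ring
  · have hl : T ≤ h.length := by have := mem_historiesOfLength.1 hh; omega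
    have h3 := thenThompson_mul P hK alg h hl i h0
    linear_combination (historyMean P i h - historyMean P j h) * h3

open Classical in
-- On `A* = i` the posterior gap differs from the true gap by four errors, all measured against the
-- empirical means of the warm-up. Each costs at most `pδ/4`, where `p = Pr[A* = i]`, and the true
-- gap is worth at least `pδ`.
lemma IsRegular.isBICAt_thenThompson {δ Φ : ℝ} {P : Fin K → Prior} (h : IsRegular δ Φ P)
    (hK : 2 ≤ K) (hN : 144 * (K * Real.log (K / δ) / δ ^ 2) ≤ N) {alg : Algorithm K}
    {φ : History K → Info K N} {T : ℕ}
    (hlaw : ∀ μ s, (pmfExp (historyLaw alg μ T) fun h => if φ h = s then 1 else 0).toReal =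
      (if HasDomain Finset.univ s then 1 else 0) * infoProb s μ) (n : ℕ) :
    IsBICAt P (thenThompson P alg T) (T + n) := by
  have hδ := h.pos
  have hL := h.half_le_log hK
  have hK' : (2 : ℝ) ≤ K := by exact_mod_cast hK
  set R := K * Real.log (K / δ) with hR
  have hR1 : 1 ≤ R := by nlinarith
  have hN0 : (0 : ℝ) < N := lt_of_lt_of_le (by positivity) hN
  have hN0' : 0 < N := by exact_mod_cast hN0
  rw [isBICAt_iff]
  intro i j
  by_cases hij : i = j
  · subst hij; simp
  rw [integral_gap_mul_recProb_thompson P (by omega)]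
  set S := historiesOfLength K (T + n) with hS
  set w : History K → ℝ := fun h => (choiceWeight (thenThompson P alg T) h).toReal with hw
  have hw0 : ∀ h, 0 ≤ w h := fun h => ENNReal.toReal_nonneg
  set e : Fin K → History K → ℝ := fun k h => blockMean ((φ (h.drop n) k).getD fun _ => false)
    with he
  have he01 : ∀ k h, 0 ≤ e k h ∧ e k h ≤ 1 := fun k h => blockMean_mem _
  set p := (jointPrior P).real (bestArm i) with hp
  have hpδ : δ ^ K ≤ p := h.pow_le_measureReal_bestArm i
  have hp0 : 0 < p := lt_of_lt_of_le (by positivity) hpδ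
  have hlogp : Real.log p⁻¹ ≤ R := by
    calc Real.log p⁻¹ ≤ Real.log (δ⁻¹ ^ K) := Real.log_le_log (by positivity) (by
          rw [inv_pow]; exact inv_anti₀ (by positivity) hpδ)
      _ = K * Real.log δ⁻¹ := Real.log_pow _ _
      _ ≤ R := mul_le_mul_of_nonneg_left (h.log_inv_le hK) (by positivity)
  have hmgf : ∀ (k : Fin K) (θ : ℝ) (μ : Fin K → unitInterval),
      ∑ h ∈ S, w h * likelihood h μ * Real.exp (θ * ((μ k : ℝ) - e k h)) ≤
        Real.exp (θ ^ 2 / N) := by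
    intro k θ μ
    refine le_trans (le_of_eq ?_) (sum_infoProb_mul_exp_le hN0' μ k θ)
    have h1 := toReal_pmfExp_comp (hlaw μ) (fun s => ENNReal.ofReal
      (Real.exp (θ * ((μ k : ℝ) - blockMean ((s k).getD fun _ => false)))))
      fun s => ENNReal.ofReal_ne_top
    rw [← pmfExp_historyLaw_drop (alg' := thenThompson P alg T)
      (fun h hl => thenThompson_of_lt P alg h hl) μ n,
      toReal_pmfExp_historyLaw _ _ _ _ fun h => ENNReal.ofReal_ne_top] at h1
    simp only [ENNReal.toReal_ofReal (Real.exp_pos _).le] at h1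
    exact h1
  -- With this choice the variance term `t/N` equals `δ/8`, and `N` is large enough that
  -- `log(1/p)/t` is at most `δ/8` as well, as `log(1/p) ≤ K log(K/δ)`.
  set t := δ * N / 8 with ht
  have ht0 : 0 < t := by positivity
  have hYi : ∀ (k : Fin K) (σ : ℝ), |σ| = 1 → ∀ (h : History K) (μ : Fin K → unitInterval),
      |σ * ((μ k : ℝ) - e k h)| ≤ 1 := fun k σ hσ h μ => by
    rw [abs_mul, hσ, one_mul]
    exact abs_le.2 ⟨by linarith [(μ k).2.1, (he01 k h).2], by linarith [(μ k).2.2, (he01 k h).1]⟩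
  have hZi : ∀ (k : Fin K) (σ : ℝ), |σ| = 1 → ∀ (h : History K),
      |σ * (historyMean P k h - e k h)| ≤ 1 := fun k σ hσ h => by
    have := historyMean_mem P k h
    rw [abs_mul, hσ, one_mul]
    exact abs_le.2 ⟨by linarith [(he01 k h).2], by linarith [(he01 k h).1]⟩
  have hexpi : ∀ (k : Fin K) (σ : ℝ), |σ| = 1 → ∀ h : History K, Integrable (fun μ =>
      likelihood h μ * Real.exp (t * (σ * ((μ k : ℝ) - e k h)))) (jointPrior P) :=
    fun k σ hσ h => integrable_likelihood_mul P h (by fun_prop) (c := Real.exp t) fun μ => by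
      rw [Real.abs_exp]
      exact Real.exp_le_exp.2 (mul_le_of_le_one_right ht0.le
        ((le_abs_self _).trans (hYi k σ hσ h μ)))
  have hexpY : ∀ (k : Fin K) (σ : ℝ), |σ| = 1 → ∑ h ∈ S, w h * ∫ μ, likelihood h μ *
      Real.exp (t * (σ * ((μ k : ℝ) - e k h))) ∂(jointPrior P) ≤ Real.exp (t ^ 2 / N) := by
    intro k σ hσ
    simp_rw [← integral_const_mul]
    rw [← integral_finsetSum _ fun h _ => (hexpi k σ hσ h).const_mul _]
    have hσ2 : (t * σ) ^ 2 = t ^ 2 := by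
      rw [mul_pow, ← sq_abs σ, hσ]; ring
    calc _ ≤ ∫ _μ, Real.exp (t ^ 2 / N) ∂(jointPrior P) := by
          refine integral_mono (integrable_finsetSum _ fun h _ => (hexpi k σ hσ h).const_mul _)
            (integrable_const _) fun μ => ?_
          have := hmgf k (t * σ) μ
          rw [hσ2] at this
          simpa only [mul_assoc] using this
      _ = _ := by simp
  -- The posterior mean inherits the exponential moments of the true mean by conditional Jensen,
  -- since the empirical mean is a function of the history.
  have hexpZ : ∀ (k : Fin K) (σ : ℝ), |σ| = 1 → ∑ h ∈ S, w h * ∫ μ, likelihood h μ *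
      Real.exp (t * (σ * (historyMean P k h - e k h))) ∂(jointPrior P) ≤
        Real.exp (t ^ 2 / N) := by
    intro k σ hσ
    refine le_trans (Finset.sum_le_sum fun h _ => mul_le_mul_of_nonneg_left ?_ (hw0 h))
      (hexpY k σ hσ)
    have i1 := integrable_likelihood_mul P h (by fun_prop) fun μ => abs_coe_le (μ k)
    have i2 : Integrable (fun μ : Fin K → unitInterval => likelihood h μ *
        (t * (σ * ((μ k : ℝ) - e k h)))) (jointPrior P) := by
      refine ((i1.const_mul (t * σ)).sub ((integrable_likelihood P h).const_mul
        (t * σ * e k h))).congr (Filter.Eventually.of_forall fun μ => ?_)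
      simp only [Pi.sub_apply]; ring
    refine integral_mul_exp_le (fun μ => (likelihood_mem h μ).1) (integrable_likelihood P h)
      i2 (hexpi k σ hσ h) ?_
    have h1 : ∀ μ : Fin K → unitInterval, likelihood h μ * (t * (σ * ((μ k : ℝ) - e k h))) =
        t * σ * (likelihood h μ * (μ k : ℝ)) - t * σ * e k h * likelihood h μ := fun μ => by ring
    simp_rw [h1]
    rw [integral_sub (i1.const_mul _) ((integrable_likelihood P h).const_mul _),
      integral_const_mul, integral_const_mul, ← historyMean_mul]
    ring
  have hbound : (t ^ 2 / N + Real.log p⁻¹) / t ≤ δ / 4 := by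
    have h1 : t ^ 2 / N / t = δ / 8 := by
      rw [ht]; field_simp
    have h2 : Real.log p⁻¹ / t ≤ δ / 8 := by
      rw [div_le_iff₀ ht0, ht]
      have h3 : 144 * R ≤ N * δ ^ 2 := by
        have := mul_le_mul_of_nonneg_right hN (sq_nonneg δ)
        rwa [show 144 * (R / δ ^ 2) * δ ^ 2 = 144 * R by field_simp] at this
      nlinarith
    rw [add_div, h1]
    linarith
  have herrY : ∀ (k : Fin K) (σ : ℝ), |σ| = 1 → ∑ h ∈ S, w h * ∫ μ in bestArm i, likelihood h μ *
      (σ * ((μ k : ℝ) - e k h)) ∂(jointPrior P) ≤ p * (δ / 4) := fun k σ hσ =>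
    (sum_setIntegral_le_of_exp_le hw0 (fun h => measurable_likelihood h) likelihood_mem
      (sum_choiceWeight_mul_likelihood (thenThompson P alg T) · (T + n)) hp0
      (Y := fun h μ => σ * ((μ k : ℝ) - e k h)) (fun h => by fun_prop) (hYi k σ hσ) ht0
      (hexpY k σ hσ)).trans (mul_le_mul_of_nonneg_left hbound hp0.le)
  have herrZ : ∀ (k : Fin K) (σ : ℝ), |σ| = 1 → ∑ h ∈ S, w h * ∫ μ in bestArm i, likelihood h μ *
      (σ * (historyMean P k h - e k h)) ∂(jointPrior P) ≤ p * (δ / 4) := fun k σ hσ =>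
    (sum_setIntegral_le_of_exp_le hw0 (fun h => measurable_likelihood h) likelihood_mem
      (sum_choiceWeight_mul_likelihood (thenThompson P alg T) · (T + n)) hp0
      (Y := fun h _ => σ * (historyMean P k h - e k h)) (fun h => by fun_prop)
      (fun h _ => hZi k σ hσ h) ht0 (hexpZ k σ hσ)).trans
      (mul_le_mul_of_nonneg_left hbound hp0.le)
  have hsplit : ∀ h : History K, ∫ μ in bestArm i, likelihood h μ *
      (historyMean P i h - historyMean P j h) ∂(jointPrior P) =
      (∫ μ in bestArm i, likelihood h μ * ((μ i : ℝ) - μ j) ∂(jointPrior P)) -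
      (∫ μ in bestArm i, likelihood h μ * (1 * ((μ i : ℝ) - e i h)) ∂(jointPrior P)) -
      (∫ μ in bestArm i, likelihood h μ * (-1 * ((μ j : ℝ) - e j h)) ∂(jointPrior P)) -
      (∫ μ in bestArm i, likelihood h μ * (-1 * (historyMean P i h - e i h)) ∂(jointPrior P)) -
      ∫ μ in bestArm i, likelihood h μ * (1 * (historyMean P j h - e j h)) ∂(jointPrior P) := by
    intro h
    have i1 := (integrable_likelihood_mul P h (F := fun μ => (μ i : ℝ) - μ j) (by fun_prop)
      fun μ => abs_coe_sub_coe_le (μ i) (μ j)).integrableOn (s := bestArm i)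
    have i2 := (integrable_likelihood_mul P h (F := fun μ => 1 * ((μ i : ℝ) - e i h))
      (by fun_prop) (hYi i 1 (by simp) h)).integrableOn (s := bestArm i)
    have i3 := (integrable_likelihood_mul P h (F := fun μ => -1 * ((μ j : ℝ) - e j h))
      (by fun_prop) (hYi j (-1) (by simp) h)).integrableOn (s := bestArm i)
    have i4 := (integrable_likelihood_mul P h (F := fun _ => -1 * (historyMean P i h - e i h))
      (by fun_prop) fun _ => hZi i (-1) (by simp) h).integrableOn (s := bestArm i)
    have i5 := (integrable_likelihood_mul P h (F := fun _ => 1 * (historyMean P j h - e j h))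
      (by fun_prop) fun _ => hZi j 1 (by simp) h).integrableOn (s := bestArm i)
    rw [← integral_sub' i1 i2, ← integral_sub' (i1.sub i2) i3,
      ← integral_sub' ((i1.sub i2).sub i3) i4, ← integral_sub' (((i1.sub i2).sub i3).sub i4) i5]
    congr 1
    funext μ
    simp only [Pi.sub_apply]
    ring
  have hmain : δ * p ≤ ∑ h ∈ S, w h * ∫ μ in bestArm i, likelihood h μ * ((μ i : ℝ) - μ j)
      ∂(jointPrior P) := by
    refine (h.mul_measureReal_le_setIntegral hij).trans (le_of_eq ?_)
    simp_rw [← integral_const_mul]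
    rw [← integral_finsetSum _ fun h _ => ((integrable_likelihood_mul P h (by fun_prop)
      fun μ => abs_coe_sub_coe_le (μ i) (μ j)).const_mul _).integrableOn]
    congr 1
    funext μ
    simp_rw [← mul_assoc]
    rw [← Finset.sum_mul, sum_choiceWeight_mul_likelihood, one_mul]
  simp_rw [hsplit, mul_sub, Finset.sum_sub_distrib]
  have e1 := herrY i 1 (by simp)
  have e2 := herrY j (-1) (by simp)
  have e3 := herrZ i (-1) (by simp)
  have e4 := herrZ j 1 (by simp)
  simp only [mul_sub] at hmain e1 e2 e3 e4 ⊢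
  linarith

end Thompson

/-! ### Assembling the easy case -/

section Main

namespace IsRegular

variable {δ Φ : ℝ} {P : Fin K → Prior}

/-- The number of growth steps in the exploration of an arm. -/
lemma exists_steps (h : IsRegular δ Φ P) (hK : 2 ≤ K) :
    ∃ L : ℕ, 1 ≤ (δ / 2) ^ K * ((1 + δ / 4) ^ L - 1) ∧
      (L : ℝ) + 1 ≤ 20 * (K * Real.log (K / δ) / δ) := by
  have hδ := h.pos
  have hδ1 := h.lt_one
  have hL := h.half_le_log hK
  have hK' : (2 : ℝ) ≤ K := by exact_mod_cast hK
  set Lg := Real.log (K / δ) with hLg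
  have hx : 1 ≤ K * Lg / δ := by rw [le_div_iff₀ hδ]; nlinarith
  -- As `log(1 + δ/4) ≥ δ/8`, this makes `(1 + δ/4)^L` at least `(2/δ)^(2K)`. One factor `(2/δ)^K`
  -- cancels `(δ/2)^K`; the other is at least `2` and covers the subtracted term.
  refine ⟨⌈16 * (K * Lg / δ)⌉₊, ?_, ?_⟩
  · have h1 : 16 * (K * Lg / δ) ≤ ((⌈16 * (K * Lg / δ)⌉₊ : ℕ) : ℝ) := Nat.le_ceil _
    set L := ⌈16 * (K * Lg / δ)⌉₊
    have h2 : δ / 8 ≤ Real.log (1 + δ / 4) := by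
      refine le_trans ?_ (Real.le_log_one_add_of_nonneg (by positivity))
      rw [div_le_div_iff₀ (by positivity) (by positivity)]
      nlinarith
    have h3 : 2 * (K * Lg) ≤ Real.log ((1 + δ / 4) ^ L) := by
      rw [Real.log_pow]
      calc 2 * (K * Lg) = 16 * (K * Lg / δ) * (δ / 8) := by field_simp; norm_num
        _ ≤ L * Real.log (1 + δ / 4) := mul_le_mul h1 h2 (by positivity) (by positivity)
    have h4 : Real.log ((2 / δ) ^ K * (2 / δ) ^ K) ≤ 2 * (K * Lg) := by
      rw [← mul_pow, Real.log_pow, Real.log_mul (by positivity) (by positivity)]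
      have := mul_le_mul_of_nonneg_left (h.log_two_div_le hK) (show (0 : ℝ) ≤ K by positivity)
      linarith
    have h5 : (2 / δ) ^ K * (2 / δ) ^ K ≤ (1 + δ / 4) ^ L :=
      (Real.log_le_log_iff (by positivity) (by positivity)).1 (h4.trans h3)
    have h6 : 2 ≤ (2 / δ) ^ K := by
      have h7 : (2 : ℝ) ≤ 2 / δ := by rw [le_div_iff₀ hδ]; linarith
      exact h7.trans (le_self_pow₀ (by linarith) (by omega))
    have h8 : (δ / 2) ^ K * (2 / δ) ^ K = 1 := by
      rw [← mul_pow, show δ / 2 * (2 / δ) = 1 by field_simp, one_pow]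
    have h9 : (δ / 2) ^ K * ((2 / δ) ^ K * (2 / δ) ^ K) ≤ (δ / 2) ^ K * (1 + δ / 4) ^ L :=
      mul_le_mul_of_nonneg_left h5 (by positivity)
    rw [← mul_assoc, h8, one_mul] at h9
    have h10 : (δ / 2) ^ K ≤ 1 := pow_le_one₀ (by positivity) (by linarith)
    rw [mul_sub, mul_one]
    linarith
  · have := (Nat.ceil_lt_add_one (show 0 ≤ 16 * (K * Lg / δ) by positivity)).le
    linarith

theorem exists_algorithm (h : IsRegular δ Φ P) (hK : 2 ≤ K) {c : ℝ} (hc : 0 ≤ c) :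
    ∃ (T : ℕ) (alg : Algorithm K),
      (T : ℝ) ≤ 40 * (c + 145) * ((K : ℝ) ^ 3 / δ ^ 4) * Real.log (K / δ) ^ 3 ∧
        IsBIC P alg T ∧ Collects P alg T (nTS c P) ∧
          ∀ t, IsBICAt P (thenThompson P alg T) t := by
  classical
  have hδ := h.pos
  have hδ1 := h.lt_one
  have hL := h.half_le_log hK
  have hK' : (2 : ℝ) ≤ K := by exact_mod_cast hK
  obtain ⟨L, hL1, hL2⟩ := h.exists_steps hK
  set Lg := Real.log (K / δ) with hLg
  have hR1 : 1 ≤ K * Lg := by nlinarith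
  have hx : 1 ≤ K * Lg / δ ^ 2 := by
    rw [le_div_iff₀ (by positivity)]
    have : δ ^ 2 ≤ 1 := pow_le_one₀ hδ.le hδ1.le
    linarith
  -- The summand `c` provides the `N_TS` samples, while `144` serves both the posterior estimates
  -- during exploration and the concentration needed for Thompson Sampling.
  set N := ⌈(c + 144) * (K * Lg / δ ^ 2)⌉₊ with hN
  have hN1 : (c + 144) * (K * Lg / δ ^ 2) ≤ N := Nat.le_ceil _
  have hN2 : (N : ℝ) ≤ (c + 145) * (K * Lg / δ ^ 2) := by
    have := (Nat.ceil_lt_add_one (show 0 ≤ (c + 144) * (K * Lg / δ ^ 2) by positivity)).le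
    linarith
  have hNc : c * (K * Lg / δ ^ 2) ≤ N :=
    (mul_le_mul_of_nonneg_right (by linarith) (by linarith)).trans hN1
  have hN144 : 144 * (K * Lg / δ ^ 2) ≤ N :=
    (mul_le_mul_of_nonneg_right (by linarith) (by linarith)).trans hN1
  have hN144' : 144 / δ ^ 2 ≤ (N : ℝ) := by
    refine le_trans ?_ hN144
    rw [div_eq_mul_one_div]
    gcongr
  obtain ⟨alg, φ, hbic, hlaw, hcount⟩ := h.reaches_univ hN144' (by omega) hL1
  refine ⟨K * ((L + 1) * N), alg, ?_, hbic, ?_, fun t => ?_⟩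
  · push_cast
    have h1 : ((L : ℝ) + 1) * N ≤ 20 * (K * Lg / δ) * ((c + 145) * (K * Lg / δ ^ 2)) :=
      mul_le_mul hL2 hN2 (by positivity) (by positivity)
    have h2 : (K : ℝ) * (((L : ℝ) + 1) * N) ≤
        K * (20 * (K * Lg / δ) * ((c + 145) * (K * Lg / δ ^ 2))) :=
      mul_le_mul_of_nonneg_left h1 (by positivity)
    refine h2.trans ?_
    have h3 : (K : ℝ) * (20 * (K * Lg / δ) * ((c + 145) * (K * Lg / δ ^ 2))) =
        20 * (c + 145) * (K ^ 3 / δ ^ 4) * Lg ^ 2 * δ := by field_simp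
    -- The construction needs only `log²` and `δ⁻³`; the surplus factor `2 Lg/δ ≥ 1` is slack.
    have h4 : 40 * (c + 145) * ((K : ℝ) ^ 3 / δ ^ 4) * Lg ^ 3 =
        20 * (c + 145) * (K ^ 3 / δ ^ 4) * Lg ^ 2 * (2 * Lg) := by ring
    rw [h3, h4]
    exact mul_le_mul_of_nonneg_left (by linarith) (by positivity)
  · refine Filter.Eventually.of_forall fun μ h' hh' i => ?_
    -- States with an unexplored arm have weight zero, so no history in the support can produce
    -- them.
    have hdom : HasDomain Finset.univ (φ h') := by
      by_contra hnd
      have h1 := hlaw μ (φ h')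
      beta_reduce at h1
      rw [if_neg hnd, zero_mul, ENNReal.toReal_eq_zero_iff] at h1
      rcases h1 with h1 | h1
      · rw [pmfExp, ENNReal.tsum_eq_zero] at h1
        have := h1 h'
        rw [if_pos rfl, mul_one] at this
        exact (PMF.mem_support_iff _ _).1 hh' this
      · have h2 : pmfExp (historyLaw alg μ (K * ((L + 1) * N)))
            (fun h => if φ h = φ h' then 1 else 0) ≤ 1 := by
          refine le_trans (pmfExp_mono _ fun a _ => ?_) (pmfExp_const _ 1).le
          split_ifs
          exacts [le_rfl, zero_le]
        rw [h1] at h2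
        exact absurd h2 (by simp)
    have h1 := hcount μ h' hh' i ((hdom i).2 (Finset.mem_univ i))
    refine (h.nTS_le hK hc).trans ((ENNReal.ofReal_le_ofReal hNc).trans ?_)
    rw [ENNReal.ofReal_natCast]
    exact_mod_cast h1
  · rcases lt_or_ge t (K * ((L + 1) * N)) with ht | ht
    · exact isBICAt_congr (fun h' hl => thenThompson_of_lt P alg h' hl) ht (hbic t ht)
    · obtain ⟨n, rfl⟩ := Nat.exists_eq_add_of_le ht
      exact h.isBICAt_thenThompson hK hN144 hlaw n

end IsRegular

theorem exists_easy_algorithm :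
    ∃ c₀ : ℝ, ∀ cTS ≥ c₀, ∀ cPad ≥ c₀, ∃ A : ℝ, ∃ a : ℕ,
      ∀ δ : ℝ, 0 < δ → ∀ C : Set Prior, IsEasy δ C → IsNonDominant δ C →
        ∀ K : ℕ, 2 ≤ K → ∀ P : Fin K → Prior, IsConsistent C P →
          roundsUB cPad P (nTS cTS P) ≤
              ENNReal.ofReal (A * ((K : ℝ) ^ 3 / δ ^ 4) * Real.log (K / δ) ^ a) ∧
            ∃ (T : ℕ) (alg : Algorithm K),
              (T : ℝ) ≤ A * ((K : ℝ) ^ 3 / δ ^ 4) * Real.log (K / δ) ^ a ∧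
                IsBIC P alg T ∧ Collects P alg T (nTS cTS P) ∧
                  ∀ t, IsBICAt P (thenThompson P alg T) t := by
  -- Any nonnegative constants will do, because the block length carries its own term `144`. The
  -- value of `A` dominates both `10 (cTS + cPad + 8)` and `40 (cTS + 145)`.
  refine ⟨0, fun cTS hTS cPad hPad => ⟨40 * (cTS + cPad + 145), 3, ?_⟩⟩
  intro δ hδ C he hd K hK P hP
  have h := isRegular_of_isEasy hδ he hd hP hK
  have hL := h.half_le_log hK
  have hX : 0 ≤ (K : ℝ) ^ 3 / δ ^ 4 := by positivity
  have hLg : 0 ≤ Real.log (K / δ) ^ 3 := by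
    have : 0 ≤ Real.log (K / δ) := by linarith
    positivity
  have hmono : ∀ x y : ℝ, x ≤ y → x * ((K : ℝ) ^ 3 / δ ^ 4) * Real.log (K / δ) ^ 3 ≤
      y * ((K : ℝ) ^ 3 / δ ^ 4) * Real.log (K / δ) ^ 3 := fun x y hxy =>
    mul_le_mul_of_nonneg_right (mul_le_mul_of_nonneg_right hxy hX) hLg
  refine ⟨(h.roundsUB_le hK hTS hPad).trans (ENNReal.ofReal_le_ofReal (hmono _ _ (by linarith))),
    ?_⟩
  obtain ⟨T, alg, hT, hrest⟩ := h.exists_algorithm hK hTS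
  exact ⟨T, alg, hT.trans (hmono _ _ (by linarith)), hrest⟩

end Main

end IncentivizedExploration

theorem theorem5p4 :
    -- (a) the easy case
    (∃ c₀ : ℝ, ∀ cTS ≥ c₀, ∀ cPad ≥ c₀, ∃ A : ℝ, ∃ a : ℕ,
      ∀ δ : ℝ, 0 < δ → ∀ C : Set Prior, IsEasy δ C → IsNonDominant δ C →
        ∀ K : ℕ, 2 ≤ K → ∀ P : Fin K → Prior, IsConsistent C P →
          roundsUB cPad P (nTS cTS P) ≤
              ENNReal.ofReal (A * ((K : ℝ) ^ 3 / δ ^ 4) * Real.log (K / δ) ^ a) ∧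
            ∃ (T : ℕ) (alg : Algorithm K),
              (T : ℝ) ≤ A * ((K : ℝ) ^ 3 / δ ^ 4) * Real.log (K / δ) ^ a ∧
                IsBIC P alg T ∧ Collects P alg T (nTS cTS P) ∧
                  ∀ t, IsBICAt P (thenThompson P alg T) t) ∧
    -- (b) the hard case
    (∀ δ : ℝ, 0 < δ → ∃ c : ℝ, 0 < c ∧
      ∀ C : Set Prior, IsHard δ C → ∀ K : ℕ, 2 ≤ K →
        ∃ P : Fin K → Prior, IsConsistent C P ∧ (Antitone fun i => mean (P i)) ∧
          ENNReal.ofReal (Real.exp (c * K)) < roundsLB P ∧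
            ∀ (T : ℕ) (alg : Algorithm K), IsBIC P alg T → Collects P alg T 1 →
              Real.exp (c * K) < T) ∧
    -- the dichotomy for finite collections
    (∀ C : Set Prior, C.Finite → C.Nonempty → sInf (supSupport '' C) ≠ Phi C →
      ∃ δ : ℝ, 0 < δ ∧ Xor (IsEasy δ C) (IsHard δ C)) :=
  ⟨exists_easy_algorithm, fun _ hδ => exists_hard_instance hδ,
    fun _ hfin hne h => exists_isEasy_xor_isHard hfin hne h⟩
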